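/- **Setting.** Let $1\le m\le q$, $0\le n\le p$, $L$ be integers. For $\ell=1,\dots,L$ let $a_i^{(\ell)},b_i^{(\ell)}\in\mathbb R$, $A_i^{(\ell)},B_i^{(\ell)}>0$, and let $$H_\ell(x)=\frac1{2\pi j}\int_{\mathrm{Re}\,v=c_\ell}\frac{\prod_{i=1}^m\Gamma(b_i^{(\ell)}+B_i^{(\ell)}v)\prod_{i=1}^n\Gamma(1-a_i^{(\ell)}-A_i^{(\ell)}v)}{\prod_{i=n+1}^p\Gamma(a_i^{(\ell)}+A_i^{(\ell)}v)\prod_{i=m+1}^q\Gamma(1-b_i^{(\ell)}-B_i^{(\ell)}v)}\,x^{-v}\,dv$$ be the Fox H-function $H_{p,q}^{m,n}(x)$, where the line $\mathrm{Re}\,v=c_\ell$ has the poles of the factors $\Gamma(b_i+B_iv)$, $i\le m$, on its left and those of $\Gamma(1-a_i-A_iv)$, $i\le n$, on its right, and the integral converges absolutely. Put $\mathcal A_i^{(\ell)}=a_i^{(\ell)}+A_i^{(\ell)}$, $\mathcal B_i^{(\ell)}=b_i^{(\ell)}+B_i^{(\ell)}$, $\beta_{\ell,i}=\mathcal B_i^{(\ell)}/B_i^{(\ell)}$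 and (suppressing the superscripts $(\ell)$ on the right) $$\mathcal F_{\ell,i}=\frac{\prod_{k\le m,\,k\ne i}\Gamma\big(\mathcal B_k-\mathcal B_i\frac{B_k}{B_i}\big)\prod_{k\le n}\Gamma\big(1-\mathcal A_k+\mathcal B_i\frac{A_k}{B_i}\big)}{\mathcal B_i\prod_{k=n+1}^p\Gamma\big(\mathcal A_k-\mathcal B_i\frac{A_k}{B_i}\big)\prod_{k=m+1}^q\Gamma\big(1-\mathcal B_k+\mathcal B_i\frac{B_k}{B_i}\big)} .$$ Assume for every $\ell$ that $\mathcal B_i^{(\ell)}>0$ for $i\le m$; that $\mathcal B_k-\mathcal B_iB_k/B_i\notin\{0,-1,-2,\dots\}$ for distinct $i,k\le m$ (the leading poles are simple); and that $\sum_{i\le n}A_i-\sum_{i>n}A_i+\sum_{i\le m}B_i-\sum_{i>m}B_i>0$ or $\sum_iB_i-\sum_iA_i\ge0$ (the standard condition for the small-argument expansion of the Fox H-function). The ideal SNR $\gamma_{id}$ has on $(0,\infty)$ the probability density $f(x)=\sum_{\ell=1}^L\psi_\ell H_\ell(\phi_\ell x)$ with $\psi_\ell,\phi_\ell>0$. The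 SINR of the impaired system is $\gamma_\varkappa=\omega/(\varrho+\tau/\gamma_{id})$ with $\omega,\varrho,\tau>0$. The symbol error probability is taken in its exponential form $\sum_{k=0}^N\theta_ke^{-\delta_k\gamma}$ with $\theta_k>0$ and $\delta_k\in(0,\infty]$, not all $\delta_k$ infinite, $e^{-\infty}=0$, and $P_s=\mathbb E\big[\sum_{k=0}^N\theta_ke^{-\delta_k\gamma_\varkappa}\big]$ is the ASEP. **Claim.** Let $\phi_\ell\to0$ for all $\ell$ (high SNR), while $f$ remains a probability density, the ratios $\psi_\ell/\phi_\ell$ remain bounded, and everything else is fixed. Then $$P_s\longrightarrow P_s^{\infty}:=\sum_{k=0}^N\theta_k\exp\Big(-\frac{\delta_k\omega}{\varrho}\Big).$$ Moreover, for $x>0$ let $$\mathbf H_\beta(x)=\Big(\frac1{2\pi j}\Big)^2\int_{\mathrm{Re}\,s=\sigma}\int_{\mathrm{Re}\,v=\nu}\frac{\Gamma(1+\beta-s-v)}{\Gamma(2+\beta-s-v)}\,\Gamma(s)\Gamma(v)\Gamma(\beta-v)\,x^{-s}(-1)^{-v}\,dv\,ds ,\qquad (-1)^{-v}=e^{-j\pi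 v},$$ which is the bivariate Fox H-function $H_{1,1:0,1:1,1}^{0,1:1,0:1,1}$ at $(x,-1)$ with parameters $(-\beta;1,1)$, $(-1-\beta;1,1)$ $|$ $-$, $(0,1)$ $|$ $(1-\beta,1)$, $(0,1)$. Suppose that for every $\ell$ and $i\le m$ the lines $\mathrm{Re}\,s=\sigma_{\ell,i}$, $\mathrm{Re}\,v=\nu_{\ell,i}$ satisfy $\sigma_{\ell,i}>0$, $0<\nu_{\ell,i}<\beta_{\ell,i}$, $\sigma_{\ell,i}+\nu_{\ell,i}<1+\beta_{\ell,i}$ and that the double integral $\mathbf H_{\beta_{\ell,i}}(\delta_k\omega/\varrho)$ along them converges absolutely for every $k$ with $\delta_k<\infty$ (such lines exist exactly when $0<\beta_{\ell,i}<1$). Then, with $$R=\frac{\omega}{\varrho}\sum_{\ell=1}^L\frac{\psi_\ell}{\phi_\ell}\sum_{k:\,\delta_k<\infty}\theta_k\delta_k\sum_{i=1}^m\frac{\mathcal F_{\ell,i}}{\Gamma(\beta_{\ell,i})}\Big(\frac{\phi_\ell\tau}{\varrho}\Big)^{\beta_{\ell,i}}\mathbf H_{\beta_{\ell,i}}\Big(\frac{\delta_k\omega}{\varrho}\Big),$$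 one has $$P_s\sim P_s^{\infty}+R\qquad\text{and}\qquad P_s-P_s^{\infty}-R=o\Big(\sum_{\ell=1}^L\frac{\psi_\ell}{\phi_\ell}\sum_{i=1}^m\phi_\ell^{\beta_{\ell,i}}\Big).$$ -/

import Mathlib

open MeasureTheory Filter Topology Asymptotics
open scoped ENNReal

noncomputable section

/-! ### Univariate Fox H-function -/

/-- Parameters `(a_i, A_i)_{i=1:p}`, `(b_i, B_i)_{i=1:q}` of a Fox H-function `H_{p,q}^{m,n}`. -/
structure FoxParams (m n p q : ℕ) where
  a : Fin p → ℝ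
  A : Fin p → ℝ
  b : Fin q → ℝ
  B : Fin q → ℝ

namespace FoxParams

variable {m n p q : ℕ}

/-- The Mellin-Barnes kernel of `H_{p,q}^{m,n}`.
Mathlib's `Complex.Gamma` is `0` at its poles, so that the quotient is `0` at a pole of a
denominator factor, as it should be. -/
def kernel (P : FoxParams m n p q) (v : ℂ) : ℂ :=
  ((∏ i : Fin q with i.val < m, Complex.Gamma (P.b i + P.B i * v)) *
      ∏ i : Fin p with i.val < n, Complex.Gamma (1 - P.a i - P.A i * v)) /
    ((∏ i : Fin p with n ≤ i.val, Complex.Gamma (P.a i + P.A i * v)) *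
      ∏ i : Fin q with m ≤ i.val, Complex.Gamma (1 - P.b i - P.B i * v))

/-- The vertical line `Re v = c` has the poles of `Γ(b_i + B_i v)`, `i ≤ m`, on its left and those
of `Γ(1 - a_i - A_i v)`, `i ≤ n`, on its right. -/
def Separates (P : FoxParams m n p q) (c : ℝ) : Prop :=
  (∀ i : Fin q, i.val < m → 0 < P.b i + P.B i * c) ∧
    ∀ i : Fin p, i.val < n → 0 < 1 - P.a i - P.A i * c

/-- The line `Re v = c` is an admissible contour: it separates the two families of poles and the
Mellin-Barnes integral along it converges (the modulus of `x ^ (-v)` is constant on the line, so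
that convergence does not depend on `x > 0`). -/
def IsContour (P : FoxParams m n p q) (c : ℝ) : Prop :=
  P.Separates c ∧ Complex.VerticalIntegrable P.kernel c

/-- `H_{p,q}^{m,n}(x)`: the Mellin-Barnes integral `(2πj)⁻¹ ∫ kernel(v) x^{-v} dv` along the
upward line `Re v = c`. -/
def foxH (P : FoxParams m n p q) (c x : ℝ) : ℂ := mellinInv c P.kernel x

/-- `𝓐_i = a_i + A_i`. -/
def calA (P : FoxParams m n p q) (i : Fin p) : ℝ := P.a i + P.A i

/-- `𝓑_i = b_i + B_i`. -/
def calB (P : FoxParams m n p q) (i : Fin q) : ℝ := P.b i + P.B i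

/-- The exponent `𝓑_i / B_i`. -/
def expo (P : FoxParams m n p q) (i : Fin q) : ℝ := P.calB i / P.B i

/-- The coefficient `𝓕_i` of the leading power belonging to the `i`-th pole family. -/
def coeffF (P : FoxParams m n p q) (i : Fin q) : ℝ :=
  ((∏ k : Fin q with k.val < m ∧ k ≠ i, Real.Gamma (P.calB k - P.calB i * (P.B k / P.B i))) *
      ∏ k : Fin p with k.val < n, Real.Gamma (1 - P.calA k + P.calB i * (P.A k / P.B i))) /
    (P.calB i *
      (∏ k : Fin p with n ≤ k.val, Real.Gamma (P.calA k - P.calB i * (P.A k / P.B i))) *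
      ∏ k : Fin q with m ≤ k.val, Real.Gamma (1 - P.calB k + P.calB i * (P.B k / P.B i)))

/-- `a* = ∑_{i≤n} A_i - ∑_{i>n} A_i + ∑_{i≤m} B_i - ∑_{i>m} B_i`. -/
def aStar (P : FoxParams m n p q) : ℝ :=
  (∑ i : Fin p with i.val < n, P.A i) - (∑ i : Fin p with n ≤ i.val, P.A i) +
    (∑ i : Fin q with i.val < m, P.B i) - ∑ i : Fin q with m ≤ i.val, P.B i

/-- `Δ = ∑ B_i - ∑ A_i`. -/
def delta (P : FoxParams m n p q) : ℝ := ∑ i, P.B i - ∑ i, P.A i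

end FoxParams

/-! ### Bivariate Fox H-function -/

/-- Parameters of a bivariate Fox H-function
`H_{p₁,q₁:p₂,q₂:p₃,q₃}^{0,n₁:m₂,n₂:m₃,n₃}`: the joint rows `(a_i; α_i, A_i)`, `(b_i; β_i, B_i)` and
the two univariate blocks. -/
structure BivFoxParams (n₁ p₁ q₁ m₂ n₂ p₂ q₂ m₃ n₃ p₃ q₃ : ℕ) where
  a : Fin p₁ → ℝ
  α : Fin p₁ → ℝ
  A : Fin p₁ → ℝ
  b : Fin q₁ → ℝ
  β : Fin q₁ → ℝ
  B : Fin q₁ → ℝ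
  fst : FoxParams m₂ n₂ p₂ q₂
  snd : FoxParams m₃ n₃ p₃ q₃

namespace BivFoxParams

variable {n₁ p₁ q₁ m₂ n₂ p₂ q₂ m₃ n₃ p₃ q₃ : ℕ}

/-- The double Mellin-Barnes kernel. -/
def kernel (P : BivFoxParams n₁ p₁ q₁ m₂ n₂ p₂ q₂ m₃ n₃ p₃ q₃) (s v : ℂ) : ℂ :=
  (∏ i : Fin p₁ with i.val < n₁, Complex.Gamma (1 - P.a i - P.α i * s - P.A i * v)) /
      ((∏ i : Fin p₁ with n₁ ≤ i.val, Complex.Gamma (P.a i + P.α i * s + P.A i * v)) *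
        ∏ i : Fin q₁, Complex.Gamma (1 - P.b i - P.β i * s - P.B i * v)) *
    (P.fst.kernel s * P.snd.kernel v)

/-- `kernel(s, v) x^{-s} y^{-v}` at the point `s = σ + j t`, `v = ν + j u` of the double contour;
powers are principal, so that `(-1)^{-v} = exp(-jπv)`. -/
def integrand (P : BivFoxParams n₁ p₁ q₁ m₂ n₂ p₂ q₂ m₃ n₃ p₃ q₃) (σ ν : ℝ) (x y : ℂ)
    (z : ℝ × ℝ) : ℂ :=
  P.kernel (σ + z.1 * Complex.I) (ν + z.2 * Complex.I) *
    x ^ (-(σ + z.1 * Complex.I)) * y ^ (-(ν + z.2 * Complex.I))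

/-- The lines `Re s = σ`, `Re v = ν` are admissible contours at `(x, y)`: they separate the poles
of the Gamma factors of the numerator and the double Mellin-Barnes integral converges. -/
def IsContour (P : BivFoxParams n₁ p₁ q₁ m₂ n₂ p₂ q₂ m₃ n₃ p₃ q₃) (σ ν : ℝ) (x y : ℂ) : Prop :=
  P.fst.Separates σ ∧ P.snd.Separates ν ∧
    (∀ i : Fin p₁, i.val < n₁ → 0 < 1 - P.a i - P.α i * σ - P.A i * ν) ∧
    Integrable (P.integrand σ ν x y)

/-- The bivariate Fox H-function `(2πj)⁻² ∬ kernel(s, v) x^{-s} y^{-v} ds dv` along the upward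
lines `Re s = σ`, `Re v = ν`. -/
def foxH (P : BivFoxParams n₁ p₁ q₁ m₂ n₂ p₂ q₂ m₃ n₃ p₃ q₃) (σ ν : ℝ) (x y : ℂ) : ℂ :=
  (1 / (2 * (Real.pi : ℂ))) ^ 2 * ∫ z : ℝ × ℝ, P.integrand σ ν x y z

end BivFoxParams

/-- The parameters of
`H_{1,1:0,1:1,1}^{0,1:1,0:1,1}(·,· | (-r;1,1); (-1-r;1,1) | -; (0,1) | (1-r,1); (0,1))`. -/
def asepBivParams (r : ℝ) : BivFoxParams 1 1 1 1 0 0 1 1 1 1 1 where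
  a := ![-r]
  α := ![1]
  A := ![1]
  b := ![-1 - r]
  β := ![1]
  B := ![1]
  fst := { a := ![], A := ![], b := ![0], B := ![1] }
  snd := { a := ![1 - r], A := ![1], b := ![0], B := ![1] }

/-! ### The impaired system -/

variable {m n p q L : ℕ}

/-- The PDF of the ideal SNR on `(0, ∞)`: `f(x) = ∑_ℓ ψ_ℓ H_{p,q}^{m,n}(φ_ℓ x)`. All parameters are
real, hence so is `H`, and taking the real part only changes the type. -/
def snrPdf (P : Fin L → FoxParams m n p q) (c ψ φ : Fin L → ℝ) (x : ℝ) : ℝ :=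
  ∑ ℓ, ψ ℓ * ((P ℓ).foxH (c ℓ) (φ ℓ * x)).re

/-- The law of the ideal SNR. -/
def snrLaw (P : Fin L → FoxParams m n p q) (c ψ φ : Fin L → ℝ) : Measure ℝ :=
  (volume.restrict (Set.Ioi 0)).withDensity fun x => ENNReal.ofReal (snrPdf P c ψ φ x)

/-- The SINR of the impaired system as a function of the ideal SNR. -/
def sinr (ω ϱ τ x : ℝ) : ℝ := ω / (ϱ + τ / x)

/-- `exp(-d x)` for a rate `d ∈ [0, ∞]` and `x > 0`, with `exp(-∞) = 0`. -/
def expNeg (d : ℝ≥0∞) (x : ℝ) : ℝ := if d = ⊤ then 0 else Real.exp (-(d.toReal * x))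

/-- The exponential form `∑_{k=0}^N θ_k exp(-δ_k γ)` of the symbol error probability. -/
def sep {N : ℕ} (θ : Fin (N + 1) → ℝ) (δ : Fin (N + 1) → ℝ≥0∞) (γ : ℝ) : ℝ :=
  ∑ k, θ k * expNeg (δ k) γ

/-- The average symbol error probability: the mean of `sep` over the law of the SINR. -/
def asep (P : Fin L → FoxParams m n p q) (c : Fin L → ℝ) (ω ϱ τ : ℝ) {N : ℕ}
    (θ : Fin (N + 1) → ℝ) (δ : Fin (N + 1) → ℝ≥0∞) (ψ φ : Fin L → ℝ) : ℝ :=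
  ∫ γ, sep θ δ γ ∂((snrLaw P c ψ φ).map (sinr ω ϱ τ))

/-- The ceiling `∑_{k=0}^N θ_k exp(-δ_k ω/ϱ)`. -/
def asepCeiling (ω ϱ : ℝ) {N : ℕ} (θ : Fin (N + 1) → ℝ) (δ : Fin (N + 1) → ℝ≥0∞) : ℝ :=
  ∑ k, θ k * expNeg (δ k) (ω / ϱ)

/-- The correction
`(ω/ϱ) ∑_ℓ (ψ_ℓ/φ_ℓ) ∑_k θ_k δ_k ∑_{i≤m} 𝓕_{ℓ,i} / Γ(𝓑_i/B_i) (φ_ℓ τ/ϱ)^{𝓑_i/B_i} H(δ_k ω/ϱ, -1)`.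
The terms with `δ_k = ∞`, for which the exponential vanishes identically, are absent. -/
def asepCorrection (P : Fin L → FoxParams m n p q) (σ ν : Fin L → Fin q → ℝ) (ω ϱ τ : ℝ) {N : ℕ}
    (θ : Fin (N + 1) → ℝ) (δ : Fin (N + 1) → ℝ≥0∞) (ψ φ : Fin L → ℝ) : ℂ :=
  (ω / ϱ : ℝ) * ∑ ℓ, (ψ ℓ / φ ℓ : ℝ) *
    ∑ k : Fin (N + 1) with δ k ≠ ⊤, (θ k * (δ k).toReal : ℝ) *
      ∑ i : Fin q with i.val < m,
        ((P ℓ).coeffF i / Real.Gamma ((P ℓ).expo i) * (φ ℓ * τ / ϱ) ^ (P ℓ).expo i : ℝ) *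
          (asepBivParams ((P ℓ).expo i)).foxH (σ ℓ i) (ν ℓ i)
            (((δ k).toReal * ω / ϱ : ℝ) : ℂ) (-1)

end

/-! Put a = δ_k ω/ϱ, κ = τ/ϱ and u = x/κ. At ideal SNR x the exponent is δ_k γ = a u/(1+u), so
exp(-δ_k γ) exceeds its limit exp(-a) by `satExp a u`, which lies in [0,1] and is at most a/(1+u).
Hence the ASEP minus its ceiling is Σ_k θ_k ∫ f(x) `satExp a_k (x/κ)` dx over the finite δ_k
(`asep_eq_asepCeiling_add`).

Ceiling: near the origin H_ℓ is at most a constant times x^(β-1), with β the smallest exponent of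
its pole families. The mass of f on (0,M] is therefore at most a constant times Σ (ψ_ℓ/φ_ℓ) φ_ℓ^β,
which vanishes, while beyond M the excess is at most a/(1+M/κ) (`tendsto_integral_mul_satExp_div`).

Correction: moving the Mellin-Barnes contour past its first pole gives H(x) ~ 𝓕 β x^(β-1) at the
origin (`FoxParams.exists_foxH_eq_add_mellinInv`). Dominated convergence transfers this to φ^(1-β) ∫
H(φx) satExp → 𝓕 β ∫ x^(β-1) satExp (`tendsto_rpow_mul_integral_comp_mul`). Simplicity of the poles
excludes ties, so the terms of R with larger exponents are negligible against the leading one. Only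
the leading term has to be matched.

Identification: writing 1/(1+β-s-v) as ∫_0^1 w^(β-s-v) dw decouples the double integral and gives
𝐇_β(a) = Γ(β) ∫_0^1 w^β (1-w)^(-β) e^(-aw) dw (`asepBivParams_foxH_eq`). Integration by parts and w
= u/(1+u) turn this into the integral of u^(β-1) satExp (`mul_integral_rpow_mul_satExp`). The
condition β < 1 needed for both is forced by absolute convergence of the double integral
(`lt_one_of_isContour`).

The contour shift and the criterion β < 1 rest on a two-sided Stirling bound for |Γ(x+jy)|,
`norm_Gamma_bounds`, obtained from log-concavity of x ↦ |Γ(x+jy)|/Γ(x). -/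

/-! ### Stirling bounds for the Gamma function on vertical strips. -/

/-- After division by the right-hand side, this is the sum of two weighted AM-GM inequalities, for
1/(1+X), 1/(1+Y) and for X/(1+X), Y/(1+Y). -/
theorem one_add_rpow_mul_rpow_le {X Y a b : ℝ} (hX : 0 ≤ X) (hY : 0 ≤ Y) (ha : 0 ≤ a) (hb : 0 ≤ b)
    (hab : a + b = 1) : 1 + X ^ a * Y ^ b ≤ (1 + X) ^ a * (1 + Y) ^ b := by
  have hX1 : 0 < 1 + X := by linarith
  have hY1 : 0 < 1 + Y := by linarith
  have h1 := Real.geom_mean_le_arith_mean2_weighted ha hb (inv_nonneg.2 hX1.le)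
    (inv_nonneg.2 hY1.le) hab
  have h2 := Real.geom_mean_le_arith_mean2_weighted ha hb (div_nonneg hX hX1.le)
    (div_nonneg hY hY1.le) hab
  rw [Real.inv_rpow hX1.le, Real.inv_rpow hY1.le] at h1
  rw [Real.div_rpow hX hX1.le, Real.div_rpow hY hY1.le] at h2
  have hp : 0 < (1 + X) ^ a * (1 + Y) ^ b := by positivity
  have h3 : (1 + X ^ a * Y ^ b) / ((1 + X) ^ a * (1 + Y) ^ b) ≤ 1 := by
    calc _ = ((1 + X) ^ a)⁻¹ * ((1 + Y) ^ b)⁻¹ + X ^ a / (1 + X) ^ a * (Y ^ b / (1 + Y) ^ b) := by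
          field_simp
      _ ≤ (a * (1 + X)⁻¹ + b * (1 + Y)⁻¹) + (a * (X / (1 + X)) + b * (Y / (1 + Y))) :=
          add_le_add h1 h2
      _ = a + b := by field_simp; ring
      _ = 1 := hab
  rwa [div_le_one hp] at h3

theorem norm_ofReal_add_mul_I_sq (u y : ℝ) : ‖(u : ℂ) + y * Complex.I‖ ^ 2 = u ^ 2 + y ^ 2 := by
  rw [← Complex.normSq_eq_norm_sq, Complex.normSq_add_mul_I]

theorem norm_ofReal_add_mul_I_pos {u : ℝ} (hu : 0 < u) (y : ℝ) :
    0 < ‖(u : ℂ) + y * Complex.I‖ := by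
  have := norm_ofReal_add_mul_I_sq u y
  rw [norm_pos_iff]
  rintro h
  rw [h] at this
  simp at this
  nlinarith [sq_nonneg y, pow_pos hu 2]

/-- `u ↦ u / |u + j y|` is logarithmically concave on `(0, ∞)`. -/
theorem logConcave_div_norm {u v a b : ℝ} (y : ℝ) (hu : 0 < u) (hv : 0 < v) (ha : 0 ≤ a)
    (hb : 0 ≤ b) (hab : a + b = 1) :
    (u / ‖(u : ℂ) + y * Complex.I‖) ^ a * (v / ‖(v : ℂ) + y * Complex.I‖) ^ b ≤
      (a * u + b * v) / ‖((a * u + b * v : ℝ) : ℂ) + y * Complex.I‖ := by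
  -- With X = (y/u)² and Y = (y/v)² the claim becomes the preceding inequality, combined with u^a
  -- v^b ≤ au + bv.
  have key : ∀ {w : ℝ}, 0 < w → w / ‖(w : ℂ) + y * Complex.I‖ = ((1 + (y / w) ^ 2) ^ (1 / 2 : ℝ))⁻¹ := by
    intro w hw
    have h := norm_ofReal_add_mul_I_sq w y
    have : ‖(w : ℂ) + y * Complex.I‖ = w * Real.sqrt (1 + (y / w) ^ 2) := by
      rw [← Real.sqrt_sq (norm_nonneg _), h, ← Real.sqrt_sq hw.le, ← Real.sqrt_mul (by positivity),
        Real.sqrt_sq hw.le]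
      congr 1
      field_simp
    rw [this, ← Real.sqrt_eq_rpow]
    field_simp
  have hw : 0 < a * u + b * v := by
    rcases ha.eq_or_lt with rfl | ha
    · simp at hab; subst hab; simpa using hv
    · have := mul_pos ha hu; have := mul_nonneg hb hv.le; linarith
  rw [key hu, key hv, key hw, Real.inv_rpow (by positivity), Real.inv_rpow (by positivity),
    ← mul_inv]
  apply inv_anti₀ (by positivity)
  rw [← Real.rpow_mul (by positivity), ← Real.rpow_mul (by positivity), mul_comm (1 / 2) a,
    mul_comm (1 / 2) b, Real.rpow_mul (by positivity), Real.rpow_mul (by positivity),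
    ← Real.mul_rpow (by positivity) (by positivity)]
  apply Real.rpow_le_rpow (by positivity) _ (by norm_num)
  refine le_trans ?_ (one_add_rpow_mul_rpow_le (sq_nonneg _) (sq_nonneg _) ha hb hab)
  gcongr
  have hg := Real.geom_mean_le_arith_mean2_weighted ha hb hu.le hv.le hab
  have hy : (y ^ 2) ^ a * (y ^ 2) ^ b = y ^ 2 := by
    rw [← Real.rpow_add_of_nonneg (by positivity) ha hb, hab, Real.rpow_one]
  rw [div_pow, div_pow, div_pow, Real.div_rpow (by positivity) (by positivity),
    Real.div_rpow (by positivity) (by positivity), div_mul_div_comm, hy,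
    ← Real.rpow_natCast u, ← Real.rpow_natCast v, ← Real.rpow_mul hu.le, ← Real.rpow_mul hv.le,
    mul_comm _ a, mul_comm _ b, Real.rpow_mul hu.le, Real.rpow_mul hv.le, Real.rpow_natCast,
    Real.rpow_natCast, ← mul_pow]
  gcongr

/-- Euler's limit formula for both Gamma functions. The factors n^x n! have the same modulus and
cancel, leaving a product of log-concave factors. -/
theorem tendsto_prod_div_norm_Gamma {x : ℝ} (y : ℝ) (hx : 0 < x) :
    Tendsto (fun n : ℕ => ∏ j ∈ Finset.range (n + 1),
        ((x + j) / ‖((x + j : ℝ) : ℂ) + y * Complex.I‖)) atTop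
      (𝓝 (‖Complex.Gamma (x + y * Complex.I)‖ / Real.Gamma x)) := by
  have h1 := (Complex.GammaSeq_tendsto_Gamma (x + y * Complex.I)).norm
  have h2 := Real.GammaSeq_tendsto_Gamma x
  refine (h1.div h2 (Real.Gamma_pos_of_pos hx).ne').congr' ?_
  filter_upwards [eventually_gt_atTop 0] with n hn
  have hn' : (0 : ℝ) < n := by exact_mod_cast hn
  simp only [Pi.div_apply]
  have hp : (∏ j ∈ Finset.range (n + 1), (x + (j : ℝ))) ≠ 0 :=
    Finset.prod_ne_zero_iff.2 fun j _ => by positivity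
  have hq : (∏ j ∈ Finset.range (n + 1), ‖((x + j : ℝ) : ℂ) + y * Complex.I‖) ≠ 0 :=
    Finset.prod_ne_zero_iff.2 fun j _ => (norm_ofReal_add_mul_I_pos (by positivity) y).ne'
  have e1 : ‖((n : ℝ) : ℂ) ^ ((x : ℂ) + y * Complex.I)‖ = (n : ℝ) ^ x := by
    rw [Complex.norm_cpow_eq_rpow_re_of_pos hn']
    simp
  simp only [Complex.ofReal_natCast] at e1
  rw [Complex.GammaSeq, Real.GammaSeq, norm_div, norm_mul, e1, norm_prod, Finset.prod_div_distrib]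
  have e2 : ∀ j : ℕ, (x : ℂ) + y * Complex.I + j = ((x + j : ℝ) : ℂ) + y * Complex.I := by
    intro j; push_cast; ring
  simp only [e2]
  have hf : ‖((n.factorial : ℕ) : ℂ)‖ = (n.factorial : ℝ) := by simp
  rw [hf]
  have : (n : ℝ) ^ x * (n.factorial : ℝ) ≠ 0 := by positivity
  field_simp

/-- `x ↦ |Γ(x + j y)| / Γ(x)` is logarithmically concave on `(0, ∞)`. -/
theorem logConcave_norm_Gamma_div {u v a b : ℝ} (y : ℝ) (hu : 0 < u) (hv : 0 < v) (ha : 0 ≤ a)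
    (hb : 0 ≤ b) (hab : a + b = 1) :
    (‖Complex.Gamma (u + y * Complex.I)‖ / Real.Gamma u) ^ a *
        (‖Complex.Gamma (v + y * Complex.I)‖ / Real.Gamma v) ^ b ≤
      ‖Complex.Gamma ((a * u + b * v : ℝ) + y * Complex.I)‖ / Real.Gamma (a * u + b * v) := by
  have hw : 0 < a * u + b * v := by
    rcases ha.eq_or_lt with rfl | ha
    · simp at hab; subst hab; simpa using hv
    · have := mul_pos ha hu; have := mul_nonneg hb hv.le; linarith
  refine le_of_tendsto_of_tendsto' (((tendsto_prod_div_norm_Gamma y hu).rpow_const (Or.inr ha)).mul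
    ((tendsto_prod_div_norm_Gamma y hv).rpow_const (Or.inr hb)))
    (tendsto_prod_div_norm_Gamma y hw) fun n => ?_
  rw [← Real.finsetProd_rpow _ _ fun j _ => by positivity,
    ← Real.finsetProd_rpow _ _ fun j _ => by positivity, ← Finset.prod_mul_distrib]
  refine Finset.prod_le_prod (fun j _ => by positivity) fun j _ => ?_
  have h := logConcave_div_norm y (u := u + j) (v := v + j) (by positivity) (by positivity) ha hb hab
  have e : a * (u + j) + b * (v + j) = a * u + b * v + j := by linear_combination (j : ℝ) * hab
  rwa [e] at h

/-- The reflection formula at jy; it anchors the Stirling bound on the line Re = 1. -/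
theorem norm_Gamma_one_add_mul_I_sq {y : ℝ} (hy : 0 < y) :
    ‖Complex.Gamma (1 + y * Complex.I)‖ ^ 2 = Real.pi * y / Real.sinh (Real.pi * y) := by
  have hyI : (y : ℂ) * Complex.I ≠ 0 := by simp [hy.ne']
  have h1 := Complex.Gamma_mul_Gamma_one_sub ((y : ℂ) * Complex.I)
  have h2 : Complex.Gamma (1 + y * Complex.I) = y * Complex.I * Complex.Gamma (y * Complex.I) := by
    rw [add_comm, Complex.Gamma_add_one _ hyI]
  have h3 : Complex.Gamma (1 - y * Complex.I) =
      (starRingEnd ℂ) (Complex.Gamma (1 + y * Complex.I)) := by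
    rw [← Complex.Gamma_conj]; simp [sub_eq_add_neg]
  have h4 : Complex.sin (Real.pi * (y * Complex.I)) = Real.sinh (Real.pi * y) * Complex.I := by
    rw [← mul_assoc, Complex.sin_mul_I]; push_cast; rfl
  have hs : Real.sinh (Real.pi * y) ≠ 0 := (Real.sinh_pos_iff.2 (by positivity)).ne'
  have h5 : Complex.Gamma (1 + y * Complex.I) * (starRingEnd ℂ) (Complex.Gamma (1 + y * Complex.I))
      = ((Real.pi * y / Real.sinh (Real.pi * y) : ℝ) : ℂ) := by
    rw [← h3, h2, mul_assoc, h1, h4]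
    have : ((Real.sinh (Real.pi * y) : ℝ) : ℂ) ≠ 0 := by exact_mod_cast hs
    rw [Complex.ofReal_div, Complex.ofReal_mul]
    field_simp
  rw [Complex.mul_conj, Complex.ofReal_inj, Complex.normSq_eq_norm_sq] at h5
  exact h5

theorem norm_Gamma_one_add_mul_I_bounds {η : ℝ} (hη : 0 < η) : ∃ C, 1 ≤ C ∧ ∀ y : ℝ, η ≤ y →
    C⁻¹ * (y ^ (1 / 2 : ℝ) * Real.exp (-(Real.pi * y / 2))) ≤
        ‖Complex.Gamma (1 + y * Complex.I)‖ ∧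
      ‖Complex.Gamma (1 + y * Complex.I)‖ ≤
        C * (y ^ (1 / 2 : ℝ) * Real.exp (-(Real.pi * y / 2))) := by
  have hπ := Real.pi_pos
  have hπ3 := Real.pi_gt_three
  -- For y ≥ η, sinh(πy) = e^(πy)(1 - e^(-2πy))/2 lies between D e^(πy)/2 and e^(πy)/2.
  set D : ℝ := 1 - Real.exp (-(2 * Real.pi * η)) with hD
  have hD0 : 0 < D := by
    rw [hD, sub_pos, Real.exp_lt_one_iff]; nlinarith
  have hD1 : D ≤ 1 := by rw [hD]; linarith [Real.exp_pos (-(2 * Real.pi * η))]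
  refine ⟨2 * Real.pi / D, ?_, fun y hy => ?_⟩
  · rw [le_div_iff₀ hD0]; linarith
  have hy0 : 0 < y := hη.trans_le hy
  have hsq := norm_Gamma_one_add_mul_I_sq hy0
  set E := y ^ (1 / 2 : ℝ) * Real.exp (-(Real.pi * y / 2)) with hE
  have hE0 : 0 < E := by positivity
  have hE2 : E ^ 2 = y * Real.exp (-(Real.pi * y)) := by
    rw [hE, mul_pow, ← Real.sqrt_eq_rpow, Real.sq_sqrt hy0.le, ← Real.exp_nat_mul]
    congr 2; push_cast; ring
  have hsinh : Real.sinh (Real.pi * y) =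
      Real.exp (Real.pi * y) * (1 - Real.exp (-(2 * Real.pi * y))) / 2 := by
    rw [Real.sinh_eq, mul_sub, ← Real.exp_add]
    congr 2
    · ring
    · congr 1; ring
  have hDy : D ≤ 1 - Real.exp (-(2 * Real.pi * y)) := by
    rw [hD]; gcongr
  have hDy0 := hD0.trans_le hDy
  have hDy1 : 1 - Real.exp (-(2 * Real.pi * y)) ≤ 1 := by linarith [Real.exp_pos (-(2 * Real.pi * y))]
  have hval : ‖Complex.Gamma (1 + y * Complex.I)‖ ^ 2 =
      2 * Real.pi / (1 - Real.exp (-(2 * Real.pi * y))) * E ^ 2 := by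
    rw [hsq, hsinh, hE2, Real.exp_neg (Real.pi * y)]
    generalize 1 - Real.exp (-(2 * Real.pi * y)) = X at hDy0
    field_simp
  have h1C : 1 ≤ 2 * Real.pi / D := by rw [le_div_iff₀ hD0]; linarith
  constructor
  · refine (pow_le_pow_iff_left₀ (by positivity) (norm_nonneg _) two_ne_zero).1 ?_
    rw [hval, mul_pow]
    gcongr
    calc ((2 * Real.pi / D)⁻¹) ^ 2 ≤ 1 := pow_le_one₀ (by positivity) (inv_le_one_of_one_le₀ h1C)
      _ ≤ _ := by rw [le_div_iff₀ hDy0]; linarith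
  · refine (pow_le_pow_iff_left₀ (norm_nonneg _) (by positivity) two_ne_zero).1 ?_
    rw [hval, mul_pow (2 * Real.pi / D) E]
    refine mul_le_mul_of_nonneg_right ?_ (sq_nonneg E)
    calc 2 * Real.pi / (1 - Real.exp (-(2 * Real.pi * y))) ≤ 2 * Real.pi / D := by gcongr
      _ ≤ (2 * Real.pi / D) ^ 2 := le_self_pow₀ h1C two_ne_zero

theorem norm_ofReal_add_mul_I_bounds {η y : ℝ} (x : ℝ) (hη : 0 < η) (hy : η ≤ y) :
    y ≤ ‖(x : ℂ) + y * Complex.I‖ ∧ ‖(x : ℂ) + y * Complex.I‖ ≤ (1 + |x| / η) * y := by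
  have hy0 : 0 < y := hη.trans_le hy
  constructor
  · have := Complex.abs_im_le_norm ((x : ℂ) + y * Complex.I)
    simpa [abs_of_pos hy0] using this
  · refine (norm_add_le _ _).trans ?_
    simp only [Complex.norm_real, norm_mul, Complex.norm_I, mul_one, Real.norm_eq_abs, abs_of_pos hy0]
    have : |x| ≤ |x| / η * y := by
      rw [div_mul_eq_mul_div, le_div_iff₀ hη]; gcongr
    linarith

theorem Real.Gamma_bounds_Icc : ∃ c C : ℝ, 0 < c ∧ 0 < C ∧
    ∀ x ∈ Set.Icc (1 : ℝ) 2, c ≤ Real.Gamma x ∧ Real.Gamma x ≤ C := by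
  have hc : ContinuousOn Real.Gamma (Set.Icc 1 2) := fun x hx =>
    (Real.differentiableAt_Gamma fun m => by
      have : (0 : ℝ) ≤ m := m.cast_nonneg
      linarith [hx.1]).continuousAt.continuousWithinAt
  obtain ⟨x, hx, hmin⟩ := isCompact_Icc.exists_isMinOn (Set.nonempty_Icc.2 one_le_two) hc
  obtain ⟨z, hz, hmax⟩ := isCompact_Icc.exists_isMaxOn (Set.nonempty_Icc.2 one_le_two) hc
  exact ⟨_, _, Real.Gamma_pos_of_pos (by linarith [hx.1]), Real.Gamma_pos_of_pos (by linarith [hz.1]),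
    fun w hw => ⟨hmin hw, hmax hw⟩⟩

/-- An argument in the style of Bohr-Mollerup: log-concavity of q(x) = |Γ(x+jy)|/Γ(x) and the
recurrence q(x+1) = |x+jy| q(x)/x determine q on [1,2] from q(1), up to constants. -/
theorem norm_Gamma_bounds_Icc {η : ℝ} (hη : 0 < η) : ∃ C, 1 ≤ C ∧ ∀ x ∈ Set.Icc (1 : ℝ) 2,
    ∀ y : ℝ, η ≤ y →
    C⁻¹ * (y ^ (x - 1 / 2) * Real.exp (-(Real.pi * y / 2))) ≤
        ‖Complex.Gamma (x + y * Complex.I)‖ ∧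
      ‖Complex.Gamma (x + y * Complex.I)‖ ≤
        C * (y ^ (x - 1 / 2) * Real.exp (-(Real.pi * y / 2))) := by
  obtain ⟨C₁, hC₁, hbase⟩ := norm_Gamma_one_add_mul_I_bounds hη
  obtain ⟨c, C₂, hc, hC₂, hΓ⟩ := Real.Gamma_bounds_Icc
  set D := 1 + 1 / η with hD
  have hD1 : 1 ≤ D := by rw [hD]; have : 0 < 1 / η := by positivity
                         linarith
  have hC₁0 : 0 < C₁ := by linarith
  refine ⟨max 1 (max (C₁ / c) (2 * D ^ 2 * C₁ * C₂)), le_max_left _ _, fun x hx y hy => ?_⟩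
  set C := max 1 (max (C₁ / c) (2 * D ^ 2 * C₁ * C₂))
  have hC : 0 < C := lt_of_lt_of_le one_pos (le_max_left _ _)
  have hy0 : 0 < y := hη.trans_le hy
  obtain ⟨hb1, hb2⟩ := hbase y hy
  obtain ⟨hΓ1, hΓ2⟩ := hΓ x hx
  set q : ℝ → ℝ := fun x => ‖Complex.Gamma (x + y * Complex.I)‖ / Real.Gamma x with hq
  have hΓx : 0 < Real.Gamma x := Real.Gamma_pos_of_pos (by linarith [hx.1])
  have hqx : ‖Complex.Gamma (x + y * Complex.I)‖ = q x * Real.Gamma x := by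
    simp only [hq]; field_simp
  have hnon : ∀ u : ℝ, 0 < u → 0 < q u := fun u hu => by
    refine div_pos (norm_pos_iff.2 (Complex.Gamma_ne_zero_of_re_pos (by simpa using hu)))
      (Real.Gamma_pos_of_pos hu)
  have hsucc : ∀ u : ℝ, 0 < u → q (u + 1) = ‖(u : ℂ) + y * Complex.I‖ / u * q u := by
    intro u hu
    have hne : (u : ℂ) + y * Complex.I ≠ 0 := norm_pos_iff.1 (norm_ofReal_add_mul_I_pos hu y)
    simp only [hq]
    rw [Real.Gamma_add_one hu.ne', show ((u + 1 : ℝ) : ℂ) + y * Complex.I = (u + y * Complex.I) + 1 by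
      push_cast; ring, Complex.Gamma_add_one _ hne, norm_mul]
    have := (Real.Gamma_pos_of_pos hu).ne'
    field_simp
  have hq1 : q 1 = ‖Complex.Gamma (1 + y * Complex.I)‖ := by simp [hq]
  obtain ⟨n1, n2⟩ := norm_ofReal_add_mul_I_bounds 1 hη hy
  obtain ⟨m1, m2⟩ := norm_ofReal_add_mul_I_bounds x hη hy
  simp only [Complex.ofReal_one, abs_one] at n1 n2
  rw [← hD] at n2
  have hq2 : q 2 = ‖(1 : ℂ) + y * Complex.I‖ * q 1 := by
    have := hsucc 1 one_pos
    norm_num at this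
    exact this
  have hq1p := hnon 1 one_pos
  obtain ⟨a, rfl⟩ : ∃ a, x = 1 + a := ⟨x - 1, by ring⟩
  have ha0 : 0 ≤ a := by linarith [hx.1]
  have ha1 : a ≤ 1 := by linarith [hx.2]
  have hEsplit : y ^ (1 + a - 1 / 2) = y ^ a * y ^ (1 / 2 : ℝ) := by
    rw [← Real.rpow_add hy0]; congr 1; ring
  -- lower bound
  have hlow : q 1 * y ^ a ≤ q (1 + a) := by
    -- 1 + a is interpolated between 1 and 2, and q(2) = |1+jy| q(1).
    have h := logConcave_norm_Gamma_div y one_pos two_pos (sub_nonneg.2 ha1) ha0 (sub_add_cancel 1 a)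
    rw [show (1 - a) * 1 + a * 2 = 1 + a by ring] at h
    have h' : q 1 ^ (1 - a) * q 2 ^ a ≤ q (1 + a) := h
    rw [hq2, Real.mul_rpow (norm_nonneg _) hq1p.le] at h'
    calc q 1 * y ^ a ≤ q 1 * ‖(1 : ℂ) + y * Complex.I‖ ^ a := by gcongr
      _ = q 1 ^ (1 - a) * (‖(1 : ℂ) + y * Complex.I‖ ^ a * q 1 ^ a) := by
          rw [mul_comm _ (q 1 ^ a), ← mul_assoc, ← Real.rpow_add hq1p, sub_add_cancel, Real.rpow_one]
      _ ≤ _ := h'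
  -- upper bound
  have hup : q (1 + a) ≤ 2 * D ^ 2 * q 1 * y ^ a := by
    have ha2 : 0 < 1 + a := by linarith
    -- Now 2 is interpolated between 1 and 2 + a. This bounds q(2+a) from above, and the recurrence
    -- brings the bound back to q(1+a).
    have h := logConcave_norm_Gamma_div y one_pos (show 0 < 2 + a by linarith)
      (a := a / (1 + a)) (b := 1 / (1 + a)) (by positivity) (by positivity)
      (by field_simp; ring)
    rw [show a / (1 + a) * 1 + 1 / (1 + a) * (2 + a) = 2 by field_simp; ring] at h
    have h' : q 1 ^ (a / (1 + a)) * q (2 + a) ^ (1 / (1 + a)) ≤ q 2 := h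
    have hq2a := hnon (2 + a) (by linarith)
    have h'' := Real.rpow_le_rpow (by positivity) h' ha2.le
    rw [Real.mul_rpow (by positivity) (by positivity), ← Real.rpow_mul hq1p.le,
      ← Real.rpow_mul hq2a.le, div_mul_cancel₀ _ ha2.ne', div_mul_cancel₀ _ ha2.ne', Real.rpow_one,
      hq2, Real.mul_rpow (norm_nonneg _) hq1p.le, Real.rpow_add hq1p, Real.rpow_one] at h''
    have h3 : q (2 + a) ≤ ‖(1 : ℂ) + y * Complex.I‖ ^ (1 + a) * q 1 := by
      have hpa : 0 < q 1 ^ a := by positivity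
      refine le_of_mul_le_mul_left ?_ hpa
      linarith
    have h4 := hsucc (1 + a) ha2
    rw [show 1 + a + 1 = 2 + a by ring] at h4
    have h5 : y / 2 * q (1 + a) ≤ q (2 + a) := by
      rw [h4]
      have := (hnon (1 + a) ha2).le
      gcongr
      linarith
    have h6 : ‖(1 : ℂ) + y * Complex.I‖ ^ (1 + a) ≤ D ^ 2 * (y * y ^ a) := by
      calc _ ≤ (D * y) ^ (1 + a) := by gcongr
        _ = D ^ (1 + a) * (y * y ^ a) := by
            rw [Real.mul_rpow (by positivity) hy0.le, Real.rpow_add hy0, Real.rpow_one]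
        _ ≤ D ^ 2 * (y * y ^ a) := by
            gcongr
            rw [← Real.rpow_natCast]
            exact Real.rpow_le_rpow_of_exponent_le hD1 (by push_cast; linarith)
    have h7 : y / 2 * q (1 + a) ≤ D ^ 2 * (y * y ^ a) * q 1 :=
      h5.trans (h3.trans (by gcongr))
    refine le_of_mul_le_mul_left ?_ (show 0 < y / 2 by positivity)
    linarith
  rw [hqx, hEsplit]
  rw [← hq1] at hb1 hb2
  set e := Real.exp (-(Real.pi * y / 2))
  have he : 0 < e := Real.exp_pos _
  have hya : 0 < y ^ a := by positivity
  have hyh : 0 < y ^ (1 / 2 : ℝ) := by positivity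
  have hqa := hnon (1 + a) (by linarith)
  constructor
  · have hCc : C₁ / c ≤ C := (le_max_left _ _).trans (le_max_right _ _)
    calc C⁻¹ * (y ^ a * y ^ (1 / 2 : ℝ) * e) ≤ (C₁ / c)⁻¹ * (y ^ a * y ^ (1 / 2 : ℝ) * e) := by gcongr
      _ = c * y ^ a * (C₁⁻¹ * (y ^ (1 / 2 : ℝ) * e)) := by field_simp
      _ ≤ c * y ^ a * q 1 := by gcongr
      _ = (q 1 * y ^ a) * c := by ring
      _ ≤ _ := by gcongr
  · have hCc : 2 * D ^ 2 * C₁ * C₂ ≤ C := (le_max_right _ _).trans (le_max_right _ _)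
    calc _ ≤ (2 * D ^ 2 * q 1 * y ^ a) * C₂ := by gcongr
      _ ≤ (2 * D ^ 2 * (C₁ * (y ^ (1 / 2 : ℝ) * e)) * y ^ a) * C₂ := by gcongr
      _ = (2 * D ^ 2 * C₁ * C₂) * (y ^ a * y ^ (1 / 2 : ℝ) * e) := by ring
      _ ≤ _ := by gcongr

/-- Each induction step widens the strip by one unit on both sides, using Γ(z+1) = zΓ(z) and the
comparability of |z| with y. -/
theorem norm_Gamma_bounds_of_nat {η : ℝ} (hη : 0 < η) (n : ℕ) : ∃ C, 1 ≤ C ∧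
    ∀ x ∈ Set.Icc (1 - n : ℝ) (2 + n), ∀ y : ℝ, η ≤ y →
    C⁻¹ * (y ^ (x - 1 / 2) * Real.exp (-(Real.pi * y / 2))) ≤
        ‖Complex.Gamma (x + y * Complex.I)‖ ∧
      ‖Complex.Gamma (x + y * Complex.I)‖ ≤
        C * (y ^ (x - 1 / 2) * Real.exp (-(Real.pi * y / 2))) := by
  induction n with
  | zero => simpa using norm_Gamma_bounds_Icc hη
  | succ n ih =>
    obtain ⟨C, hC, h⟩ := ih
    have hC0 : 0 < C := by linarith
    set D : ℝ := 1 + (n + 3) / η with hD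
    have hD1 : 1 ≤ D := by
      rw [hD]
      have : 0 < ((n : ℝ) + 3) / η := by positivity
      linarith
    have hD0 : 0 < D := by linarith
    refine ⟨C * D, by nlinarith, fun x hx y hy => ?_⟩
    push_cast at hx
    have hy0 : 0 < y := hη.trans_le hy
    have hE : ∀ z : ℝ, 0 < y ^ z * Real.exp (-(Real.pi * y / 2)) := fun z => by positivity
    have hsucc : ∀ u : ℝ, ‖Complex.Gamma ((u + 1 : ℝ) + y * Complex.I)‖ =
        ‖(u : ℂ) + y * Complex.I‖ * ‖Complex.Gamma (u + y * Complex.I)‖ := by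
      intro u
      have hne : (u : ℂ) + y * Complex.I ≠ 0 := by
        intro h0
        have := congrArg Complex.im h0
        simp at this
        exact hy0.ne' this
      rw [show ((u + 1 : ℝ) : ℂ) + y * Complex.I = (u + y * Complex.I) + 1 by push_cast; ring,
        Complex.Gamma_add_one _ hne, norm_mul]
    have hn : ∀ u : ℝ, |u| ≤ n + 3 → y ≤ ‖(u : ℂ) + y * Complex.I‖ ∧
        ‖(u : ℂ) + y * Complex.I‖ ≤ D * y := fun u hu => by
      obtain ⟨h1, h2⟩ := norm_ofReal_add_mul_I_bounds u hη hy
      refine ⟨h1, h2.trans ?_⟩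
      rw [hD]; gcongr
    have hn0 : (0 : ℝ) ≤ n := n.cast_nonneg
    by_cases h1 : x < 1 - n
    · obtain ⟨l, u⟩ := h (x + 1) ⟨by linarith [hx.1], by linarith⟩ y hy
      obtain ⟨n1, n2⟩ := hn x (by rw [abs_le]; constructor <;> linarith [hx.1])
      have hN : 0 < ‖(x : ℂ) + y * Complex.I‖ := hy0.trans_le n1
      rw [hsucc, show x + 1 - 1 / 2 = 1 + (x - 1 / 2) by ring, Real.rpow_add hy0, Real.rpow_one] at l u
      set G := ‖Complex.Gamma (x + y * Complex.I)‖
      set E := y ^ (x - 1 / 2) * Real.exp (-(Real.pi * y / 2)) with hEdef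
      have hEE := hE (x - 1 / 2)
      rw [← hEdef] at hEE
      rw [mul_assoc y] at l u
      rw [← hEdef] at l u
      constructor
      · refine le_of_mul_le_mul_left ?_ (mul_pos hD0 hy0)
        calc D * y * ((C * D)⁻¹ * E) = C⁻¹ * (y * E) := by field_simp
          _ ≤ _ := l
          _ ≤ D * y * G := by gcongr
      · refine le_of_mul_le_mul_left ?_ hy0
        calc y * G ≤ ‖(x : ℂ) + y * Complex.I‖ * G := by gcongr
          _ ≤ C * (y * E) := u
          _ ≤ (C * (y * E)) * D := le_mul_of_one_le_right (by positivity) hD1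
          _ = _ := by ring
    · by_cases h2 : 2 + n < x
      · obtain ⟨l, u⟩ := h (x - 1) ⟨by linarith, by linarith [hx.2]⟩ y hy
        obtain ⟨n1, n2⟩ := hn (x - 1) (by rw [abs_le]; constructor <;> linarith [hx.2])
        have hs := hsucc (x - 1)
        rw [sub_add_cancel] at hs
        rw [hs, show x - 1 / 2 = 1 + (x - 1 - 1 / 2) by ring, Real.rpow_add hy0, Real.rpow_one,
          mul_assoc y]
        set G := ‖Complex.Gamma ((x - 1 : ℝ) + y * Complex.I)‖
        set E := y ^ (x - 1 - 1 / 2) * Real.exp (-(Real.pi * y / 2)) with hEdef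
        have hEE := hE (x - 1 - 1 / 2)
        rw [← hEdef] at hEE
        constructor
        · calc (C * D)⁻¹ * (y * E) = D⁻¹ * (y * (C⁻¹ * E)) := by field_simp
            _ ≤ 1 * (y * (C⁻¹ * E)) := by gcongr; exact inv_le_one_of_one_le₀ hD1
            _ = y * (C⁻¹ * E) := one_mul _
            _ ≤ _ := by gcongr
        · calc _ ≤ (D * y) * (C * E) := by gcongr
            _ = _ := by ring
      · obtain ⟨l, u⟩ := h x ⟨not_lt.1 h1, not_lt.1 h2⟩ y hy
        have hEE := hE (x - 1 / 2)
        constructor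
        · refine le_trans ?_ l
          gcongr
          nlinarith
        · refine u.trans ?_
          gcongr
          nlinarith

/-- Two-sided Stirling bound for the Gamma function, uniform on bounded vertical strips away from
the real axis. -/
theorem norm_Gamma_bounds (R : ℝ) {η : ℝ} (hη : 0 < η) : ∃ C, 1 ≤ C ∧
    ∀ x : ℝ, |x| ≤ R → ∀ y : ℝ, η ≤ |y| →
    C⁻¹ * (|y| ^ (x - 1 / 2) * Real.exp (-(Real.pi * |y| / 2))) ≤
        ‖Complex.Gamma (x + y * Complex.I)‖ ∧
      ‖Complex.Gamma (x + y * Complex.I)‖ ≤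
        C * (|y| ^ (x - 1 / 2) * Real.exp (-(Real.pi * |y| / 2))) := by
  obtain ⟨n, hn⟩ := exists_nat_ge (R + 1)
  obtain ⟨C, hC, h⟩ := norm_Gamma_bounds_of_nat hη n
  refine ⟨C, hC, fun x hx y hy => ?_⟩
  have hx' := abs_le.1 hx
  have key := h x ⟨by linarith, by linarith⟩ |y| hy
  suffices ‖Complex.Gamma (x + y * Complex.I)‖ = ‖Complex.Gamma (x + |y| * Complex.I)‖ by
    rwa [this]
  rcases abs_cases y with ⟨e, -⟩ | ⟨e, -⟩
  · rw [e]
  · rw [e, ← Complex.norm_conj, ← Complex.Gamma_conj]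
    simp

/-! ### Growth and decay orders along vertical lines. -/

/-- On the strip `l ≤ Re s ≤ r` and away from the real axis, `|f(σ + j t)|` is comparable to
`|t| ^ (e + d σ) exp (-κ |t|)`. -/
def HasVerticalOrder (f : ℂ → ℂ) (l r e d κ : ℝ) : Prop :=
  ∃ C, 1 ≤ C ∧ ∀ σ ∈ Set.Icc l r, ∀ t : ℝ, 1 ≤ |t| →
    C⁻¹ * (|t| ^ (e + d * σ) * Real.exp (-(κ * |t|))) ≤ ‖f (σ + t * Complex.I)‖ ∧
      ‖f (σ + t * Complex.I)‖ ≤ C * (|t| ^ (e + d * σ) * Real.exp (-(κ * |t|)))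

namespace HasVerticalOrder

variable {f g : ℂ → ℂ} {l r e d κ e' d' κ' : ℝ}

theorem one (l r : ℝ) : HasVerticalOrder (fun _ => 1) l r 0 0 0 :=
  ⟨1, le_rfl, fun σ _ t _ => by simp⟩

theorem mul (hf : HasVerticalOrder f l r e d κ) (hg : HasVerticalOrder g l r e' d' κ') :
    HasVerticalOrder (fun s => f s * g s) l r (e + e') (d + d') (κ + κ') := by
  obtain ⟨C, hC, h⟩ := hf
  obtain ⟨C', hC', h'⟩ := hg
  refine ⟨C * C', one_le_mul_of_one_le_of_one_le hC hC', fun σ hσ t ht => ?_⟩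
  obtain ⟨a, b⟩ := h σ hσ t ht
  obtain ⟨a', b'⟩ := h' σ hσ t ht
  have ht0 : 0 < |t| := by linarith
  have hE : |t| ^ (e + e' + (d + d') * σ) * Real.exp (-((κ + κ') * |t|)) =
      (|t| ^ (e + d * σ) * Real.exp (-(κ * |t|))) *
        (|t| ^ (e' + d' * σ) * Real.exp (-(κ' * |t|))) := by
    rw [mul_mul_mul_comm, ← Real.rpow_add ht0, ← Real.exp_add]
    congr 2 <;> ring
  rw [hE, norm_mul]
  constructor
  · rw [mul_inv, mul_mul_mul_comm]
    gcongr
  · rw [mul_mul_mul_comm]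
    gcongr

theorem inv (hf : HasVerticalOrder f l r e d κ) :
    HasVerticalOrder (fun s => (f s)⁻¹) l r (-e) (-d) (-κ) := by
  obtain ⟨C, hC, h⟩ := hf
  refine ⟨C, hC, fun σ hσ t ht => ?_⟩
  obtain ⟨a, b⟩ := h σ hσ t ht
  have ht0 : 0 < |t| := by linarith
  have hE : |t| ^ (-e + -d * σ) * Real.exp (-(-κ * |t|)) =
      (|t| ^ (e + d * σ) * Real.exp (-(κ * |t|)))⁻¹ := by
    rw [mul_inv, ← Real.rpow_neg ht0.le, ← Real.exp_neg]
    congr 2 <;> ring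
  rw [hE, norm_inv, ← mul_inv]
  have hEp : 0 < |t| ^ (e + d * σ) * Real.exp (-(κ * |t|)) := by positivity
  have hC0 : 0 < C := by linarith
  have hf0 : 0 < ‖f (σ + t * Complex.I)‖ := lt_of_lt_of_le (by positivity) a
  constructor
  · exact inv_anti₀ hf0 b
  · have := inv_anti₀ (by positivity) a
    rwa [mul_inv, inv_inv] at this

theorem prod {α : Type*} (s : Finset α) {f : α → ℂ → ℂ} {e d κ : α → ℝ}
    (h : ∀ i ∈ s, HasVerticalOrder (f i) l r (e i) (d i) (κ i)) :
    HasVerticalOrder (fun z => ∏ i ∈ s, f i z) l r (∑ i ∈ s, e i) (∑ i ∈ s, d i)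
      (∑ i ∈ s, κ i) := by
  classical
  induction s using Finset.induction_on with
  | empty => simpa using one l r
  | insert a s ha ih =>
    simp only [Finset.prod_insert ha, Finset.sum_insert ha]
    exact (h a (Finset.mem_insert_self _ _)).mul
      (ih fun i hi => h i (Finset.mem_insert_of_mem hi))

theorem congr (hf : HasVerticalOrder f l r e d κ) (he : e = e') (hd : d = d') (hκ : κ = κ')
    (hfg : ∀ s, f s = g s) : HasVerticalOrder g l r e' d' κ' := by
  obtain rfl : f = g := funext hfg
  subst he hd hκ
  exact hf

end HasVerticalOrder

theorem Real.rpow_bounds_of_abs_le {x R : ℝ} (hx : 0 < x) {z : ℝ} (hz : |z| ≤ R) :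
    (Real.exp (|Real.log x| * R))⁻¹ ≤ x ^ z ∧ x ^ z ≤ Real.exp (|Real.log x| * R) := by
  have h : |Real.log x * z| ≤ |Real.log x| * R := by
    rw [abs_mul]; gcongr
  obtain ⟨h1, h2⟩ := abs_le.1 h
  rw [Real.rpow_def_of_pos hx, ← Real.exp_neg]
  exact ⟨Real.exp_le_exp.2 h1, Real.exp_le_exp.2 h2⟩

theorem hasVerticalOrder_Gamma (l r a : ℝ) {b : ℝ} (hb : b ≠ 0) :
    HasVerticalOrder (fun s => Complex.Gamma (a + b * s)) l r (a - 1 / 2) b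
      (Real.pi / 2 * |b|) := by
  set R := |a| + |b| * (|l| + |r|) with hR
  obtain ⟨C, hC, h⟩ := norm_Gamma_bounds R (abs_pos.2 hb)
  set M := Real.exp (|Real.log (|b|)| * (R + 1)) with hM
  have hM1 : 1 ≤ M := Real.one_le_exp (by positivity)
  have hM0 : 0 < M := by linarith
  refine ⟨C * M, one_le_mul_of_one_le_of_one_le hC hM1, fun σ hσ t ht => ?_⟩
  have ht0 : 0 < |t| := by linarith
  have hσa : |σ| ≤ |l| + |r| := by
    rw [abs_le]
    constructor
    · linarith [neg_abs_le l, abs_nonneg r, hσ.1]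
    · linarith [le_abs_self r, abs_nonneg l, hσ.2]
  have hx : |a + b * σ| ≤ R := by
    refine (abs_add_le _ _).trans ?_
    rw [abs_mul, hR]
    gcongr
  have hz : |a + b * σ - 1 / 2| ≤ R + 1 := by
    refine (abs_sub _ _).trans ?_
    have : |(1 / 2 : ℝ)| ≤ 1 := by norm_num [abs_of_pos]
    linarith
  obtain ⟨h1, h2⟩ := h (a + b * σ) hx (b * t) (by
    rw [abs_mul]; exact le_mul_of_one_le_right (abs_nonneg b) ht)
  obtain ⟨m1, m2⟩ := Real.rpow_bounds_of_abs_le (abs_pos.2 hb) hz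
  rw [← hM] at m1 m2
  have e1 : ((a + b * σ : ℝ) : ℂ) + (b * t : ℝ) * Complex.I = a + b * (σ + t * Complex.I) := by
    push_cast; ring
  have e2 : Real.exp (-(Real.pi * |b * t| / 2)) = Real.exp (-(Real.pi / 2 * |b| * |t|)) := by
    rw [abs_mul]; congr 1; ring
  rw [e1, e2, abs_mul, Real.mul_rpow (abs_nonneg b) (abs_nonneg t)] at h1 h2
  rw [show a - 1 / 2 + b * σ = a + b * σ - 1 / 2 by ring]
  have hC0 : 0 < C := by linarith
  constructor
  · refine le_trans ?_ h1
    rw [mul_inv, mul_assoc, mul_assoc (|b| ^ _)]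
    gcongr
  · refine h2.trans ?_
    rw [mul_assoc (|b| ^ _), mul_assoc C M]
    gcongr

theorem rpow_mul_exp_neg_le (p : ℝ) {κ : ℝ} (hκ : 0 < κ) : ∃ C, 0 < C ∧ ∀ p' ≤ p, ∀ t : ℝ, 1 ≤ t →
    t ^ p' * Real.exp (-(κ * t)) ≤ C := by
  obtain ⟨n, hn⟩ := exists_nat_ge p
  refine ⟨n.factorial / κ ^ n, by positivity, fun p' hp' t ht => ?_⟩
  have ht0 : 0 < t := by linarith
  have h := Real.pow_div_factorial_le_exp (κ * t) (by positivity) n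
  rw [Real.exp_neg, ← div_eq_mul_inv, div_le_iff₀ (Real.exp_pos _)]
  calc t ^ p' ≤ t ^ (n : ℝ) := Real.rpow_le_rpow_of_exponent_le ht (hp'.trans hn)
    _ = n.factorial / κ ^ n * ((κ * t) ^ n / n.factorial) := by
        rw [Real.rpow_natCast, mul_pow]; field_simp
    _ ≤ _ := by gcongr

/-- The lower half of the two-sided bound converts convergence of the integral on one line into
information about the exponents. -/
theorem HasVerticalOrder.of_verticalIntegrable {f : ℂ → ℂ} {l r e d κ c : ℝ}
    (hf : HasVerticalOrder f l r e d κ) (hc : c ∈ Set.Icc l r)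
    (hint : Complex.VerticalIntegrable f c) : 0 < κ ∨ (κ = 0 ∧ e + d * c < -1) := by
  obtain ⟨C, hC, h⟩ := hf
  have hC0 : 0 < C := by linarith
  rcases lt_or_ge 0 κ with hκ | hκ
  · exact Or.inl hκ
  right
  have hint' : IntegrableOn (fun t : ℝ => f (c + t * Complex.I)) (Set.Ioi 1) :=
    Integrable.integrableOn hint
  -- A power lying below the modulus up to a constant is integrable on (1,∞). Taking p = e + dc
  -- settles κ = 0, and p = 0 gives a contradiction when κ < 0.
  have key : ∀ p a : ℝ, 0 < a → (∀ t : ℝ, 1 ≤ t →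
      a * t ^ p ≤ t ^ (e + d * c) * Real.exp (-(κ * t))) → p < -1 := by
    intro p a ha hle
    have : IntegrableOn (fun t : ℝ => t ^ p) (Set.Ioi 1) := by
      refine Integrable.mono' (hint'.norm.const_mul (C / a)) (by fun_prop) ?_
      refine (ae_restrict_iff' measurableSet_Ioi).2 (ae_of_all _ fun t ht => ?_)
      have ht' : (1 : ℝ) < t := ht
      have ht0 : (0 : ℝ) < t := by linarith
      have h1 := (h c hc t (by rw [abs_of_pos ht0]; exact ht'.le)).1
      rw [abs_of_pos ht0] at h1
      have h2 := hle t ht'.le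
      rw [Real.norm_of_nonneg (by positivity)]
      calc t ^ p = C / a * (C⁻¹ * (a * t ^ p)) := by field_simp
        _ ≤ C / a * (C⁻¹ * (t ^ (e + d * c) * Real.exp (-(κ * t)))) := by gcongr
        _ ≤ _ := by gcongr
    exact (integrableOn_Ioi_rpow_iff one_pos).1 this
  rcases hκ.eq_or_lt with rfl | hκ
  · exact ⟨rfl, key _ 1 one_pos fun t _ => by simp⟩
  · exfalso
    obtain ⟨D, hD, hb⟩ := rpow_mul_exp_neg_le (-(e + d * c)) (neg_pos.2 hκ)
    have := key 0 D⁻¹ (by positivity) fun t ht => by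
      have ht0 : 0 < t := by linarith
      have h1 := hb _ le_rfl t ht
      rw [Real.rpow_neg ht0.le, neg_mul, neg_neg] at h1
      have h2 : Real.exp (κ * t) ≤ D * t ^ (e + d * c) := by
        rwa [inv_mul_le_iff₀ (by positivity), mul_comm (t ^ _)] at h1
      rw [Real.rpow_zero, mul_one, Real.exp_neg]
      have h3 : 0 < Real.exp (κ * t) := Real.exp_pos _
      rw [← div_eq_mul_inv, le_div_iff₀ h3, inv_mul_le_iff₀ hD]
      exact h2
    linarith

/-- A function of vertical order `κ > 0`, or decaying along `Re s = c` and not growing when moving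
to the left of this line, decays uniformly on strips to the left of this line. -/
theorem HasVerticalOrder.exists_bound {f : ℂ → ℂ} {l c e d κ : ℝ}
    (hf : HasVerticalOrder f l c e d κ) (hd : 0 < κ ∨ (κ = 0 ∧ e + d * c < -1 ∧ 0 ≤ d)) :
    ∃ C ρ : ℝ, 1 < ρ ∧ 0 < C ∧ ∀ σ ∈ Set.Icc l c, ∀ t : ℝ, 1 ≤ |t| →
      ‖f (σ + t * Complex.I)‖ ≤ C * |t| ^ (-ρ) := by
  obtain ⟨C, hC, h⟩ := hf
  have hC0 : 0 < C := by linarith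
  rcases hd with hκ | ⟨rfl, hlt, hd⟩
  · obtain ⟨D, hD, hb⟩ := rpow_mul_exp_neg_le (|e| + |d| * (|l| + |c|) + 2) hκ
    refine ⟨C * D, 2, one_lt_two, by positivity, fun σ hσ t ht => ?_⟩
    have ht0 : 0 < |t| := by linarith
    refine (h σ hσ t ht).2.trans ?_
    rw [mul_assoc]
    refine mul_le_mul_of_nonneg_left ?_ hC0.le
    have hσa : |σ| ≤ |l| + |c| := by
      rw [abs_le]
      constructor
      · linarith [neg_abs_le l, abs_nonneg c, hσ.1]
      · linarith [le_abs_self c, abs_nonneg l, hσ.2]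
    have hx : e + d * σ + 2 ≤ |e| + |d| * (|l| + |c|) + 2 := by
      have h1 : d * σ ≤ |d| * |σ| := by rw [← abs_mul]; exact le_abs_self _
      have h2 : |d| * |σ| ≤ |d| * (|l| + |c|) := by gcongr
      linarith [le_abs_self e]
    have := hb _ hx (|t|) ht
    rw [Real.rpow_add ht0] at this
    rw [Real.rpow_neg ht0.le, ← div_eq_mul_inv, le_div_iff₀ (by positivity)]
    linarith
  · refine ⟨C, -(e + d * c), by linarith, hC0, fun σ hσ t ht => ?_⟩
    refine (h σ hσ t ht).2.trans ?_
    rw [neg_neg]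
    simp only [zero_mul, neg_zero, Real.exp_zero, mul_one]
    gcongr
    exact hσ.2

/-! ### Decay of the Fox kernel to the left of its contour. -/

namespace FoxParams

variable {m n p q : ℕ}

/-- The exponent at `Re v = 0` of the growth of the kernel along vertical lines. -/
noncomputable def verticalExponent (P : FoxParams m n p q) : ℝ :=
  (∑ i : Fin q with i.val < m, (P.b i - 1 / 2)) + (∑ i : Fin p with i.val < n, (1 - P.a i - 1 / 2)) -
    ((∑ i : Fin p with n ≤ i.val, (P.a i - 1 / 2)) +
      ∑ i : Fin q with m ≤ i.val, (1 - P.b i - 1 / 2))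

theorem hasVerticalOrder_kernel (P : FoxParams m n p q) (hA : ∀ i, 0 < P.A i) (hB : ∀ i, 0 < P.B i)
    (l r : ℝ) : HasVerticalOrder P.kernel l r P.verticalExponent P.delta
      (Real.pi / 2 * P.aStar) := by
  have h1 : ∀ i ∈ ({i : Fin q | i.val < m} : Finset (Fin q)), HasVerticalOrder
      (fun v => Complex.Gamma (P.b i + P.B i * v)) l r (P.b i - 1 / 2) (P.B i)
        (Real.pi / 2 * P.B i) := fun i _ => by
    simpa [abs_of_pos (hB i)] using hasVerticalOrder_Gamma l r (P.b i) (hB i).ne'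
  have h2 : ∀ i ∈ ({i : Fin p | i.val < n} : Finset (Fin p)), HasVerticalOrder
      (fun v => Complex.Gamma (1 - P.a i - P.A i * v)) l r (1 - P.a i - 1 / 2) (-P.A i)
        (Real.pi / 2 * P.A i) := fun i _ => by
    simpa [abs_of_pos (hA i), sub_eq_add_neg] using
      hasVerticalOrder_Gamma l r (1 - P.a i) (neg_ne_zero.2 (hA i).ne')
  have h3 : ∀ i ∈ ({i : Fin p | n ≤ i.val} : Finset (Fin p)), HasVerticalOrder
      (fun v => Complex.Gamma (P.a i + P.A i * v)) l r (P.a i - 1 / 2) (P.A i)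
        (Real.pi / 2 * P.A i) := fun i _ => by
    simpa [abs_of_pos (hA i)] using hasVerticalOrder_Gamma l r (P.a i) (hA i).ne'
  have h4 : ∀ i ∈ ({i : Fin q | m ≤ i.val} : Finset (Fin q)), HasVerticalOrder
      (fun v => Complex.Gamma (1 - P.b i - P.B i * v)) l r (1 - P.b i - 1 / 2) (-P.B i)
        (Real.pi / 2 * P.B i) := fun i _ => by
    simpa [abs_of_pos (hB i), sub_eq_add_neg] using
      hasVerticalOrder_Gamma l r (1 - P.b i) (neg_ne_zero.2 (hB i).ne')
  refine (((HasVerticalOrder.prod _ h1).mul (HasVerticalOrder.prod _ h2)).mul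
    ((HasVerticalOrder.prod _ h3).mul (HasVerticalOrder.prod _ h4)).inv).congr ?_ ?_ ?_ ?_
  · simp only [verticalExponent]; ring
  · have hq := Finset.sum_filter_add_sum_filter_not Finset.univ (fun i : Fin q => i.val < m) P.B
    have hp := Finset.sum_filter_add_sum_filter_not Finset.univ (fun i : Fin p => i.val < n) P.A
    simp only [not_lt] at hq hp
    rw [delta, ← hq, ← hp, Finset.sum_neg_distrib, Finset.sum_neg_distrib]
    ring
  · simp only [aStar, ← Finset.mul_sum]; ring
  · intro s; rw [kernel, div_eq_mul_inv]

/-- If a* > 0 the decay is exponential. Otherwise Δ ≥ 0, and convergence on Re v = c gives either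
exponential decay or a power below -1 that does not grow as the line moves left. -/
theorem kernel_bound (P : FoxParams m n p q) (hA : ∀ i, 0 < P.A i) (hB : ∀ i, 0 < P.B i)
    {l c : ℝ} (hlc : l ≤ c) (hint : Complex.VerticalIntegrable P.kernel c)
    (hΔ : 0 < P.aStar ∨ 0 ≤ P.delta) :
    ∃ C ρ : ℝ, 1 < ρ ∧ 0 < C ∧ ∀ σ ∈ Set.Icc l c, ∀ t : ℝ, 1 ≤ |t| →
      ‖P.kernel (σ + t * Complex.I)‖ ≤ C * |t| ^ (-ρ) := by
  have hK := P.hasVerticalOrder_kernel hA hB l c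
  refine hK.exists_bound ?_
  rcases hΔ with h | h
  · have := Real.pi_pos
    exact Or.inl (by positivity)
  · exact (hK.of_verticalIntegrable (Set.right_mem_Icc.2 hlc) hint).imp_right fun h' =>
      ⟨h'.1, h'.2, h⟩

end FoxParams

/-! ### Contour shifts and the Cahen-Mellin integral. -/

theorem integrable_of_continuous_of_norm_le_rpow {g : ℝ → ℂ} {C ρ : ℝ} (hg : Continuous g)
    (hρ : 1 < ρ) (hC : 0 < C) (h : ∀ t : ℝ, 1 ≤ |t| → ‖g t‖ ≤ C * |t| ^ (-ρ)) : Integrable g := by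
  obtain ⟨M, hM⟩ := (isCompact_Icc (a := (-1 : ℝ)) (b := 1)).exists_bound_of_continuousOn
    hg.continuousOn
  have hint : Integrable (fun t : ℝ => (1 + ‖t‖) ^ (-ρ)) :=
    integrable_one_add_norm (by simpa using hρ)
  refine (hint.const_mul (max C M * 2 ^ ρ)).mono' hg.aestronglyMeasurable (ae_of_all _ fun t => ?_)
  have h2 : (2 : ℝ) ^ ρ * (1 + ‖t‖) ^ (-ρ) = ((1 + |t|) / 2) ^ (-ρ) := by
    have : 0 ≤ 1 + |t| := by positivity
    rw [Real.norm_eq_abs, Real.div_rpow this two_pos.le, Real.rpow_neg two_pos.le,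
      Real.rpow_neg this]
    field_simp
  rw [mul_assoc, h2]
  have hmax : 0 < max C M := lt_max_of_lt_left hC
  rcases le_total 1 |t| with ht | ht
  · refine (h t ht).trans ?_
    gcongr ?_ * ?_
    · exact le_max_left _ _
    · exact Real.rpow_le_rpow_of_nonpos (by positivity) (by linarith) (by linarith)
  · refine (hM t (abs_le.1 ht)).trans ((le_max_right C M).trans ?_)
    refine le_mul_of_one_le_right hmax.le ?_
    exact Real.one_le_rpow_of_pos_of_le_one_of_nonpos (by positivity) (by linarith) (by linarith)

section Shift

variable {Φ : ℂ → ℂ} {l c C ρ : ℝ} {z : ℂ}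

theorem verticalIntegrable_of_bound {σ : ℝ} (hcont : ∀ v : ℂ, v.re = σ → ContinuousAt Φ v)
    (hρ : 1 < ρ) (hC : 0 < C)
    (hb : ∀ t : ℝ, 1 ≤ |t| → ‖Φ (σ + t * Complex.I)‖ ≤ C * |t| ^ (-ρ)) :
    Complex.VerticalIntegrable Φ σ := by
  refine integrable_of_continuous_of_norm_le_rpow ?_ hρ hC hb
  refine continuous_iff_continuousAt.2 fun t => ?_
  exact ContinuousAt.comp (f := fun t : ℝ => (σ : ℂ) + t * Complex.I) (hcont _ (by simp))
    (by fun_prop)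

/-- Cauchy's theorem on the rectangle of height 2T; the horizontal sides contribute at most C T^(-ρ)
|c - l|. Differentiability may fail at z, which will be the removed pole, where continuity is
enough. -/
theorem integral_vertical_eq_of_bound (hlc : l ≤ c)
    (hcont : ∀ v : ℂ, v.re ∈ Set.Icc l c → ContinuousAt Φ v)
    (hdiff : ∀ v : ℂ, v.re ∈ Set.Ioo l c → v ≠ z → DifferentiableAt ℂ Φ v)
    (hρ : 1 < ρ) (hC : 0 < C)
    (hb : ∀ σ ∈ Set.Icc l c, ∀ t : ℝ, 1 ≤ |t| → ‖Φ (σ + t * Complex.I)‖ ≤ C * |t| ^ (-ρ)) :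
    ∫ t : ℝ, Φ (l + t * Complex.I) = ∫ t : ℝ, Φ (c + t * Complex.I) := by
  have hl : Complex.VerticalIntegrable Φ l := verticalIntegrable_of_bound
    (fun v hv => hcont v (by rw [hv]; exact Set.left_mem_Icc.2 hlc)) hρ hC
    (hb l (Set.left_mem_Icc.2 hlc))
  have hc : Complex.VerticalIntegrable Φ c := verticalIntegrable_of_bound
    (fun v hv => hcont v (by rw [hv]; exact Set.right_mem_Icc.2 hlc)) hρ hC
    (hb c (Set.right_mem_Icc.2 hlc))
  have tl := intervalIntegral_tendsto_integral hl tendsto_neg_atTop_atBot tendsto_id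
  have tc := intervalIntegral_tendsto_integral hc tendsto_neg_atTop_atBot tendsto_id
  have hrect : ∀ T : ℝ, 0 < T →
      (∫ x : ℝ in l..c, Φ (x + (-T : ℝ) * Complex.I)) - (∫ x : ℝ in l..c, Φ (x + T * Complex.I)) +
      Complex.I • (∫ y : ℝ in (-T)..T, Φ (c + y * Complex.I)) -
      Complex.I • (∫ y : ℝ in (-T)..T, Φ (l + y * Complex.I)) = 0 := by
    intro T hT
    have h := Complex.integral_boundary_rect_eq_zero_of_differentiable_on_off_countable Φ
      ⟨l, -T⟩ ⟨c, T⟩ {z} (Set.countable_singleton z) (fun v hv => by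
        have h1 := (Complex.mem_reProdIm.1 hv).1
        simp only [Set.uIcc_of_le hlc] at h1
        exact (hcont v h1).continuousWithinAt) (fun v hv => by
        have h1 := (Complex.mem_reProdIm.1 hv.1).1
        simp only [min_eq_left hlc, max_eq_right hlc] at h1
        exact hdiff v h1 hv.2)
    simpa using h
  have hh : ∀ s : ℝ → ℝ, (∀ᶠ T in atTop, |s T| = T) →
      Tendsto (fun T : ℝ => ∫ x : ℝ in l..c, Φ (x + s T * Complex.I)) atTop (𝓝 0) := by
    intro s hs
    have hlim : Tendsto (fun T : ℝ => C * T ^ (-ρ) * |c - l|) atTop (𝓝 0) := by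
      have := ((tendsto_rpow_neg_atTop (show 0 < ρ by linarith)).const_mul C).mul_const |c - l|
      simpa using this
    refine squeeze_zero_norm' ?_ hlim
    filter_upwards [eventually_ge_atTop 1, hs] with T hT hsT
    refine intervalIntegral.norm_integral_le_of_norm_le_const fun x hx => ?_
    rw [Set.uIoc_of_le hlc] at hx
    have := hb x ⟨hx.1.le, hx.2⟩ (s T) (by rwa [hsT])
    rwa [hsT] at this
  have h1 := hh (fun T => -T) (by
    filter_upwards [eventually_ge_atTop 0] with T hT; rw [abs_neg, abs_of_nonneg hT])
  have h2 := hh (fun T => T) (by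
    filter_upwards [eventually_ge_atTop 0] with T hT; rw [abs_of_nonneg hT])
  have hlim := ((h1.sub h2).add (tc.const_smul Complex.I)).sub (tl.const_smul Complex.I)
  have h0 : Tendsto (fun T : ℝ => (0 : ℂ)) atTop (𝓝 (0 - 0 +
      Complex.I • (∫ t : ℝ, Φ (c + t * Complex.I)) - Complex.I • ∫ t : ℝ, Φ (l + t * Complex.I))) := by
    refine hlim.congr' ?_
    filter_upwards [eventually_gt_atTop 0] with T hT
    exact hrect T hT
  have := tendsto_nhds_unique h0 tendsto_const_nhds
  rw [sub_zero, zero_add, ← smul_sub, smul_eq_zero] at this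
  exact (sub_eq_zero.1 (this.resolve_left Complex.I_ne_zero)).symm

/-- The contour of an inverse Mellin transform can be moved inside a strip of holomorphy in which
the function decays. -/
theorem mellinInv_eq_of_bound (hlc : l ≤ c)
    (hcont : ∀ v : ℂ, v.re ∈ Set.Icc l c → ContinuousAt Φ v)
    (hdiff : ∀ v : ℂ, v.re ∈ Set.Ioo l c → v ≠ z → DifferentiableAt ℂ Φ v)
    (hρ : 1 < ρ) (hC : 0 < C)
    (hb : ∀ σ ∈ Set.Icc l c, ∀ t : ℝ, 1 ≤ |t| → ‖Φ (σ + t * Complex.I)‖ ≤ C * |t| ^ (-ρ))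
    {x : ℝ} (hx : 0 < x) : mellinInv l Φ x = mellinInv c Φ x := by
  have hx' : (x : ℂ) ≠ 0 := by exact_mod_cast hx.ne'
  have hd : ∀ v : ℂ, DifferentiableAt ℂ (fun v : ℂ => (x : ℂ) ^ (-v)) v := fun v =>
    (differentiableAt_id.neg).const_cpow (Or.inl hx')
  rw [mellinInv, mellinInv]
  congr 1
  set M := Real.exp (|Real.log x| * (|l| + |c|)) with hM
  refine integral_vertical_eq_of_bound (Φ := fun v => (x : ℂ) ^ (-v) • Φ v) (z := z) (ρ := ρ)
    (C := M * C) hlc (fun v hv => (hd v).continuousAt.smul (hcont v hv))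
    (fun v hv hz => (hd v).smul (hdiff v hv hz)) hρ (by positivity) fun σ hσ t ht => ?_
  rw [norm_smul, Complex.norm_cpow_eq_rpow_re_of_pos hx, mul_assoc]
  have hσa : |-σ| ≤ |l| + |c| := by
    rw [abs_le]
    constructor
    · linarith [le_abs_self c, abs_nonneg l, hσ.2]
    · linarith [neg_abs_le l, abs_nonneg c, hσ.1]
  have hre : (-((σ : ℂ) + t * Complex.I)).re = -σ := by simp
  rw [hre]
  gcongr
  · exact (Real.rpow_bounds_of_abs_le hx hσa).2
  · exact hb σ hσ t ht

end Shift

/-- On the line |x^(-v)| = x^(-c). If Φ is not integrable there, the inverse transform is zero by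
convention and the bound still holds. -/
theorem norm_mellinInv_le (Φ : ℂ → ℂ) (c : ℝ) :
    ∃ C, 0 ≤ C ∧ ∀ x : ℝ, 0 < x → ‖mellinInv c Φ x‖ ≤ C * x ^ (-c) := by
  refine ⟨‖(1 / (2 * Real.pi) : ℝ)‖ * ∫ t : ℝ, ‖Φ (c + t * Complex.I)‖, by positivity,
    fun x hx => ?_⟩
  rw [mellinInv, norm_smul, mul_assoc]
  refine mul_le_mul_of_nonneg_left ?_ (norm_nonneg _)
  refine (norm_integral_le_integral_norm _).trans (le_of_eq ?_)
  rw [← integral_mul_const]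
  refine integral_congr_ae (ae_of_all _ fun t => ?_)
  simp only
  rw [norm_smul, Complex.norm_cpow_eq_rpow_re_of_pos hx, mul_comm]
  simp

theorem aestronglyMeasurable_mellinInv_mul {Φ : ℂ → ℂ} {c : ℝ} (hΦ : Complex.VerticalIntegrable Φ c)
    (μ : Measure ℝ) [SFinite μ] (φ : ℝ) :
    AEStronglyMeasurable (fun x => mellinInv c Φ (φ * x)) μ := by
  have h : AEStronglyMeasurable (fun z : ℝ × ℝ =>
      ((φ * z.1 : ℝ) : ℂ) ^ (-((c : ℂ) + z.2 * Complex.I)) • Φ (c + z.2 * Complex.I))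
      (μ.prod volume) := by
    have h2 : AEStronglyMeasurable (fun t : ℝ => Φ (c + t * Complex.I)) volume :=
      Integrable.aestronglyMeasurable hΦ
    have h1 : Measurable (fun z : ℝ × ℝ =>
        ((φ * z.1 : ℝ) : ℂ) ^ (-((c : ℂ) + z.2 * Complex.I))) := by
      fun_prop
    exact h1.aestronglyMeasurable.smul h2.comp_snd
  exact h.integral_prod_right'.const_smul _

theorem hasVerticalOrder_Gamma_sub (l r v₀ : ℝ) :
    HasVerticalOrder (fun v => Complex.Gamma (v - v₀)) l r (-v₀ - 1 / 2) 1 (Real.pi / 2) := by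
  refine (hasVerticalOrder_Gamma l r (-v₀) one_ne_zero).congr rfl rfl (by simp) fun s => ?_
  congr 1; push_cast; ring

theorem Gamma_sub_bound (l r v₀ : ℝ) :
    ∃ C ρ : ℝ, 1 < ρ ∧ 0 < C ∧ ∀ σ ∈ Set.Icc l r, ∀ t : ℝ, 1 ≤ |t| →
      ‖Complex.Gamma ((σ + t * Complex.I) - v₀)‖ ≤ C * |t| ^ (-ρ) :=
  (hasVerticalOrder_Gamma_sub l r v₀).exists_bound (Or.inl (by positivity))

theorem Complex.differentiableAt_Gamma_of_re_pos {s : ℂ} (hs : 0 < s.re) :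
    DifferentiableAt ℂ Complex.Gamma s := by
  refine Complex.differentiableAt_Gamma s fun m h => ?_
  rw [h] at hs
  simp at hs
  linarith [(m.cast_nonneg : (0 : ℝ) ≤ m)]

theorem verticalIntegrable_Gamma_sub {c v₀ : ℝ} (h : v₀ < c) :
    Complex.VerticalIntegrable (fun v => Complex.Gamma (v - v₀)) c := by
  obtain ⟨C, ρ, hρ, hC, hb⟩ := Gamma_sub_bound c c v₀
  refine verticalIntegrable_of_bound (fun v hv => ?_) hρ hC (hb c ⟨le_rfl, le_rfl⟩)
  have : DifferentiableAt ℂ Complex.Gamma (v - v₀) :=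
    Complex.differentiableAt_Gamma_of_re_pos (by simp [hv, h])
  exact ContinuousAt.comp (f := fun v : ℂ => v - v₀) this.continuousAt (by fun_prop)

/-- The Cahen-Mellin integral. -/
theorem mellinInv_Gamma {c x : ℝ} (hc : 0 < c) (hx : 0 < x) :
    mellinInv c Complex.Gamma x = Real.exp (-x) := by
  have hm : ∀ s : ℂ, 0 < s.re → mellin (fun x : ℝ => ((Real.exp (-x) : ℝ) : ℂ)) s =
      Complex.Gamma s := fun s hs => by
    rw [Complex.Gamma_eq_integral hs, Complex.GammaIntegral_eq_mellin]
  have hline : ∀ t : ℝ, mellin (fun x : ℝ => ((Real.exp (-x) : ℝ) : ℂ)) (c + t * Complex.I) =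
      Complex.Gamma (c + t * Complex.I) := fun t => hm _ (by simpa using hc)
  have hv : Complex.VerticalIntegrable Complex.Gamma c := by
    simpa using verticalIntegrable_Gamma_sub hc
  rw [← mellinInv_mellin_eq c (fun x : ℝ => ((Real.exp (-x) : ℝ) : ℂ)) hx]
  · simp only [mellinInv, hline]
  · have := Complex.GammaIntegral_convergent (s := c) (by simpa using hc)
    rw [MellinConvergent]
    refine this.congr_fun (fun t _ => ?_) measurableSet_Ioi
    simp [mul_comm]
  · simpa only [Complex.VerticalIntegrable, hline] using hv
  · fun_prop

theorem mellinInv_Gamma_sub {c v₀ x : ℝ} (hc : v₀ < c) (hx : 0 < x) :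
    mellinInv c (fun v => Complex.Gamma (v - v₀)) x = (x ^ (-v₀) * Real.exp (-x) : ℝ) := by
  have hx' : (x : ℂ) ≠ 0 := by exact_mod_cast hx.ne'
  rw [Complex.ofReal_mul, ← mellinInv_Gamma (sub_pos.2 hc) hx, mellinInv, mellinInv,
    mul_smul_comm, ← integral_const_mul, Complex.ofReal_cpow hx.le]
  congr 2
  ext t
  rw [smul_eq_mul, smul_eq_mul, ← mul_assoc, ← Complex.cpow_add _ _ hx']
  congr 2 <;> push_cast <;> ring

/-! ### Leading behaviour of the Fox H-function at the origin. -/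

namespace FoxParams

variable {m n p q : ℕ}

/-- The kernel with the factor `Γ(b_i + B_i v)` removed. -/
noncomputable def reducedKernel (P : FoxParams m n p q) (i₀ : Fin q) (v : ℂ) : ℂ :=
  ((∏ i : Fin q with i.val < m ∧ i ≠ i₀, Complex.Gamma (P.b i + P.B i * v)) *
      ∏ i : Fin p with i.val < n, Complex.Gamma (1 - P.a i - P.A i * v)) *
    ((∏ i : Fin p with n ≤ i.val, (Complex.Gamma (P.a i + P.A i * v))⁻¹) *
      ∏ i : Fin q with m ≤ i.val, (Complex.Gamma (1 - P.b i - P.B i * v))⁻¹)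

theorem kernel_eq_Gamma_mul_reducedKernel (P : FoxParams m n p q) {i₀ : Fin q} (hi₀ : i₀.val < m)
    (v : ℂ) : P.kernel v = Complex.Gamma (P.b i₀ + P.B i₀ * v) * P.reducedKernel i₀ v := by
  have h : ({i : Fin q | i.val < m} : Finset (Fin q)) =
      insert i₀ ({i : Fin q | i.val < m ∧ i ≠ i₀} : Finset (Fin q)) := by
    ext i
    by_cases hi : i = i₀
    · subst hi; simp [hi₀]
    · simp [hi]
  rw [kernel, reducedKernel, h, Finset.prod_insert (by simp), Finset.prod_inv_distrib,
    Finset.prod_inv_distrib, div_eq_mul_inv, mul_inv]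
  ring

theorem differentiableAt_reducedKernel (P : FoxParams m n p q) {i₀ : Fin q} {v : ℂ}
    (h1 : ∀ i : Fin q, i.val < m → i ≠ i₀ → 0 < P.b i + P.B i * v.re)
    (h2 : ∀ i : Fin p, i.val < n → 0 < 1 - P.a i - P.A i * v.re) :
    DifferentiableAt ℂ (P.reducedKernel i₀) v := by
  have key : ∀ f : ℂ → ℂ, DifferentiableAt ℂ f v → 0 < (f v).re →
      DifferentiableAt ℂ (fun v => Complex.Gamma (f v)) v := fun f hf hre =>
    DifferentiableAt.comp (f := f) v (Complex.differentiableAt_Gamma_of_re_pos hre) hf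
  have key' : ∀ f : ℂ → ℂ, DifferentiableAt ℂ f v →
      DifferentiableAt ℂ (fun v => (Complex.Gamma (f v))⁻¹) v := fun f hf =>
    DifferentiableAt.comp (f := f) v (Complex.differentiable_one_div_Gamma _) hf
  unfold reducedKernel
  refine DifferentiableAt.mul (DifferentiableAt.mul ?_ ?_) (DifferentiableAt.mul ?_ ?_)
  · refine DifferentiableAt.fun_finsetProd fun i hi => key _ (by fun_prop) ?_
    simp only [Finset.mem_filter, Finset.mem_univ, true_and] at hi
    simpa using h1 i hi.1 hi.2
  · refine DifferentiableAt.fun_finsetProd fun i hi => key _ (by fun_prop) ?_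
    simp only [Finset.mem_filter, Finset.mem_univ, true_and] at hi
    simpa using h2 i hi
  · exact DifferentiableAt.fun_finsetProd fun i hi => key' _ (by fun_prop)
  · exact DifferentiableAt.fun_finsetProd fun i hi => key' _ (by fun_prop)

theorem one_sub_expo (P : FoxParams m n p q) {i : Fin q} (hB : 0 < P.B i) :
    1 - P.expo i = -P.b i / P.B i := by
  rw [expo, calB]; field_simp; ring

/-- At v₀ = -b/B = 1 - 𝓑/B the factor Γ(b + Bv) has residue 1/B. The residue of the whole kernel is
therefore 𝓕 𝓑/B, that is, 𝓕 times the exponent. -/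
theorem reducedKernel_one_sub_expo (P : FoxParams m n p q) {i₀ : Fin q} (h𝓑 : 0 < P.calB i₀) :
    P.reducedKernel i₀ ((1 - P.expo i₀ : ℝ) : ℂ) = ((P.coeffF i₀ * P.calB i₀ : ℝ) : ℂ) := by
  have e : P.coeffF i₀ * P.calB i₀ =
      ((∏ k : Fin q with k.val < m ∧ k ≠ i₀,
          Real.Gamma (P.calB k - P.calB i₀ * (P.B k / P.B i₀))) *
        ∏ k : Fin p with k.val < n, Real.Gamma (1 - P.calA k + P.calB i₀ * (P.A k / P.B i₀))) *
      ((∏ k : Fin p with n ≤ k.val,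
          (Real.Gamma (P.calA k - P.calB i₀ * (P.A k / P.B i₀)))⁻¹) *
        ∏ k : Fin q with m ≤ k.val,
          (Real.Gamma (1 - P.calB k + P.calB i₀ * (P.B k / P.B i₀)))⁻¹) := by
    have cancel : ∀ X Y b Z W : ℝ, b ≠ 0 → X * Y / (b * Z * W) * b = X * Y * (Z⁻¹ * W⁻¹) := by
      intro X Y b Z W hb
      field_simp
    rw [coeffF, Finset.prod_inv_distrib, Finset.prod_inv_distrib]
    exact cancel _ _ _ _ _ h𝓑.ne'
  have hx : ∀ B : ℝ, B * (1 - P.expo i₀) = B - P.calB i₀ * (B / P.B i₀) := by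
    intro B; rw [expo]; ring
  rw [e, reducedKernel]
  push_cast
  congr 1
  · congr 1 <;>
    · refine Finset.prod_congr rfl fun k _ => ?_
      rw [← Complex.Gamma_ofReal]
      congr 1
      norm_cast
      rw [hx]
      simp only [calA, calB]
      ring
  · congr 1 <;>
    · refine Finset.prod_congr rfl fun k _ => ?_
      rw [← Complex.Gamma_ofReal]
      congr 2
      norm_cast
      rw [hx]
      simp only [calA, calB]
      ring

/-- All the inequalities are strict at v₀ = 1 - `P.expo i₀`, so they persist slightly to its left.
They say that v₀ is the only pole of the kernel, and of Γ(v - v₀), met between the new line and the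
old one. -/
theorem exists_lt_of_leading (P : FoxParams m n p q) (hB : ∀ i, 0 < P.B i) {i₀ : Fin q}
    (hmin : ∀ k : Fin q, k.val < m → k ≠ i₀ → P.expo i₀ < P.expo k) :
    ∃ l, l < 1 - P.expo i₀ ∧ 1 - P.expo i₀ - 1 < l ∧ 0 < P.b i₀ + P.B i₀ * l + 1 ∧
      ∀ k : Fin q, k.val < m → k ≠ i₀ → 0 < P.b k + P.B k * l := by
  set v₀ := 1 - P.expo i₀ with hv₀
  have h : ∀ᶠ l in 𝓝[<] v₀, v₀ - 1 < l ∧ 0 < P.b i₀ + P.B i₀ * l + 1 ∧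
      ∀ k : Fin q, k.val < m → k ≠ i₀ → 0 < P.b k + P.B k * l := by
    apply eventually_nhdsWithin_of_eventually_nhds
    have e : ∀ f : ℝ → ℝ, Continuous f → 0 < f v₀ → ∀ᶠ l in 𝓝 v₀, 0 < f l := fun f hf h0 =>
      hf.continuousAt.eventually (lt_mem_nhds h0)
    refine (lt_mem_nhds (sub_one_lt v₀)).and ((e _ (by fun_prop) ?_).and
      (eventually_all.2 fun k => ?_))
    · rw [hv₀, P.one_sub_expo (hB i₀), mul_div_cancel₀ _ (hB i₀).ne']
      linarith
    · by_cases hk : k.val < m ∧ k ≠ i₀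
      · refine (e (fun l => P.b k + P.B k * l) (by fun_prop) ?_).mono fun l hl _ _ => hl
        have h1 := hmin k hk.1 hk.2
        have h2 : -P.b k / P.B k < v₀ := by rw [← P.one_sub_expo (hB k), hv₀]; linarith
        rw [div_lt_iff₀ (hB k)] at h2
        linarith
      · exact Eventually.of_forall fun l h1 h2 => absurd ⟨h1, h2⟩ hk
  obtain ⟨l, hl, hl'⟩ := (eventually_mem_nhdsWithin.and h).exists
  exact ⟨l, hl, hl'⟩

/-- Leading term and remainder of the Fox H-function at the origin. -/
theorem exists_foxH_eq_add_mellinInv (P : FoxParams m n p q) (hA : ∀ i, 0 < P.A i)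
    (hB : ∀ i, 0 < P.B i) {c : ℝ} (hc : P.IsContour c) (hΔ : 0 < P.aStar ∨ 0 ≤ P.delta)
    {i₀ : Fin q} (hi₀ : i₀.val < m) (h𝓑 : 0 < P.calB i₀)
    (hmin : ∀ k : Fin q, k.val < m → k ≠ i₀ → P.expo i₀ < P.expo k) :
    ∃ l < 1 - P.expo i₀, ∃ Φ : ℂ → ℂ, ∀ x : ℝ, 0 < x → P.foxH c x =
      ((P.coeffF i₀ * P.expo i₀ * (x ^ (-(1 - P.expo i₀)) * Real.exp (-x)) : ℝ) : ℂ) +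
        mellinInv l Φ x := by
  obtain ⟨l, hl, hl1, hl2, hl3⟩ := P.exists_lt_of_leading hB hmin
  have hBp := hB i₀
  set v₀ := 1 - P.expo i₀ with hv₀
  have hbv₀ : P.b i₀ = -(P.B i₀ * v₀) := by
    rw [hv₀, P.one_sub_expo hBp, mul_div_cancel₀ _ hBp.ne']; ring
  have hv₀c : v₀ < c := by
    have := hc.1.1 i₀ hi₀
    rw [hbv₀] at this
    nlinarith
  have hlc : l ≤ c := (hl.trans hv₀c).le
  set h₀ : ℂ := ((P.coeffF i₀ * P.expo i₀ : ℝ) : ℂ) with hh₀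
  -- E(v) = (v - v₀)(kernel(v) - h₀ Γ(v - v₀)), written without poles. The subtracted Gamma function
  -- has the same residue h₀ at v₀ and the explicit inverse transform x^(-v₀) e^(-x), so E(v₀) = 0
  -- and the difference quotient Φ continues the difference across v₀.
  set E : ℂ → ℂ := fun v => Complex.Gamma (P.b i₀ + P.B i₀ * v + 1) / P.B i₀ *
    P.reducedKernel i₀ v - h₀ * Complex.Gamma (v - v₀ + 1) with hE
  have hEv₀ : E v₀ = 0 := by
    have h1 : ((P.b i₀ : ℝ) : ℂ) + P.B i₀ * v₀ + 1 = 1 := by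
      rw [hbv₀]; push_cast; ring
    have hBC : (P.B i₀ : ℂ) ≠ 0 := by exact_mod_cast hBp.ne'
    simp only [hE]
    rw [h1, sub_self, zero_add, Complex.Gamma_one, P.reducedKernel_one_sub_expo h𝓑, hh₀, expo]
    push_cast
    field_simp
    ring
  have hEd : ∀ v : ℂ, v.re ∈ Set.Icc l c → DifferentiableAt ℂ E v := by
    intro v hv
    have hr := P.differentiableAt_reducedKernel (i₀ := i₀) (v := v)
      (fun i hi hne => (hl3 i hi hne).trans_le (by have := (hB i).le; gcongr; exact hv.1))
      (fun i hi => (hc.1.2 i hi).trans_le (by have := (hA i).le; gcongr; exact hv.2))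
    have hg1 : DifferentiableAt ℂ (fun v : ℂ => Complex.Gamma (P.b i₀ + P.B i₀ * v + 1)) v := by
      refine DifferentiableAt.comp (f := fun v : ℂ => P.b i₀ + P.B i₀ * v + 1) v
        (Complex.differentiableAt_Gamma_of_re_pos ?_) (by fun_prop)
      have : P.B i₀ * l ≤ P.B i₀ * v.re := by gcongr; exact hv.1
      simp
      linarith
    have hg2 : DifferentiableAt ℂ (fun v : ℂ => Complex.Gamma (v - v₀ + 1)) v := by
      refine DifferentiableAt.comp (f := fun v : ℂ => v - v₀ + 1) v
        (Complex.differentiableAt_Gamma_of_re_pos ?_) (by fun_prop)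
      simp
      linarith [hv.1]
    exact ((hg1.div_const _).mul hr).sub (hg2.const_mul _)
  set Φ := dslope E v₀ with hΦ
  have hΦne : ∀ v : ℂ, v ≠ v₀ → Φ v = P.kernel v - h₀ * Complex.Gamma (v - v₀) := by
    intro v hv
    have hsub : v - v₀ ≠ 0 := sub_ne_zero.2 hv
    have hBC : (P.B i₀ : ℂ) ≠ 0 := by exact_mod_cast hBp.ne'
    have h1 : ((P.b i₀ : ℝ) : ℂ) + P.B i₀ * v = P.B i₀ * (v - v₀) := by
      rw [hbv₀]; push_cast; ring
    rw [hΦ, dslope_of_ne _ hv, slope_def_field, hEv₀, sub_zero,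
      P.kernel_eq_Gamma_mul_reducedKernel hi₀]
    simp only [hE]
    rw [h1, Complex.Gamma_add_one _ (mul_ne_zero hBC hsub), Complex.Gamma_add_one _ hsub]
    field_simp
  have hΦcont : ∀ v : ℂ, v.re ∈ Set.Icc l c → ContinuousAt Φ v := by
    intro v hv
    by_cases h : v = v₀
    · subst h
      exact continuousAt_dslope_same.2 (hEd _ hv)
    · exact (continuousAt_dslope_of_ne h).2 (hEd v hv).continuousAt
  have hΦdiff : ∀ v : ℂ, v.re ∈ Set.Ioo l c → v ≠ v₀ → DifferentiableAt ℂ Φ v := fun v hv hne =>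
    (differentiableAt_dslope_of_ne hne).2 (hEd v ⟨hv.1.le, hv.2.le⟩)
  obtain ⟨C₁, ρ₁, hρ₁, hC₁, hb₁⟩ := P.kernel_bound hA hB hlc hc.2 hΔ
  obtain ⟨C₂, ρ₂, hρ₂, hC₂, hb₂⟩ := Gamma_sub_bound l c v₀
  have hb : ∀ σ ∈ Set.Icc l c, ∀ t : ℝ, 1 ≤ |t| →
      ‖Φ (σ + t * Complex.I)‖ ≤ (C₁ + ‖h₀‖ * C₂) * |t| ^ (-(min ρ₁ ρ₂)) := by
    intro σ hσ t ht
    have hne : (σ : ℂ) + t * Complex.I ≠ v₀ := by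
      intro h
      have := congrArg Complex.im h
      simp at this
      rw [this] at ht
      norm_num at ht
    rw [hΦne _ hne, add_mul]
    refine (norm_sub_le _ _).trans (add_le_add ((hb₁ σ hσ t ht).trans ?_) ?_)
    · gcongr
      exact min_le_left _ _
    · rw [norm_mul, mul_assoc]
      gcongr
      refine (hb₂ σ hσ t ht).trans ?_
      gcongr
      exact min_le_right _ _
  have hρ : 1 < min ρ₁ ρ₂ := lt_min hρ₁ hρ₂
  have hC : 0 < C₁ + ‖h₀‖ * C₂ := by positivity
  refine ⟨l, hl, Φ, fun x hx => ?_⟩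
  have hΦint : Complex.VerticalIntegrable Φ c := verticalIntegrable_of_bound
    (fun v hv => hΦcont v (by rw [hv]; exact Set.right_mem_Icc.2 hlc)) hρ hC
    (hb c (Set.right_mem_Icc.2 hlc))
  rw [mellinInv_eq_of_bound hlc hΦcont hΦdiff hρ hC hb hx, Complex.ofReal_mul,
    ← mellinInv_Gamma_sub hv₀c hx, foxH, ← hh₀]
  have hmel : ∀ {Ψ : ℂ → ℂ}, Complex.VerticalIntegrable Ψ c →
      Integrable (fun t : ℝ => (x : ℂ) ^ (-((c : ℂ) + t * Complex.I)) • Ψ (c + t * Complex.I)) := by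
    intro Ψ hΨ
    have hΨ' : Integrable (fun t : ℝ => Ψ (c + t * Complex.I)) := hΨ
    refine hΨ'.bdd_mul (c := x ^ (-c)) ?_ (ae_of_all _ fun t => ?_)
    · have : Measurable (fun t : ℝ => (x : ℂ) ^ (-((c : ℂ) + t * Complex.I))) := by fun_prop
      exact this.aestronglyMeasurable
    · rw [Complex.norm_cpow_eq_rpow_re_of_pos hx]
      simp
  simp only [mellinInv]
  rw [mul_smul_comm, ← smul_add, ← integral_const_mul, ← integral_add
    ((hmel (verticalIntegrable_Gamma_sub hv₀c)).const_mul h₀) (hmel hΦint)]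
  congr 2
  ext t
  have hne : (c : ℂ) + t * Complex.I ≠ v₀ := by
    intro h
    have := congrArg Complex.re h
    simp at this
    exact hv₀c.ne' this
  rw [hΦne _ hne]
  simp only [smul_eq_mul]
  ring

/-- For x ≤ 1 the expansion is used, with remainder x^(-l) and l < 1 - r. For x ≥ 1 the original
contour gives x^(-c) with c > 1 - r. One power thus serves as a bound on the whole half-line. -/
theorem norm_foxH_le (P : FoxParams m n p q) (hA : ∀ i, 0 < P.A i)
    (hB : ∀ i, 0 < P.B i) {c : ℝ} (hc : P.IsContour c) (hΔ : 0 < P.aStar ∨ 0 ≤ P.delta)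
    {i₀ : Fin q} (hi₀ : i₀.val < m) (h𝓑 : 0 < P.calB i₀)
    (hmin : ∀ k : Fin q, k.val < m → k ≠ i₀ → P.expo i₀ < P.expo k) :
    ∃ C, 0 ≤ C ∧ ∀ x : ℝ, 0 < x → ‖P.foxH c x‖ ≤ C * x ^ (P.expo i₀ - 1) := by
  obtain ⟨l, hl, Φ, h⟩ := P.exists_foxH_eq_add_mellinInv hA hB hc hΔ hi₀ h𝓑 hmin
  obtain ⟨C₁, hC₁, h₁⟩ := norm_mellinInv_le Φ l
  obtain ⟨C₂, hC₂, h₂⟩ := norm_mellinInv_le P.kernel c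
  have hcc : 1 - P.expo i₀ < c := by
    have := hc.1.1 i₀ hi₀
    rw [P.one_sub_expo (hB i₀), div_lt_iff₀ (hB i₀)]
    linarith
  set r := P.expo i₀ with hr
  refine ⟨|P.coeffF i₀ * r| + C₁ + C₂, by positivity, fun x hx => ?_⟩
  rcases le_total x 1 with hx1 | hx1
  · rw [h x hx]
    refine (norm_add_le _ _).trans ?_
    have e1 : ‖((P.coeffF i₀ * r * (x ^ (-(1 - r)) * Real.exp (-x)) : ℝ) : ℂ)‖ ≤
        |P.coeffF i₀ * r| * x ^ (r - 1) := by
      rw [Complex.norm_real, Real.norm_eq_abs, abs_mul, neg_sub]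
      gcongr
      rw [abs_of_pos (by positivity)]
      exact mul_le_of_le_one_right (by positivity) (Real.exp_le_one_iff.2 (by linarith))
    have e2 : ‖mellinInv l Φ x‖ ≤ C₁ * x ^ (r - 1) := by
      refine (h₁ x hx).trans ?_
      refine mul_le_mul_of_nonneg_left ?_ hC₁
      exact Real.rpow_le_rpow_of_exponent_ge hx hx1 (by linarith)
    have e3 : 0 ≤ C₂ * x ^ (r - 1) := by positivity
    rw [add_mul, add_mul]
    linarith
  · have e2 : ‖P.foxH c x‖ ≤ C₂ * x ^ (r - 1) := by
      refine (h₂ x hx).trans ?_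
      refine mul_le_mul_of_nonneg_left ?_ hC₂
      exact Real.rpow_le_rpow_of_exponent_le hx1 (by linarith)
    have e3 : 0 ≤ (|P.coeffF i₀ * r| + C₁) * x ^ (r - 1) := by positivity
    rw [add_mul]
    linarith

theorem tendsto_rpow_mul_foxH (P : FoxParams m n p q) (hA : ∀ i, 0 < P.A i)
    (hB : ∀ i, 0 < P.B i) {c : ℝ} (hc : P.IsContour c) (hΔ : 0 < P.aStar ∨ 0 ≤ P.delta)
    {i₀ : Fin q} (hi₀ : i₀.val < m) (h𝓑 : 0 < P.calB i₀)
    (hmin : ∀ k : Fin q, k.val < m → k ≠ i₀ → P.expo i₀ < P.expo k) :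
    Tendsto (fun x : ℝ => x ^ (1 - P.expo i₀) * (P.foxH c x).re) (𝓝[>] 0)
      (𝓝 (P.coeffF i₀ * P.expo i₀)) := by
  obtain ⟨l, hl, Φ, h⟩ := P.exists_foxH_eq_add_mellinInv hA hB hc hΔ hi₀ h𝓑 hmin
  obtain ⟨C₁, hC₁, h₁⟩ := norm_mellinInv_le Φ l
  set r := P.expo i₀ with hr
  have t1 : Tendsto (fun x : ℝ => P.coeffF i₀ * r * Real.exp (-x)) (𝓝[>] 0)
      (𝓝 (P.coeffF i₀ * r * Real.exp (-0))) :=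
    ((by fun_prop : Continuous fun x : ℝ => P.coeffF i₀ * r * Real.exp (-x)).tendsto 0).mono_left
      nhdsWithin_le_nhds
  have t2 : Tendsto (fun x : ℝ => x ^ (1 - r) * (mellinInv l Φ x).re) (𝓝[>] 0) (𝓝 0) := by
    have hlim : Tendsto (fun x : ℝ => C₁ * x ^ (1 - r - l)) (𝓝[>] 0) (𝓝 0) := by
      have hpos : 0 < 1 - r - l := by linarith
      have := (Real.continuousAt_rpow_const 0 (1 - r - l) (Or.inr hpos.le)).tendsto.const_mul C₁
      rw [Real.zero_rpow hpos.ne', mul_zero] at this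
      exact this.mono_left nhdsWithin_le_nhds
    refine squeeze_zero_norm' ?_ hlim
    filter_upwards [self_mem_nhdsWithin] with x hx
    have hx0 : (0 : ℝ) < x := hx
    rw [norm_mul, Real.norm_of_nonneg (by positivity), sub_eq_add_neg (1 - r) l,
      Real.rpow_add hx0, mul_left_comm]
    gcongr
    exact (Complex.abs_re_le_norm _).trans (h₁ x hx0)
  have t3 := t1.add t2
  simp only [neg_zero, Real.exp_zero, mul_one, add_zero] at t3
  refine t3.congr' ?_
  filter_upwards [self_mem_nhdsWithin] with x hx
  have hx0 : (0 : ℝ) < x := hx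
  rw [h x hx0, Complex.add_re, Complex.ofReal_re, Real.rpow_neg hx0.le]
  have : x ^ (1 - r) ≠ 0 := by positivity
  field_simp

end FoxParams

/-! ### The substitution w = y/(1+y) and the Mellin transform of the binomial function. -/

theorem hasDerivAt_div_one_add {y : ℝ} (hy : 0 < y) :
    HasDerivAt (fun y : ℝ => y / (1 + y)) ((1 + y) ^ (-2 : ℤ)) y := by
  have h : 1 + y ≠ 0 := by positivity
  have := (hasDerivAt_id y).div ((hasDerivAt_id y).const_add 1) h
  refine this.congr_deriv ?_
  simp only [id]
  rw [zpow_neg]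
  field_simp
  norm_cast
  ring

theorem injOn_div_one_add : Set.InjOn (fun y : ℝ => y / (1 + y)) (Set.Ioi 0) := by
  intro x hx y hy h
  have hx0 : (0 : ℝ) < x := hx
  have hy0 : (0 : ℝ) < y := hy
  simp only at h
  rw [div_eq_div_iff (by positivity) (by positivity)] at h
  linarith

theorem image_div_one_add : (fun y : ℝ => y / (1 + y)) '' Set.Ioi 0 = Set.Ioo 0 1 := by
  ext w
  constructor
  · rintro ⟨y, hy, rfl⟩
    have hy0 : (0 : ℝ) < y := hy
    refine ⟨by positivity, ?_⟩
    simp only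
    rw [div_lt_one (by positivity)]
    linarith
  · rintro ⟨h0, h1⟩
    have : 0 < 1 - w := by linarith
    refine ⟨w / (1 - w), div_pos h0 this, ?_⟩
    simp only
    field_simp
    ring

section Substitution

variable {E : Type*} [NormedAddCommGroup E] [NormedSpace ℝ E]

theorem integral_Ioo_eq_integral_Ioi_div_one_add (g : ℝ → E) :
    ∫ w in Set.Ioo (0 : ℝ) 1, g w = ∫ y in Set.Ioi (0 : ℝ), (1 + y) ^ (-2 : ℤ) • g (y / (1 + y)) := by
  rw [← image_div_one_add, integral_image_eq_integral_abs_deriv_smul measurableSet_Ioi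
    (fun y hy => (hasDerivAt_div_one_add hy).hasDerivWithinAt) injOn_div_one_add]
  refine setIntegral_congr_fun measurableSet_Ioi fun y hy => ?_
  have : (0 : ℝ) < y := hy
  rw [abs_of_pos (by positivity)]

theorem integrableOn_Ioo_iff_div_one_add (g : ℝ → E) :
    IntegrableOn g (Set.Ioo (0 : ℝ) 1) ↔
      IntegrableOn (fun y => (1 + y) ^ (-2 : ℤ) • g (y / (1 + y))) (Set.Ioi (0 : ℝ)) := by
  rw [← image_div_one_add, integrableOn_image_iff_integrableOn_abs_deriv_smul measurableSet_Ioi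
    (fun y hy => (hasDerivAt_div_one_add hy).hasDerivWithinAt) injOn_div_one_add]
  refine integrableOn_congr_fun (fun y hy => ?_) measurableSet_Ioi
  have : (0 : ℝ) < y := hy
  rw [abs_of_pos (by positivity)]

end Substitution

theorem beta_integrand_div_one_add {β : ℝ} {v : ℂ} {y : ℝ} (hy : 0 < y) :
    (1 + y) ^ (-2 : ℤ) • (((y / (1 + y) : ℝ) : ℂ) ^ (v - 1) *
      (1 - ((y / (1 + y) : ℝ) : ℂ)) ^ ((β : ℂ) - v - 1)) =
    (y : ℂ) ^ (v - 1) • (((1 + y) ^ (-β) : ℝ) : ℂ) := by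
  have h1 : 0 < 1 + y := by positivity
  have hne : ((1 + y : ℝ) : ℂ) ≠ 0 := by exact_mod_cast h1.ne'
  have e1 : (1 - ((y / (1 + y) : ℝ) : ℂ)) = (((1 + y)⁻¹ : ℝ) : ℂ) := by
    rw [← Complex.ofReal_one, ← Complex.ofReal_sub]
    congr 1
    field_simp
    ring
  rw [e1, div_eq_mul_inv, Complex.ofReal_mul, Complex.mul_cpow_ofReal_nonneg hy.le (by positivity),
    mul_assoc, ← Complex.cpow_add _ _ (by exact_mod_cast (inv_pos.2 h1).ne'),
    Complex.ofReal_inv, Complex.inv_cpow_eq_ite, if_neg, ← Complex.cpow_neg,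
    Complex.ofReal_cpow h1.le, Complex.real_smul, smul_eq_mul, mul_left_comm]
  · congr 1
    rw [Complex.ofReal_zpow, ← Complex.cpow_intCast, ← Complex.cpow_add _ _ hne]
    congr 1
    push_cast
    ring
  · rw [Complex.arg_ofReal_of_nonneg h1.le]
    exact Real.pi_ne_zero.symm

/-- Euler's Beta integral B(v, β - v) after the substitution w = y/(1+y). -/
theorem mellin_one_add_rpow_neg {β : ℝ} {v : ℂ} (h0 : 0 < v.re) (h1 : v.re < β) :
    MellinConvergent (fun x : ℝ => (((1 + x) ^ (-β) : ℝ) : ℂ)) v ∧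
      mellin (fun x : ℝ => (((1 + x) ^ (-β) : ℝ) : ℂ)) v =
        Complex.Gamma v * Complex.Gamma (β - v) / Real.Gamma β := by
  have h1' : 0 < ((β : ℂ) - v).re := by simpa using h1
  have hβ : 0 < β := h0.trans h1
  have hconv := Complex.betaIntegral_convergent h0 h1'
  rw [intervalIntegrable_iff_integrableOn_Ioo_of_le zero_le_one,
    integrableOn_Ioo_iff_div_one_add] at hconv
  constructor
  · exact hconv.congr_fun (fun y hy => beta_integrand_div_one_add hy) measurableSet_Ioi
  · have hb := Complex.Gamma_mul_Gamma_eq_betaIntegral h0 h1'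
    rw [add_sub_cancel, Complex.Gamma_ofReal] at hb
    have hΓ : (Real.Gamma β : ℂ) ≠ 0 := by exact_mod_cast (Real.Gamma_pos_of_pos hβ).ne'
    rw [hb, mul_div_cancel_left₀ _ hΓ, Complex.betaIntegral,
      intervalIntegral.integral_of_le zero_le_one, integral_Ioc_eq_integral_Ioo,
      integral_Ioo_eq_integral_Ioi_div_one_add, mellin]
    exact (setIntegral_congr_fun measurableSet_Ioi fun y hy =>
      beta_integrand_div_one_add hy).symm

theorem hasVerticalOrder_Gamma_mul_Gamma (β l r : ℝ) :
    HasVerticalOrder (fun v => Complex.Gamma v * Complex.Gamma (β - v)) l r (β - 1) 0 Real.pi := by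
  refine ((hasVerticalOrder_Gamma l r 0 one_ne_zero).mul
    (hasVerticalOrder_Gamma l r β (neg_ne_zero.2 one_ne_zero))).congr ?_ ?_ ?_ fun s => ?_
  · ring
  · ring
  · simp
  · congr 2 <;> push_cast <;> ring

theorem continuous_Gamma_vertical {σ : ℝ} (hσ : 0 < σ) :
    Continuous fun t : ℝ => Complex.Gamma (σ + t * Complex.I) := by
  refine continuous_iff_continuousAt.2 fun t => ?_
  exact ContinuousAt.comp (f := fun t : ℝ => (σ : ℂ) + t * Complex.I)
    (Complex.differentiableAt_Gamma_of_re_pos (by simpa using hσ)).continuousAt (by fun_prop)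

theorem continuous_Gamma_mul_Gamma_vertical {β ν : ℝ} (h0 : 0 < ν) (h1 : ν < β) :
    Continuous fun t : ℝ => Complex.Gamma (ν + t * Complex.I) *
      Complex.Gamma (β - (ν + t * Complex.I)) := by
  refine (continuous_Gamma_vertical h0).mul (continuous_iff_continuousAt.2 fun t => ?_)
  exact ContinuousAt.comp (f := fun t : ℝ => (β : ℂ) - (ν + t * Complex.I))
    (Complex.differentiableAt_Gamma_of_re_pos (by simpa using h1)).continuousAt (by fun_prop)

/-- The gap κ - b absorbs every power of |t|. The weight 1 + |t| is there for differentiation under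
the integral sign. -/
theorem HasVerticalOrder.integrable_mul_exp {f : ℂ → ℂ} {l r e d κ σ b : ℝ}
    (hf : HasVerticalOrder f l r e d κ) (hσ : σ ∈ Set.Icc l r)
    (hcont : Continuous fun t : ℝ => f (σ + t * Complex.I)) (hb : b < κ) :
    Integrable fun t : ℝ => ‖f (σ + t * Complex.I)‖ * ((1 + |t|) * Real.exp (b * |t|)) := by
  obtain ⟨C, hC, h⟩ := hf
  obtain ⟨D, hD, hle⟩ := rpow_mul_exp_neg_le (e + d * σ + 3) (sub_pos.2 hb)
  have hint : Integrable fun t : ℝ =>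
      ((‖f (σ + t * Complex.I)‖ * ((1 + |t|) * Real.exp (b * |t|)) : ℝ) : ℂ) := by
    refine integrable_of_continuous_of_norm_le_rpow (C := C * (2 * D)) (ρ := 2)
      (Complex.continuous_ofReal.comp (hcont.norm.mul (by fun_prop))) one_lt_two (by positivity) fun t ht => ?_
    have ht0 : 0 < |t| := by linarith
    rw [Complex.norm_real, Real.norm_of_nonneg (by positivity), mul_assoc C]
    have h1 := hle _ le_rfl (|t|) ht
    have h2 := (h σ hσ t ht).2
    have h3 : |t| ^ (e + d * σ + 3) * Real.exp (-((κ - b) * |t|)) =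
        |t| ^ (2 : ℝ) * (|t| ^ (e + d * σ) * Real.exp (-(κ * |t|)) * (|t| * Real.exp (b * |t|))) := by
      rw [show e + d * σ + 3 = (e + d * σ) + 2 + 1 by ring, Real.rpow_add ht0, Real.rpow_add ht0,
        Real.rpow_one, show -((κ - b) * |t|) = -(κ * |t|) + b * |t| by ring, Real.exp_add]
      ring
    rw [h3] at h1
    calc _ ≤ C * (|t| ^ (e + d * σ) * Real.exp (-(κ * |t|))) *
          ((|t| + |t|) * Real.exp (b * |t|)) := by gcongr
      _ = C * (2 * (|t| ^ (e + d * σ) * Real.exp (-(κ * |t|)) * (|t| * Real.exp (b * |t|)))) := by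
          ring
      _ ≤ C * (2 * D * |t| ^ (-2 : ℝ)) := by
          refine mul_le_mul_of_nonneg_left ?_ (by positivity)
          rw [Real.rpow_neg ht0.le, ← div_eq_mul_inv, le_div_iff₀ (by positivity)]
          linarith
  exact hint.re.congr (ae_of_all _ fun t => Complex.ofReal_re _)

section Binomial

variable {β ν : ℝ}

/-- `Γ(v) Γ(β - v)` on the line `Re v = ν`. -/
noncomputable def gammaPair (β ν t : ℝ) : ℂ :=
  Complex.Gamma (ν + t * Complex.I) * Complex.Gamma (β - (ν + t * Complex.I))

theorem integrable_gammaPair_mul_exp (h0 : 0 < ν) (h1 : ν < β) {b : ℝ} (hb : b < Real.pi) :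
    Integrable fun t : ℝ => ‖gammaPair β ν t‖ * ((1 + |t|) * Real.exp (b * |t|)) :=
  (hasVerticalOrder_Gamma_mul_Gamma β ν ν).integrable_mul_exp ⟨le_rfl, le_rfl⟩
    (continuous_Gamma_mul_Gamma_vertical h0 h1) hb

theorem continuous_gammaPair (h0 : 0 < ν) (h1 : ν < β) : Continuous (gammaPair β ν) :=
  continuous_Gamma_mul_Gamma_vertical h0 h1

/-- Mellin inversion of (1 + y)^(-β) at y = e^x. -/
theorem integral_gammaPair_ofReal (h0 : 0 < ν) (h1 : ν < β) (x : ℝ) :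
    ∫ t : ℝ, gammaPair β ν t * Complex.exp (-(x : ℂ) * (ν + t * Complex.I)) =
      2 * Real.pi * Real.Gamma β * (1 + Complex.exp x) ^ (-(β : ℂ)) := by
  have hβ : 0 < β := h0.trans h1
  have hΓ : (Real.Gamma β : ℂ) ≠ 0 := by exact_mod_cast (Real.Gamma_pos_of_pos hβ).ne'
  have hline : ∀ t : ℝ, mellin (fun x : ℝ => (((1 + x) ^ (-β) : ℝ) : ℂ)) (ν + t * Complex.I) =
      gammaPair β ν t / Real.Gamma β := fun t =>
    (mellin_one_add_rpow_neg (by simpa using h0) (by simpa using h1)).2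
  have hx := Real.exp_pos x
  have hint : Integrable (gammaPair β ν) := by
    refine (integrable_gammaPair_mul_exp h0 h1 Real.pi_pos).mono'
      (continuous_gammaPair h0 h1).aestronglyMeasurable (ae_of_all _ fun t => ?_)
    rw [zero_mul, Real.exp_zero, mul_one]
    exact le_mul_of_one_le_right (norm_nonneg _) (by linarith [abs_nonneg t])
  have hinv := mellinInv_mellin_eq ν (fun x : ℝ => (((1 + x) ^ (-β) : ℝ) : ℂ)) hx
    (mellin_one_add_rpow_neg (by simpa using h0) (by simpa using h1)).1
    (by simpa only [Complex.VerticalIntegrable, hline] using hint.div_const _)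
    (by
      refine Complex.continuous_ofReal.continuousAt.comp ?_
      exact ContinuousAt.rpow_const (by fun_prop) (Or.inl (by positivity)))
  simp only [mellinInv, hline] at hinv
  have e2 : ∀ t : ℝ, ((Real.exp x : ℝ) : ℂ) ^ (-((ν : ℂ) + t * Complex.I)) •
      (gammaPair β ν t / Real.Gamma β) =
      (Real.Gamma β : ℂ)⁻¹ * (gammaPair β ν t * Complex.exp (-(x : ℂ) * (ν + t * Complex.I))) := by
    intro t
    rw [Complex.cpow_def_of_ne_zero (by exact_mod_cast hx.ne'), ← Complex.ofReal_log hx.le,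
      Real.log_exp, smul_eq_mul, mul_neg, neg_mul]
    field_simp
  simp only [e2] at hinv
  rw [integral_const_mul, Complex.ofReal_cpow (by positivity), Complex.real_smul] at hinv
  push_cast at hinv
  rw [← hinv]
  generalize (∫ t : ℝ, gammaPair β ν t * Complex.exp (-(x : ℂ) * (ν + t * Complex.I))) = J
  have : (Real.pi : ℂ) ≠ 0 := by exact_mod_cast Real.pi_ne_zero
  field_simp

theorem differentiableAt_integral_gammaPair (h0 : 0 < ν) (h1 : ν < β) {ζ : ℂ}
    (hζ : |ζ.im| < Real.pi) : DifferentiableAt ℂ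
      (fun ζ : ℂ => ∫ t : ℝ, gammaPair β ν t * Complex.exp (-ζ * (ν + t * Complex.I))) ζ := by
  obtain ⟨b, hb1, hb2⟩ := exists_between hζ
  have hmeas : ∀ ζ : ℂ, AEStronglyMeasurable
      (fun t : ℝ => gammaPair β ν t * Complex.exp (-ζ * (ν + t * Complex.I))) volume := fun ζ =>
    ((continuous_gammaPair h0 h1).mul (by fun_prop)).aestronglyMeasurable
  -- This radius keeps |Im| ≤ b < π on the ball, so one exponential weight dominates all derivatives
  -- there.
  set s : Set ℂ := Metric.ball ζ (b - |ζ.im|) with hs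
  set K := Real.exp (ν * (|ζ.re| + (b - |ζ.im|))) with hK
  have hnorm : ∀ t : ℝ, ∀ x ∈ s, ‖Complex.exp (-x * (ν + t * Complex.I))‖ ≤
      K * Real.exp (b * |t|) := by
    intro t x hx
    have hd : ‖x - ζ‖ < b - |ζ.im| := by simpa [hs, dist_eq_norm] using hx
    have hre : |x.re - ζ.re| < b - |ζ.im| := by
      simpa using (Complex.abs_re_le_norm (x - ζ)).trans_lt hd
    have him : |x.im - ζ.im| < b - |ζ.im| := by
      simpa using (Complex.abs_im_le_norm (x - ζ)).trans_lt hd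
    have hre' : -x.re ≤ |ζ.re| + (b - |ζ.im|) := by
      have := abs_lt.1 hre; have := neg_abs_le ζ.re; linarith
    have him' : |x.im| ≤ b := by
      have := abs_sub_abs_le_abs_sub x.im ζ.im; linarith
    rw [Complex.norm_exp, hK, ← Real.exp_add]
    refine Real.exp_le_exp.2 ?_
    have hval : (-x * (ν + t * Complex.I)).re = ν * (-x.re) + x.im * t := by
      simp; ring
    rw [hval]
    have : x.im * t ≤ |x.im| * |t| := by rw [← abs_mul]; exact le_abs_self _
    have : |x.im| * |t| ≤ b * |t| := by gcongr
    have : ν * (-x.re) ≤ ν * (|ζ.re| + (b - |ζ.im|)) := by gcongr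
    linarith
  have hzs : ζ ∈ s := Metric.mem_ball_self (by linarith)
  have hbint := (integrable_gammaPair_mul_exp h0 h1 hb2).const_mul (K * (1 + ν))
  refine (hasDerivAt_integral_of_dominated_loc_of_deriv_le (μ := volume)
    (F := fun ζ (t : ℝ) => gammaPair β ν t * Complex.exp (-ζ * (ν + t * Complex.I)))
    (F' := fun ζ (t : ℝ) => gammaPair β ν t * (Complex.exp (-ζ * (ν + t * Complex.I)) *
      (-1 * (ν + t * Complex.I)))) (bound := fun t => K * (1 + ν) *
        (‖gammaPair β ν t‖ * ((1 + |t|) * Real.exp (b * |t|)))) (s := s)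
    (Metric.ball_mem_nhds ζ (by linarith)) (Eventually.of_forall hmeas) ?_ ?_ ?_ hbint ?_).2.differentiableAt
  · refine hbint.mono' (hmeas ζ) (ae_of_all _ fun t => ?_)
    rw [norm_mul]
    calc _ ≤ ‖gammaPair β ν t‖ * (K * Real.exp (b * |t|)) := by gcongr; exact hnorm t ζ hzs
      _ = K * 1 * (‖gammaPair β ν t‖ * (1 * Real.exp (b * |t|))) := by ring
      _ ≤ _ := by
        have := abs_nonneg t
        gcongr <;> linarith
  · exact ((continuous_gammaPair h0 h1).mul (by fun_prop)).aestronglyMeasurable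
  · refine ae_of_all _ fun t x hx => ?_
    rw [norm_mul, norm_mul]
    have hv : ‖-1 * ((ν : ℂ) + t * Complex.I)‖ ≤ (1 + ν) * (1 + |t|) := by
      rw [neg_one_mul, norm_neg]
      refine (norm_add_le _ _).trans ?_
      simp only [Complex.norm_real, norm_mul, Complex.norm_I, mul_one, Real.norm_eq_abs,
        abs_of_pos h0]
      nlinarith [abs_nonneg t]
    calc _ ≤ ‖gammaPair β ν t‖ * ((K * Real.exp (b * |t|)) * ((1 + ν) * (1 + |t|))) := by
          gcongr; exact hnorm t x hx
      _ = _ := by ring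
  · refine ae_of_all _ fun t x _ => ?_
    exact (((hasDerivAt_id x).neg.mul_const _).cexp).const_mul _

theorem one_add_exp_mem_slitPlane {ζ : ℂ} (hζ : |ζ.im| < Real.pi) :
    1 + Complex.exp ζ ∈ Complex.slitPlane := by
  rw [Complex.mem_slitPlane_iff]
  by_cases h : ζ.im = 0
  · left
    have : (Complex.exp ζ).re = Real.exp ζ.re := by rw [Complex.exp_re, h]; simp
    rw [Complex.add_re, this]
    simp only [Complex.one_re]
    positivity
  · right
    rw [Complex.add_im, Complex.exp_im]
    simp only [Complex.one_im, zero_add]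
    refine mul_ne_zero (Real.exp_pos _).ne' fun hsin => h ?_
    have := abs_lt.1 hζ
    exact (Real.sin_eq_zero_iff_of_lt_of_lt this.1 this.2).1 hsin

/-- Mellin-Barnes integral of the binomial function in its maximal sector. -/
theorem integral_gammaPair (h0 : 0 < ν) (h1 : ν < β) {ζ : ℂ} (hζ : |ζ.im| < Real.pi) :
    ∫ t : ℝ, gammaPair β ν t * Complex.exp (-ζ * (ν + t * Complex.I)) =
      2 * Real.pi * Real.Gamma β * (1 + Complex.exp ζ) ^ (-(β : ℂ)) := by
  set U : Set ℂ := Complex.im ⁻¹' Set.Ioo (-Real.pi) Real.pi with hU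
  have hUo : IsOpen U := isOpen_Ioo.preimage Complex.continuous_im
  have hUc : IsPreconnected U :=
    ((convex_Ioo (-Real.pi) Real.pi).linear_preimage Complex.imLm).isPreconnected
  have hf : AnalyticOnNhd ℂ (fun ζ : ℂ => ∫ t : ℝ, gammaPair β ν t *
      Complex.exp (-ζ * (ν + t * Complex.I))) U :=
    DifferentiableOn.analyticOnNhd (fun z hz => (differentiableAt_integral_gammaPair h0 h1
      (abs_lt.2 hz)).differentiableWithinAt) hUo
  have hg : AnalyticOnNhd ℂ (fun ζ : ℂ => 2 * Real.pi * Real.Gamma β *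
      (1 + Complex.exp ζ) ^ (-(β : ℂ))) U :=
    DifferentiableOn.analyticOnNhd (fun z hz => by
      refine DifferentiableAt.differentiableWithinAt ?_
      exact ((Complex.differentiableAt_exp.const_add 1).cpow_const
        (one_add_exp_mem_slitPlane (abs_lt.2 hz))).const_mul _) hUo
  have hz0 : (0 : ℂ) ∈ U := by simp [hU, Real.pi_pos]
  have ht : Tendsto (fun x : ℝ => (x : ℂ)) (𝓝[≠] 0) (𝓝[≠] 0) := by
    refine tendsto_nhdsWithin_iff.2 ⟨?_, ?_⟩
    · exact (Complex.continuous_ofReal.tendsto' 0 0 rfl).mono_left nhdsWithin_le_nhds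
    · filter_upwards [self_mem_nhdsWithin] with x hx
      simpa using hx
  -- Both sides are analytic on |Im ζ| < π and agree at real points accumulating at 0.
  refine hf.eqOn_of_preconnected_of_frequently_eq hg hUc hz0 ?_ (abs_lt.1 hζ)
  exact ht.frequently (Eventually.of_forall fun x => integral_gammaPair_ofReal h0 h1 x).frequently

end Binomial

/-! ### The bivariate H-function at second argument -1. -/

theorem asepBivParams_kernel (r : ℝ) (s v : ℂ) : (asepBivParams r).kernel s v =
    Complex.Gamma (1 + r - s - v) / Complex.Gamma (1 + r - s - v + 1) *
      (Complex.Gamma s * (Complex.Gamma v * Complex.Gamma (r - v))) := by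
  have e : (1 : ℂ) - (-1 - r) - s - v = 1 + r - s - v + 1 := by ring
  simp [BivFoxParams.kernel, FoxParams.kernel, asepBivParams, e]

section Bivariate

variable {r σ ν a : ℝ}

theorem asepBivParams_isContour_iff {x y : ℂ} : (asepBivParams r).IsContour σ ν x y ↔
    0 < σ ∧ (0 < ν ∧ ν < r) ∧ σ + ν < 1 + r ∧
      Integrable ((asepBivParams r).integrand σ ν x y) := by
  simp only [BivFoxParams.IsContour, FoxParams.Separates, asepBivParams]
  simp
  intro _ _ _ _
  constructor <;> intro h <;> linarith

/-- The factor `Γ(s) a^{-s}` on the line `Re s = σ`. -/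
noncomputable def gammaPow (σ a t : ℝ) : ℂ :=
  Complex.Gamma (σ + t * Complex.I) * (a : ℂ) ^ (-((σ : ℂ) + t * Complex.I))

/-- The integrand of the bivariate H-function at the second argument `exp ζ`. -/
noncomputable def bivIntegrand (r σ ν a : ℝ) (ζ : ℂ) (z : ℝ × ℝ) : ℂ :=
  (1 + r - (σ + z.1 * Complex.I) - (ν + z.2 * Complex.I))⁻¹ *
    (gammaPow σ a z.1 * (gammaPair r ν z.2 * Complex.exp (-ζ * (ν + z.2 * Complex.I))))

theorem asepBivParams_integrand (h : σ + ν < 1 + r) (z : ℝ × ℝ) :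
    (asepBivParams r).integrand σ ν a (-1) z = bivIntegrand r σ ν a (Real.pi * Complex.I) z := by
  have hne : (1 : ℂ) + r - (σ + z.1 * Complex.I) - (ν + z.2 * Complex.I) ≠ 0 := by
    intro h0
    have := congrArg Complex.re h0
    simp at this
    linarith
  have hΓ : Complex.Gamma ((1 : ℂ) + r - (σ + z.1 * Complex.I) - (ν + z.2 * Complex.I)) ≠ 0 :=
    Complex.Gamma_ne_zero_of_re_pos (by simp; linarith)
  rw [BivFoxParams.integrand, asepBivParams_kernel, Complex.Gamma_add_one _ hne, bivIntegrand,
    gammaPow, gammaPair, Complex.cpow_def_of_ne_zero (show (-1 : ℂ) ≠ 0 by norm_num), Complex.log_neg_one]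
  have e : (Real.pi : ℂ) * Complex.I * -((ν : ℂ) + z.2 * Complex.I) =
      -(Real.pi * Complex.I) * (ν + z.2 * Complex.I) := by ring
  rw [e, div_mul_cancel_right₀ hΓ]
  ring

theorem continuous_gammaPow (hσ : 0 < σ) (ha : 0 < a) : Continuous (gammaPow σ a) := by
  refine (continuous_Gamma_vertical hσ).mul ?_
  exact Continuous.const_cpow (by fun_prop) (Or.inl (by exact_mod_cast ha.ne'))

theorem norm_gammaPow (ha : 0 < a) (t : ℝ) :
    ‖gammaPow σ a t‖ = ‖Complex.Gamma (σ + t * Complex.I)‖ * a ^ (-σ) := by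
  rw [gammaPow, norm_mul, Complex.norm_cpow_eq_rpow_re_of_pos ha]
  simp

theorem integrable_gammaPow (hσ : 0 < σ) (ha : 0 < a) : Integrable (gammaPow σ a) := by
  have h : Integrable fun t : ℝ => Complex.Gamma (σ + t * Complex.I) := by
    simpa [Complex.VerticalIntegrable] using verticalIntegrable_Gamma_sub hσ
  refine (h.norm.mul_const (a ^ (-σ))).mono' (continuous_gammaPow hσ ha).aestronglyMeasurable
    (ae_of_all _ fun t => (norm_gammaPow ha t).le)

theorem norm_exp_mul_vertical (α ν t : ℝ) :
    ‖Complex.exp (-(α * Complex.I) * (ν + t * Complex.I))‖ = Real.exp (α * t) := by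
  rw [Complex.norm_exp]
  congr 1
  simp

theorem integrable_gammaPair_mul_cexp (h0 : 0 < ν) (h1 : ν < r) {α : ℝ} (hα : |α| < Real.pi) :
    Integrable fun t : ℝ => gammaPair r ν t *
      Complex.exp (-(α * Complex.I) * (ν + t * Complex.I)) := by
  refine (integrable_gammaPair_mul_exp h0 h1 hα).mono'
    ((continuous_gammaPair h0 h1).mul (by fun_prop)).aestronglyMeasurable (ae_of_all _ fun t => ?_)
  rw [norm_mul, norm_exp_mul_vertical]
  have : Real.exp (α * t) ≤ Real.exp (|α| * |t|) :=
    Real.exp_le_exp.2 (by rw [← abs_mul]; exact le_abs_self _)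
  gcongr
  calc _ ≤ 1 * Real.exp (|α| * |t|) := by rwa [one_mul]
    _ ≤ _ := by gcongr; linarith [abs_nonneg t]

theorem continuous_bivIntegrand (hσ : 0 < σ) (h0 : 0 < ν) (h1 : ν < r) (h : σ + ν < 1 + r)
    (ha : 0 < a) (ζ : ℂ) : Continuous (bivIntegrand r σ ν a ζ) := by
  refine Continuous.mul (Continuous.inv₀ (by fun_prop) fun z h0 => ?_) ?_
  · have := congrArg Complex.re h0
    simp at this
    linarith
  · exact ((continuous_gammaPow hσ ha).comp continuous_fst).mul
      (((continuous_gammaPair h0 h1).comp continuous_snd).mul (by fun_prop))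

theorem norm_inv_vertical_le (h : σ + ν < 1 + r) (z : ℝ × ℝ) :
    ‖((1 : ℂ) + r - (σ + z.1 * Complex.I) - (ν + z.2 * Complex.I))⁻¹‖ ≤ (1 + r - σ - ν)⁻¹ := by
  rw [norm_inv]
  refine inv_anti₀ (by linarith) ?_
  have := Complex.re_le_norm ((1 : ℂ) + r - (σ + z.1 * Complex.I) - (ν + z.2 * Complex.I))
  simpa using this

theorem integrable_bivIntegrand (hσ : 0 < σ) (h0 : 0 < ν) (h1 : ν < r) (h : σ + ν < 1 + r)
    (ha : 0 < a) {α : ℝ} (hα : |α| < Real.pi) :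
    Integrable (bivIntegrand r σ ν a (α * Complex.I)) := by
  refine (((integrable_gammaPow hσ ha).mul_prod (integrable_gammaPair_mul_cexp h0 h1 hα)).norm.const_mul
    (1 + r - σ - ν)⁻¹).mono' (continuous_bivIntegrand hσ h0 h1 h ha _).aestronglyMeasurable
    (ae_of_all _ fun z => ?_)
  rw [bivIntegrand, norm_mul]
  gcongr
  exact norm_inv_vertical_le h z

/-- The bivariate integral at a second argument `exp (jα)` off the negative axis. -/
theorem integral_bivIntegrand (hσ : 0 < σ) (h0 : 0 < ν) (h1 : ν < r) (h : σ + ν < 1 + r)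
    (ha : 0 < a) {α : ℝ} (hα : |α| < Real.pi) :
    ∫ z, bivIntegrand r σ ν a (α * Complex.I) z = (2 * Real.pi) ^ 2 * Real.Gamma r *
      ∫ w in Set.Ioo (0 : ℝ) 1, ((w ^ r * Real.exp (-(a * w)) : ℝ) : ℂ) *
        (1 + w * Complex.exp (α * Complex.I)) ^ (-(r : ℂ)) := by
  set g₁ := gammaPow σ a with hg₁
  set g₂ : ℝ → ℂ := fun t => gammaPair r ν t *
    Complex.exp (-(α * Complex.I) * (ν + t * Complex.I)) with hg₂
  have i₁ : Integrable g₁ := integrable_gammaPow hσ ha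
  have i₂ : Integrable g₂ := integrable_gammaPair_mul_cexp h0 h1 hα
  set G : (ℝ × ℝ) → ℝ → ℂ := fun z w =>
    (w : ℂ) ^ ((r : ℂ) - (σ + z.1 * Complex.I) - (ν + z.2 * Complex.I)) * (g₁ z.1 * g₂ z.2) with hG
  have hnorm : ∀ z : ℝ × ℝ, ∀ w : ℝ, 0 < w → ‖(w : ℂ) ^ ((r : ℂ) - (σ + z.1 * Complex.I) -
      (ν + z.2 * Complex.I))‖ = w ^ (r - σ - ν) := by
    intro z w hw
    rw [Complex.norm_cpow_eq_rpow_re_of_pos hw]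
    simp
  -- the kernel factor is itself an integral over the unit interval
  have hz : ∀ z, bivIntegrand r σ ν a (α * Complex.I) z = ∫ w in Set.Ioo (0 : ℝ) 1, G z w := by
    intro z
    simp only [hG]
    have hre : -1 < ((r : ℂ) - (σ + z.1 * Complex.I) - (ν + z.2 * Complex.I)).re := by
      simp; linarith
    have hne : (r : ℂ) - (σ + z.1 * Complex.I) - (ν + z.2 * Complex.I) + 1 ≠ 0 := by
      intro h0
      have := congrArg Complex.re h0
      simp at this
      linarith
    rw [integral_mul_const, ← integral_Ioc_eq_integral_Ioo,
      ← intervalIntegral.integral_of_le zero_le_one, integral_cpow (Or.inl hre)]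
    rw [Complex.ofReal_one, Complex.one_cpow, Complex.ofReal_zero, Complex.zero_cpow hne, sub_zero,
      one_div, bivIntegrand]
    congr 2
    ring
  have hint : Integrable (Function.uncurry G)
      ((volume : Measure (ℝ × ℝ)).prod (volume.restrict (Set.Ioo (0 : ℝ) 1))) := by
    have hw : IntegrableOn (fun w : ℝ => w ^ (r - σ - ν)) (Set.Ioo 0 1) :=
      (intervalIntegral.integrableOn_Ioo_rpow_iff one_pos).2 (by linarith)
    have hbig := (i₁.mul_prod i₂).norm.mul_prod hw
    have hm₁ : AEStronglyMeasurable (fun x : (ℝ × ℝ) × ℝ => g₁ x.1.1 * g₂ x.1.2)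
        ((volume : Measure (ℝ × ℝ)).prod (volume.restrict (Set.Ioo (0 : ℝ) 1))) :=
      (i₁.mul_prod i₂).aestronglyMeasurable.comp_fst
    have hm₂ : Measurable (fun x : (ℝ × ℝ) × ℝ =>
        (x.2 : ℂ) ^ ((r : ℂ) - (σ + x.1.1 * Complex.I) - (ν + x.1.2 * Complex.I))) := by fun_prop
    refine hbig.mono' (hm₂.aestronglyMeasurable.mul hm₁) ?_
    have hae : ∀ᵐ x : (ℝ × ℝ) × ℝ ∂((volume : Measure (ℝ × ℝ)).prod
        (volume.restrict (Set.Ioo (0 : ℝ) 1))), x.2 ∈ Set.Ioo (0 : ℝ) 1 :=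
      Measure.quasiMeasurePreserving_snd.ae (ae_restrict_mem measurableSet_Ioo)
    filter_upwards [hae] with x hx
    simp only [Function.uncurry, hG]
    rw [norm_mul, hnorm x.1 x.2 hx.1, mul_comm]
  simp only [hz]
  rw [integral_integral_swap hint, ← integral_const_mul]
  refine setIntegral_congr_fun measurableSet_Ioo fun w hw => ?_
  have hw0 : (w : ℂ) ≠ 0 := by exact_mod_cast hw.1.ne'
  simp only [hG]
  -- For fixed w the integrand is a product in s and v. The s-integral is Cahen-Mellin at aw, and
  -- the v-integral is the binomial formula at ζ = log w + jα.
  have hsplit : ∀ z : ℝ × ℝ, (w : ℂ) ^ ((r : ℂ) - (σ + z.1 * Complex.I) - (ν + z.2 * Complex.I)) *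
      (g₁ z.1 * g₂ z.2) = (w : ℂ) ^ (r : ℂ) *
        (((w : ℂ) ^ (-((σ : ℂ) + z.1 * Complex.I)) * g₁ z.1) *
          ((w : ℂ) ^ (-((ν : ℂ) + z.2 * Complex.I)) * g₂ z.2)) := by
    intro z
    rw [sub_eq_add_neg, sub_eq_add_neg, Complex.cpow_add _ _ hw0, Complex.cpow_add _ _ hw0]
    ring
  simp only [hsplit]
  rw [integral_const_mul]
  have hprod := integral_prod_mul (μ := (volume : Measure ℝ)) (ν := (volume : Measure ℝ))
    (fun t : ℝ => (w : ℂ) ^ (-((σ : ℂ) + t * Complex.I)) * g₁ t)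
    (fun t : ℝ => (w : ℂ) ^ (-((ν : ℂ) + t * Complex.I)) * g₂ t)
  rw [← Measure.volume_eq_prod] at hprod
  rw [hprod]
  have hA : ∫ t : ℝ, (w : ℂ) ^ (-((σ : ℂ) + t * Complex.I)) * g₁ t =
      2 * Real.pi * Real.exp (-(a * w)) := by
    have hm := mellinInv_Gamma hσ (mul_pos ha hw.1)
    rw [mellinInv, Complex.real_smul] at hm
    rw [← hm]
    have hp : ((2 * Real.pi : ℝ) : ℂ) ≠ 0 := by
      exact_mod_cast (mul_pos two_pos Real.pi_pos).ne'
    have e : (2 * Real.pi : ℂ) = ((2 * Real.pi : ℝ) : ℂ) := by push_cast; rfl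
    rw [e, ← mul_assoc, ← Complex.ofReal_mul, mul_one_div_cancel (mul_pos two_pos Real.pi_pos).ne',
      Complex.ofReal_one, one_mul]
    refine integral_congr_ae (ae_of_all _ fun t => ?_)
    simp only [hg₁, gammaPow, smul_eq_mul]
    rw [Complex.ofReal_mul, Complex.mul_cpow_ofReal_nonneg ha.le hw.1.le]
    ring
  have hB : ∫ t : ℝ, (w : ℂ) ^ (-((ν : ℂ) + t * Complex.I)) * g₂ t =
      2 * Real.pi * Real.Gamma r * (1 + w * Complex.exp (α * Complex.I)) ^ (-(r : ℂ)) := by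
    have hm := integral_gammaPair h0 h1 (ζ := Real.log w + α * Complex.I) (by simpa using hα)
    rw [Complex.exp_add, ← Complex.ofReal_exp, Real.exp_log hw.1] at hm
    rw [← hm]
    refine integral_congr_ae (ae_of_all _ fun t => ?_)
    simp only [hg₂]
    rw [Complex.cpow_def_of_ne_zero hw0, ← Complex.ofReal_log hw.1.le, mul_left_comm,
      ← Complex.exp_add]
    congr 2
    ring
  rw [hA, hB, Complex.ofReal_mul, Complex.ofReal_cpow hw.1.le]
  ring

/-- By Fubini some fixed s leaves an integrable function of v. As Im v = u → +∞ the factor e^(πu)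
from (-1)^(-v) cancels the decay of Γ(v)Γ(r-v), so its modulus is at least a constant times u^(r-2),
which forces r - 2 < -1. -/
theorem lt_one_of_integrable_bivIntegrand (hσ : 0 < σ) (h : σ + ν < 1 + r) (ha : 0 < a)
    (hint : Integrable (bivIntegrand r σ ν a (Real.pi * Complex.I))) : r < 1 := by
  rw [Measure.volume_eq_prod] at hint
  obtain ⟨t, ht⟩ := hint.prod_right_ae.exists
  obtain ⟨C, hC, hb⟩ := hasVerticalOrder_Gamma_mul_Gamma r ν ν
  have hC0 : 0 < C := by linarith
  set A := |1 + r - σ - ν| + |t| with hA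
  have hA0 : 0 ≤ A := by positivity
  have hg : 0 < ‖gammaPow σ a t‖ := by
    rw [norm_gammaPow ha]
    have : 0 < ‖Complex.Gamma (σ + t * Complex.I)‖ :=
      norm_pos_iff.2 (Complex.Gamma_ne_zero_of_re_pos (by simpa using hσ))
    positivity
  have hI : IntegrableOn (fun u : ℝ => u ^ (r - 2)) (Set.Ioi 1) := by
    refine (ht.integrableOn.norm.const_mul ((A + 1) * C / ‖gammaPow σ a t‖)).mono' (by fun_prop) ?_
    refine (ae_restrict_iff' measurableSet_Ioi).2 (ae_of_all _ fun u hu => ?_)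
    have hu1 : (1 : ℝ) < u := hu
    have hu0 : (0 : ℝ) < u := by linarith
    have hl := (hb ν ⟨le_rfl, le_rfl⟩ u (by rw [abs_of_pos hu0]; exact hu1.le)).1
    rw [abs_of_pos hu0, zero_mul, add_zero] at hl
    have hl' : C⁻¹ * u ^ (r - 1) ≤ ‖gammaPair r ν u‖ * Real.exp (Real.pi * u) := by
      calc C⁻¹ * u ^ (r - 1) = C⁻¹ * (u ^ (r - 1) * Real.exp (-(Real.pi * u))) *
            Real.exp (Real.pi * u) := by
            rw [Real.exp_neg]; field_simp
        _ ≤ _ := by gcongr; exact hl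
    have hden : ‖(1 : ℂ) + r - (σ + t * Complex.I) - (ν + u * Complex.I)‖ ≤ (A + 1) * u := by
      have e : (1 : ℂ) + r - (σ + t * Complex.I) - (ν + u * Complex.I) =
          ((1 + r - σ - ν : ℝ) : ℂ) - t * Complex.I - u * Complex.I := by push_cast; ring
      rw [e]
      refine (norm_sub_le _ _).trans ((add_le_add_left (norm_sub_le _ _) _).trans ?_)
      simp only [Complex.norm_real, norm_mul, Complex.norm_I, mul_one, Real.norm_eq_abs,
        abs_of_pos hu0]
      rw [← hA]
      nlinarith
    have hne : (1 : ℂ) + r - (σ + t * Complex.I) - (ν + u * Complex.I) ≠ 0 := by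
      intro h0
      have := congrArg Complex.re h0
      simp at this
      linarith
    rw [Real.norm_of_nonneg (by positivity), bivIntegrand, norm_mul, norm_mul, norm_mul, norm_inv,
      norm_exp_mul_vertical]
    calc u ^ (r - 2) = (A + 1) * C / ‖gammaPow σ a t‖ *
          (((A + 1) * u)⁻¹ * (‖gammaPow σ a t‖ * (C⁻¹ * u ^ (r - 1)))) := by
          rw [show r - 1 = (r - 2) + 1 by ring, Real.rpow_add hu0, Real.rpow_one]
          field_simp
      _ ≤ _ := by
          have : 0 < ‖(1 : ℂ) + r - (σ + t * Complex.I) - (ν + u * Complex.I)‖ := norm_pos_iff.2 hne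
          gcongr
  have := (integrableOn_Ioi_rpow_iff one_pos).1 hI
  linarith

theorem norm_one_add_mul_exp_ge {w : ℝ} (hw : w ∈ Set.Ioo (0 : ℝ) 1) (α : ℝ) :
    1 - w ≤ ‖1 + w * Complex.exp (α * Complex.I)‖ := by
  have h := norm_sub_le_norm_add (1 : ℂ) (w * Complex.exp (α * Complex.I))
  rw [norm_one, norm_mul, Complex.norm_exp_ofReal_mul_I, Complex.norm_real,
    Real.norm_of_nonneg hw.1.le, mul_one] at h
  exact h

/-- The value at second argument `-1` of the bivariate H-function occurring in the ASEP. -/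
theorem asepBivParams_foxH_eq (hr : r < 1) (ha : 0 < a)
    (hc : (asepBivParams r).IsContour σ ν a (-1)) :
    (asepBivParams r).foxH σ ν a (-1) = ((Real.Gamma r * ∫ w in Set.Ioo (0 : ℝ) 1,
      w ^ r * (1 - w) ^ (-r) * Real.exp (-(a * w)) : ℝ) : ℂ) := by
  obtain ⟨hσ, ⟨h0, h1⟩, h, hint⟩ := asepBivParams_isContour_iff.1 hc
  have hr0 : 0 < r := h0.trans h1
  have hfun : (asepBivParams r).integrand σ ν a (-1) =
      bivIntegrand r σ ν a (Real.pi * Complex.I) := funext fun z => asepBivParams_integrand h z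
  rw [BivFoxParams.foxH, hfun]
  rw [hfun] at hint
  have hα : ∀ᶠ α in 𝓝[<] Real.pi, α ∈ Set.Ioo 0 Real.pi := Ioo_mem_nhdsLT Real.pi_pos
  have habs : ∀ α ∈ Set.Ioo 0 Real.pi, |α| < Real.pi := fun α hα => by
    rw [abs_of_pos hα.1]; exact hα.2
  have L1 : Tendsto (fun α : ℝ => ∫ z, bivIntegrand r σ ν a (α * Complex.I) z) (𝓝[<] Real.pi)
      (𝓝 (∫ z, bivIntegrand r σ ν a (Real.pi * Complex.I) z)) := by
    -- The value at -1 is reached as the angle α tends to π from below. Since αt ≤ max(0, πt), the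
    -- moduli at angles 0 and π together dominate all intermediate ones.
    refine tendsto_integral_filter_of_dominated_convergence
      (fun z => ‖bivIntegrand r σ ν a (Real.pi * Complex.I) z‖ +
        ‖bivIntegrand r σ ν a ((0 : ℝ) * Complex.I) z‖)
      (Eventually.of_forall fun α => (continuous_bivIntegrand hσ h0 h1 h ha _).aestronglyMeasurable)
      ?_ (hint.norm.add (integrable_bivIntegrand hσ h0 h1 h ha (by simp [Real.pi_pos])).norm)
      (ae_of_all _ fun z => ?_)
    · filter_upwards [hα] with α hα
      refine ae_of_all _ fun z => ?_
      simp only [bivIntegrand, norm_mul, norm_exp_mul_vertical]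
      rw [← mul_add, ← mul_add, ← mul_add]
      gcongr
      rcases le_total 0 z.2 with hz | hz
      · have : Real.exp (α * z.2) ≤ Real.exp (Real.pi * z.2) :=
          Real.exp_le_exp.2 (by gcongr; exact hα.2.le)
        linarith [Real.exp_pos (0 * z.2)]
      · have : Real.exp (α * z.2) ≤ Real.exp (0 * z.2) :=
          Real.exp_le_exp.2 (by nlinarith [hα.1])
        linarith [Real.exp_pos (Real.pi * z.2)]
    · have : Continuous fun α : ℝ => bivIntegrand r σ ν a (α * Complex.I) z := by
        unfold bivIntegrand; fun_prop
      exact (this.tendsto _).mono_left nhdsWithin_le_nhds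
  have L2 : Tendsto (fun α : ℝ => ∫ w in Set.Ioo (0 : ℝ) 1,
      ((w ^ r * Real.exp (-(a * w)) : ℝ) : ℂ) *
        (1 + w * Complex.exp (α * Complex.I)) ^ (-(r : ℂ))) (𝓝[<] Real.pi)
      (𝓝 (∫ w in Set.Ioo (0 : ℝ) 1, ((w ^ r * Real.exp (-(a * w)) : ℝ) : ℂ) *
        (1 + w * Complex.exp (Real.pi * Complex.I)) ^ (-(r : ℂ)))) := by
    -- Here |1 + w e^(jα)| ≥ 1 - w for every α, and (1-w)^(-r) is integrable because r < 1.
    refine tendsto_integral_filter_of_dominated_convergence (fun w => (1 - w) ^ (-r))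
      (Eventually.of_forall fun α => Measurable.aestronglyMeasurable (by fun_prop))
      (Eventually.of_forall fun α => ?_) ?_ ?_
    · refine (ae_restrict_iff' measurableSet_Ioo).2 (ae_of_all _ fun w hw => ?_)
      have hw1 : 0 < 1 - w := by linarith [hw.2]
      have hge := norm_one_add_mul_exp_ge hw α
      have hpos : 0 < ‖1 + w * Complex.exp (α * Complex.I)‖ := hw1.trans_le hge
      rw [norm_mul, Complex.norm_real, Real.norm_of_nonneg (by have := hw.1; positivity),
        Complex.norm_cpow_of_ne_zero (norm_pos_iff.1 hpos)]
      have e1 : (-(r : ℂ)).im = 0 := by simp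
      have e2 : (-(r : ℂ)).re = -r := by simp
      rw [e1, e2, mul_zero, Real.exp_zero, div_one]
      have p1 : w ^ r * Real.exp (-(a * w)) ≤ 1 := by
        refine mul_le_one₀ (Real.rpow_le_one hw.1.le hw.2.le hr0.le) (Real.exp_pos _).le ?_
        exact Real.exp_le_one_iff.2 (by have := mul_pos ha hw.1; linarith)
      have p2 := Real.rpow_le_rpow_of_nonpos hw1 hge (neg_nonpos.2 hr0.le)
      calc _ ≤ 1 * (1 - w) ^ (-r) := by gcongr
        _ = _ := one_mul _
    · have := ((intervalIntegral.intervalIntegrable_rpow' (r := -r) (a := 0) (b := 1)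
        (by linarith)).comp_sub_left 1)
      simp only [sub_zero, sub_self] at this
      exact (intervalIntegrable_iff_integrableOn_Ioo_of_le zero_le_one).1 this.symm
    · refine (ae_restrict_iff' measurableSet_Ioo).2 (ae_of_all _ fun w hw => ?_)
      refine Tendsto.mono_left (ContinuousAt.tendsto ?_) nhdsWithin_le_nhds
      refine ContinuousAt.mul (by fun_prop) (ContinuousAt.cpow (by fun_prop) continuousAt_const ?_)
      rw [Complex.exp_pi_mul_I, Complex.mem_slitPlane_iff]
      left
      simp
      exact hw.2
  have L3 := tendsto_nhds_unique (L1.congr' (by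
    filter_upwards [hα] with α hα
    exact integral_bivIntegrand hσ h0 h1 h ha (habs α hα)))
    (L2.const_mul ((2 * Real.pi : ℂ) ^ 2 * Real.Gamma r))
  rw [L3, Complex.ofReal_mul, ← integral_complex_ofReal, ← mul_assoc, ← mul_assoc]
  have hπ : (Real.pi : ℂ) ≠ 0 := by exact_mod_cast Real.pi_ne_zero
  congr 1
  · field_simp
  · refine setIntegral_congr_fun measurableSet_Ioo fun w hw => ?_
    have hw1 : 0 < 1 - w := by linarith [hw.2]
    rw [Complex.exp_pi_mul_I, mul_neg_one, ← sub_eq_add_neg]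
    have : (1 - (w : ℂ)) ^ (-(r : ℂ)) = (((1 - w) ^ (-r) : ℝ) : ℂ) := by
      rw [Complex.ofReal_cpow hw1.le]; push_cast; rfl
    rw [this, ← Complex.ofReal_mul]
    congr 1
    ring

theorem lt_one_of_isContour (ha : 0 < a) (hc : (asepBivParams r).IsContour σ ν a (-1)) : r < 1 := by
  obtain ⟨hσ, -, h, hint⟩ := asepBivParams_isContour_iff.1 hc
  rw [show (asepBivParams r).integrand σ ν a (-1) =
      bivIntegrand r σ ν a (Real.pi * Complex.I) from
    funext fun z => asepBivParams_integrand h z] at hint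
  exact lt_one_of_integrable_bivIntegrand hσ h ha hint

end Bivariate

/-! ### The excess over the ceiling and its Mellin-type integral. -/

/-- Excess of `exp(-a x)` over its limit along the saturating curve `x = u / (1 + u)`. -/
noncomputable def satExp (a u : ℝ) : ℝ := Real.exp (-(a * (u / (1 + u)))) - Real.exp (-a)

section SatExp

variable {a β : ℝ}

theorem measurable_satExp (a : ℝ) : Measurable (satExp a) := by
  unfold satExp; fun_prop

theorem satExp_nonneg (ha : 0 < a) {u : ℝ} (hu : 0 < u) : 0 ≤ satExp a u := by
  rw [satExp, sub_nonneg]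
  refine Real.exp_le_exp.2 (neg_le_neg ?_)
  refine mul_le_of_le_one_right ha.le ?_
  rw [div_le_one (by positivity)]
  linarith

theorem satExp_le_one (ha : 0 < a) {u : ℝ} (hu : 0 < u) : satExp a u ≤ 1 := by
  have h1 : Real.exp (-(a * (u / (1 + u)))) ≤ 1 :=
    Real.exp_le_one_iff.2 (neg_nonpos.2 (by positivity))
  have h2 := Real.exp_pos (-a)
  rw [satExp]
  linarith

/-- Since u/(1+u) = 1 - 1/(1+u), this is the inequality 1 - e^(-y) ≤ y at y = a/(1+u). -/
theorem satExp_le_div (ha : 0 < a) {u : ℝ} (hu : 0 < u) : satExp a u ≤ a / (1 + u) := by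
  have h1 : Real.exp (-(a * (u / (1 + u)))) ≤ 1 :=
    Real.exp_le_one_iff.2 (neg_nonpos.2 (by positivity))
  have h2 : Real.exp (-a) = Real.exp (-(a * (u / (1 + u)))) * Real.exp (-(a / (1 + u))) := by
    rw [← Real.exp_add]
    congr 1
    field_simp
    ring
  have h3 := Real.add_one_le_exp (-(a / (1 + u)))
  have h4 : 0 < a / (1 + u) := by positivity
  rw [satExp, h2]
  nlinarith [Real.exp_pos (-(a * (u / (1 + u))))]

/-- The bound 1 gives convergence at the origin for β > 0, and the bound a/u gives it at infinity
for β < 1. -/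
theorem integrableOn_rpow_mul_satExp (ha : 0 < a) (h0 : 0 < β) (h1 : β < 1) :
    IntegrableOn (fun u => u ^ (β - 1) * satExp a u) (Set.Ioi 0) := by
  have hm : Measurable fun u : ℝ => u ^ (β - 1) * satExp a u :=
    (by fun_prop : Measurable fun u : ℝ => u ^ (β - 1)).mul (measurable_satExp a)
  rw [← Set.Ioc_union_Ioi_eq_Ioi zero_le_one]
  refine IntegrableOn.union ?_ ?_
  · have hi : IntegrableOn (fun u : ℝ => u ^ (β - 1)) (Set.Ioc 0 1) :=
      (intervalIntegrable_iff_integrableOn_Ioc_of_le zero_le_one).1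
        (intervalIntegral.intervalIntegrable_rpow' (by linarith))
    refine hi.mono' hm.aestronglyMeasurable
      ((ae_restrict_iff' measurableSet_Ioc).2 (ae_of_all _ fun u hu => ?_))
    have hs := satExp_nonneg ha hu.1
    rw [Real.norm_of_nonneg (mul_nonneg (Real.rpow_nonneg hu.1.le _) hs)]
    exact mul_le_of_le_one_right (Real.rpow_nonneg hu.1.le _) (satExp_le_one ha hu.1)
  · have hi : IntegrableOn (fun u : ℝ => u ^ (β - 2)) (Set.Ioi 1) :=
      (integrableOn_Ioi_rpow_iff one_pos).2 (by linarith)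
    refine (hi.const_mul a).mono' hm.aestronglyMeasurable
      ((ae_restrict_iff' measurableSet_Ioi).2 (ae_of_all _ fun u hu => ?_))
    have hu0 : 0 < u := one_pos.trans hu
    have hs := satExp_nonneg ha hu0
    rw [Real.norm_of_nonneg (mul_nonneg (Real.rpow_nonneg hu0.le _) hs)]
    calc u ^ (β - 1) * satExp a u ≤ u ^ (β - 1) * (a / u) := by
          gcongr
          refine (satExp_le_div ha hu0).trans ?_
          gcongr
          linarith
      _ = a * u ^ (β - 2) := by
          rw [show β - 1 = (β - 2) + 1 by ring, Real.rpow_add hu0, Real.rpow_one]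
          field_simp

theorem integrableOn_beta_exp (ha : 0 < a) (h0 : 0 < β) (h1 : β < 1) :
    IntegrableOn (fun w : ℝ => w ^ β * (1 - w) ^ (-β) * Real.exp (-(a * w))) (Set.Ioo 0 1) := by
  have hi : IntegrableOn (fun w : ℝ => (1 - w) ^ (-β)) (Set.Ioo 0 1) := by
    have := ((intervalIntegral.intervalIntegrable_rpow' (r := -β) (a := 0) (b := 1)
      (by linarith)).comp_sub_left 1)
    simp only [sub_zero, sub_self] at this
    exact (intervalIntegrable_iff_integrableOn_Ioo_of_le zero_le_one).1 this.symm
  refine hi.mono' (Measurable.aestronglyMeasurable (by fun_prop))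
    ((ae_restrict_iff' measurableSet_Ioo).2 (ae_of_all _ fun w hw => ?_))
  have hw1 : 0 < 1 - w := by linarith [hw.2]
  have p1 : w ^ β ≤ 1 := Real.rpow_le_one hw.1.le hw.2.le h0.le
  have p2 : Real.exp (-(a * w)) ≤ 1 :=
    Real.exp_le_one_iff.2 (by have := mul_pos ha hw.1; linarith)
  rw [Real.norm_of_nonneg (by have := hw.1; positivity)]
  calc _ ≤ 1 * (1 - w) ^ (-β) * 1 := by gcongr
    _ = _ := by ring

theorem tendsto_rpow_mul_satExp_zero (h0 : 0 < β) :
    Tendsto (fun u => u ^ β * satExp a u) (𝓝[>] 0) (𝓝 0) := by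
  have h : ContinuousAt (fun u => u ^ β * satExp a u) 0 := by
    refine (Real.continuousAt_rpow_const 0 β (Or.inr h0.le)).mul ?_
    unfold satExp
    have : ContinuousAt (fun u : ℝ => u / (1 + u)) 0 :=
      ContinuousAt.div (by fun_prop) (by fun_prop) (by norm_num)
    fun_prop
  have := h.tendsto
  simp only [Real.zero_rpow h0.ne', zero_mul] at this
  exact this.mono_left nhdsWithin_le_nhds

theorem tendsto_rpow_mul_satExp_atTop (ha : 0 < a) (h1 : β < 1) :
    Tendsto (fun u => u ^ β * satExp a u) atTop (𝓝 0) := by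
  have hlim : Tendsto (fun u : ℝ => a * u ^ (-(1 - β))) atTop (𝓝 0) := by
    simpa using (tendsto_rpow_neg_atTop (sub_pos.2 h1)).const_mul a
  refine squeeze_zero' ?_ ?_ hlim
  · filter_upwards [eventually_gt_atTop 0] with u hu
    exact mul_nonneg (Real.rpow_nonneg hu.le _) (satExp_nonneg ha hu)
  · filter_upwards [eventually_gt_atTop 0] with u hu
    calc u ^ β * satExp a u ≤ u ^ β * (a / u) := by
          gcongr
          refine (satExp_le_div ha hu).trans ?_
          gcongr
          linarith
      _ = a * u ^ (-(1 - β)) := by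
          rw [show -(1 - β) = β - 1 by ring, Real.rpow_sub hu, Real.rpow_one]
          ring

theorem hasDerivAt_satExp {u : ℝ} (hu : 0 < u) :
    HasDerivAt (satExp a) (-(a * ((1 + u) ^ (-2 : ℤ) * Real.exp (-(a * (u / (1 + u))))))) u := by
  have h := (((hasDerivAt_div_one_add hu).const_mul a).neg.exp).sub_const (Real.exp (-a))
  refine h.congr_deriv ?_
  simp only [Pi.neg_apply]
  ring

theorem beta_exp_div_one_add {u : ℝ} (hu : 0 < u) :
    (1 + u) ^ (-2 : ℤ) • ((u / (1 + u)) ^ β * (1 - u / (1 + u)) ^ (-β) *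
      Real.exp (-(a * (u / (1 + u))))) =
    u ^ β * ((1 + u) ^ (-2 : ℤ) * Real.exp (-(a * (u / (1 + u))))) := by
  have h : 0 < 1 + u := by positivity
  have e : 1 - u / (1 + u) = (1 + u)⁻¹ := by field_simp; ring
  have hp : (1 + u) ^ β ≠ 0 := (Real.rpow_pos_of_pos h _).ne'
  rw [e, Real.div_rpow hu.le h.le, Real.inv_rpow h.le, Real.rpow_neg h.le, inv_inv, smul_eq_mul,
    div_mul_cancel₀ _ hp]
  ring

/-- Integration by parts and the substitution `w = u / (1 + u)`. -/
theorem mul_integral_rpow_mul_satExp (ha : 0 < a) (h0 : 0 < β) (h1 : β < 1) :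
    β * ∫ u in Set.Ioi (0 : ℝ), u ^ (β - 1) * satExp a u =
      a * ∫ w in Set.Ioo (0 : ℝ) 1, w ^ β * (1 - w) ^ (-β) * Real.exp (-(a * w)) := by
  have hi := integrableOn_beta_exp ha h0 h1
  rw [integrableOn_Ioo_iff_div_one_add] at hi
  have hi' : IntegrableOn (fun u : ℝ =>
      u ^ β * ((1 + u) ^ (-2 : ℤ) * Real.exp (-(a * (u / (1 + u)))))) (Set.Ioi 0) :=
    hi.congr_fun (fun u hu => beta_exp_div_one_add hu) measurableSet_Ioi
  have hv : IntegrableOn ((fun u : ℝ => u ^ β) * fun u =>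
      -(a * ((1 + u) ^ (-2 : ℤ) * Real.exp (-(a * (u / (1 + u))))))) (Set.Ioi 0) := by
    refine IntegrableOn.congr_fun (hi'.const_mul (-a)) (fun u _ => ?_) measurableSet_Ioi
    simp only [Pi.mul_apply]
    ring
  have hu' : IntegrableOn ((fun u : ℝ => β * u ^ (β - 1)) * satExp a) (Set.Ioi 0) := by
    refine IntegrableOn.congr_fun ((integrableOn_rpow_mul_satExp ha h0 h1).const_mul β)
      (fun u _ => ?_) measurableSet_Ioi
    simp only [Pi.mul_apply]
    ring
  -- Both boundary terms of u^β `satExp a u` vanish: at 0 because β > 0, at infinity because β < 1.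
  have hparts := integral_Ioi_mul_deriv_eq_deriv_mul (a := 0) (u := fun u : ℝ => u ^ β)
    (u' := fun u : ℝ => β * u ^ (β - 1)) (v := satExp a)
    (v' := fun u => -(a * ((1 + u) ^ (-2 : ℤ) * Real.exp (-(a * (u / (1 + u)))))))
    (fun u hu => Real.hasDerivAt_rpow_const (Or.inl (ne_of_gt hu)))
    (fun u hu => hasDerivAt_satExp hu) hv hu' (tendsto_rpow_mul_satExp_zero h0)
    (tendsto_rpow_mul_satExp_atTop ha h1)
  rw [integral_Ioo_eq_integral_Ioi_div_one_add,
    setIntegral_congr_fun measurableSet_Ioi (fun u hu => beta_exp_div_one_add hu)]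
  simp only [mul_neg, mul_left_comm _ a, mul_assoc β, integral_neg, integral_const_mul, sub_zero,
    zero_sub, neg_inj] at hparts
  exact hparts.symm

theorem integrableOn_rpow_mul_satExp_div (ha : 0 < a) (h0 : 0 < β) (h1 : β < 1) {κ : ℝ}
    (hκ : 0 < κ) : IntegrableOn (fun x => x ^ (β - 1) * satExp a (x / κ)) (Set.Ioi 0) := by
  have h := (integrableOn_Ioi_comp_mul_left_iff (fun u => u ^ (β - 1) * satExp a u) 0
    (inv_pos.2 hκ)).2 (by simpa using integrableOn_rpow_mul_satExp ha h0 h1)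
  refine IntegrableOn.congr_fun (h.const_mul (κ ^ (β - 1))) (fun x hx => ?_) measurableSet_Ioi
  have hx0 : (0 : ℝ) < x := hx
  have hp : κ ^ (β - 1) ≠ 0 := by positivity
  rw [Real.mul_rpow (by positivity) hx0.le, Real.inv_rpow hκ.le, inv_mul_eq_div]
  field_simp

theorem integral_rpow_mul_satExp_div (a β : ℝ) {κ : ℝ} (hκ : 0 < κ) :
    ∫ x in Set.Ioi (0 : ℝ), x ^ (β - 1) * satExp a (x / κ) =
      κ ^ β * ∫ u in Set.Ioi (0 : ℝ), u ^ (β - 1) * satExp a u := by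
  have h := integral_comp_mul_left_Ioi (fun u => u ^ (β - 1) * satExp a u) 0 (inv_pos.2 hκ)
  rw [mul_zero, inv_inv, smul_eq_mul] at h
  rw [show κ ^ β = κ ^ (β - 1) * κ by
    rw [← Real.rpow_add_one hκ.ne', sub_add_cancel], mul_assoc, ← h, ← integral_const_mul]
  refine setIntegral_congr_fun measurableSet_Ioi fun x hx => ?_
  have hx0 : (0 : ℝ) < x := hx
  have hp : κ ^ (β - 1) ≠ 0 := by positivity
  rw [Real.mul_rpow (by positivity) hx0.le, Real.inv_rpow hκ.le, inv_mul_eq_div]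
  field_simp

end SatExp

/-! ### Transfer of the asymptotics at the origin, and uniqueness of the leading exponent. -/

/-- Abelian theorem: the behaviour of `h` at the origin determines that of its multiplicative
convolution with `g`. -/
theorem tendsto_rpow_mul_integral_comp_mul {h g : ℝ → ℝ} {β C h₀ : ℝ}
    (hm : ∀ φ : ℝ, AEStronglyMeasurable (fun x => h (φ * x)) (volume.restrict (Set.Ioi 0)))
    (hgm : Measurable g)
    (hb : ∀ x, 0 < x → |h x| ≤ C * x ^ (β - 1))
    (hlim : Tendsto (fun x => x ^ (1 - β) * h x) (𝓝[>] 0) (𝓝 h₀))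
    (hg : IntegrableOn (fun x => x ^ (β - 1) * g x) (Set.Ioi 0)) :
    Tendsto (fun φ => φ ^ (1 - β) * ∫ x in Set.Ioi (0 : ℝ), h (φ * x) * g x) (𝓝[>] 0)
      (𝓝 (h₀ * ∫ x in Set.Ioi (0 : ℝ), x ^ (β - 1) * g x)) := by
  simp only [← integral_const_mul]
  -- The normalisation φ^(1-β) isolates the bounded factor (φx)^(1-β) h(φx), which tends to h₀ for
  -- each x, against the integrable weight x^(β-1) g(x).
  have key : ∀ φ x : ℝ, 0 < φ → 0 < x → φ ^ (1 - β) * (h (φ * x) * g x) =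
      ((φ * x) ^ (1 - β) * h (φ * x)) * (x ^ (β - 1) * g x) := by
    intro φ x hφ hx
    have : x ^ (1 - β) * x ^ (β - 1) = 1 := by
      rw [← Real.rpow_add hx]; simp
    rw [Real.mul_rpow hφ.le hx.le]
    linear_combination (-(φ ^ (1 - β) * h (φ * x) * g x)) * this
  refine tendsto_integral_filter_of_dominated_convergence
    (fun x => C * ‖x ^ (β - 1) * g x‖) (Eventually.of_forall fun φ =>
      ((hm φ).mul hgm.aestronglyMeasurable).const_mul _) ?_ (hg.norm.const_mul C) ?_
  · filter_upwards [self_mem_nhdsWithin] with φ hφ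
    refine (ae_restrict_iff' measurableSet_Ioi).2 (ae_of_all _ fun x hx => ?_)
    have hφ0 : (0 : ℝ) < φ := hφ
    have hx0 : (0 : ℝ) < x := hx
    have hφx := mul_pos hφ0 hx0
    rw [key φ x hφ hx, norm_mul]
    gcongr
    rw [norm_mul, Real.norm_of_nonneg (by positivity), Real.norm_eq_abs]
    calc _ ≤ (φ * x) ^ (1 - β) * (C * (φ * x) ^ (β - 1)) := by gcongr; exact hb _ hφx
      _ = C * ((φ * x) ^ (1 - β) * (φ * x) ^ (β - 1)) := by ring
      _ = C := by rw [← Real.rpow_add hφx]; simp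
  · refine (ae_restrict_iff' measurableSet_Ioi).2 (ae_of_all _ fun x hx => ?_)
    have hx0 : (0 : ℝ) < x := hx
    have hscale : Tendsto (fun φ : ℝ => φ * x) (𝓝[>] 0) (𝓝[>] 0) := by
      refine tendsto_nhdsWithin_iff.2 ⟨?_, ?_⟩
      · have : Tendsto (fun φ : ℝ => φ * x) (𝓝 0) (𝓝 (0 * x)) := by
          exact (continuous_mul_const x).tendsto 0
        rw [zero_mul] at this
        exact this.mono_left nhdsWithin_le_nhds
      · filter_upwards [self_mem_nhdsWithin] with φ hφ
        exact mul_pos hφ hx0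
    refine ((hlim.comp hscale).mul_const _).congr' ?_
    filter_upwards [self_mem_nhdsWithin] with φ hφ
    exact (key φ x hφ hx0).symm

/-- Equal exponents 𝓑_i/B_i = 𝓑_k/B_k would make 𝓑_k - 𝓑_i B_k/B_i equal to 0, the case r = 0
excluded by simplicity. Hence the minimum is attained only once. -/
theorem FoxParams.exists_leading {m n p q : ℕ} (P : FoxParams m n p q) (hm : 1 ≤ m) (hmq : m ≤ q)
    (hB : ∀ i, 0 < P.B i)
    (hsimple : ∀ i k : Fin q, i.val < m → k.val < m → k ≠ i → ∀ r : ℕ,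
      P.calB k - P.calB i * (P.B k / P.B i) ≠ -(r : ℝ)) :
    ∃ i₀ : Fin q, i₀.val < m ∧ ∀ k : Fin q, k.val < m → k ≠ i₀ → P.expo i₀ < P.expo k := by
  obtain ⟨i₀, hi₀, hmin⟩ := Finset.exists_min_image ({i : Fin q | i.val < m} : Finset (Fin q)) P.expo
    ⟨⟨0, by omega⟩, by simp; omega⟩
  simp only [Finset.mem_filter, Finset.mem_univ, true_and] at hi₀ hmin
  refine ⟨i₀, hi₀, fun k hk hne => (hmin k hk).lt_of_ne fun heq => ?_⟩
  refine hsimple i₀ k hi₀ hk hne 0 ?_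
  have hk0 := (hB k).ne'
  have h : P.calB k = P.expo k * P.B k := by rw [FoxParams.expo]; field_simp
  have h' : P.calB i₀ * (P.B k / P.B i₀) = P.expo i₀ * P.B k := by rw [FoxParams.expo]; ring
  rw [h, h', heq]
  simp

/-! ### Reduction of the ASEP to integrals of the excess, and the ceiling. -/

theorem measurable_sinr (ω ϱ τ : ℝ) : Measurable (sinr ω ϱ τ) := by
  unfold sinr; fun_prop

theorem measurable_expNeg (d : ℝ≥0∞) : Measurable (expNeg d) := by
  unfold expNeg
  split_ifs <;> fun_prop

theorem measurable_sep {N : ℕ} (θ : Fin (N + 1) → ℝ) (δ : Fin (N + 1) → ℝ≥0∞) :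
    Measurable (sep θ δ) :=
  Finset.measurable_fun_sum _ fun k _ => (measurable_expNeg (δ k)).const_mul (θ k)

theorem expNeg_sinr {d : ℝ≥0∞} (hd : d ≠ ⊤) {ω ϱ τ x : ℝ} (hϱ : 0 < ϱ) (hτ : 0 < τ) (hx : 0 < x) :
    expNeg d (sinr ω ϱ τ x) =
      expNeg d (ω / ϱ) + satExp (d.toReal * ω / ϱ) (x / (τ / ϱ)) := by
  rw [expNeg, if_neg hd, expNeg, if_neg hd, satExp, sinr]
  have e1 : d.toReal * (ω / (ϱ + τ / x)) =
      d.toReal * ω / ϱ * (x / (τ / ϱ) / (1 + x / (τ / ϱ))) := by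
    field_simp
    ring
  have e2 : d.toReal * (ω / ϱ) = d.toReal * ω / ϱ := by ring
  rw [e1, e2]
  ring

theorem sep_sinr {N : ℕ} (θ : Fin (N + 1) → ℝ) (δ : Fin (N + 1) → ℝ≥0∞) {ω ϱ τ x : ℝ}
    (hϱ : 0 < ϱ) (hτ : 0 < τ) (hx : 0 < x) :
    sep θ δ (sinr ω ϱ τ x) = asepCeiling ω ϱ θ δ +
      ∑ k : Fin (N + 1) with δ k ≠ ⊤, θ k * satExp ((δ k).toReal * ω / ϱ) (x / (τ / ϱ)) := by
  rw [sep, asepCeiling, Finset.sum_filter, ← Finset.sum_add_distrib]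
  refine Finset.sum_congr rfl fun k _ => ?_
  split_ifs with h
  · rw [expNeg_sinr h hϱ hτ hx, mul_add]
  · rw [not_not] at h
    simp [expNeg, h]

theorem integrableOn_mul_satExp_div {f : ℝ → ℝ} (hf : IntegrableOn f (Set.Ioi 0)) {a κ : ℝ}
    (ha : 0 < a) (hκ : 0 < κ) : IntegrableOn (fun x => f x * satExp a (x / κ)) (Set.Ioi 0) := by
  refine hf.norm.mono' (hf.aestronglyMeasurable.mul
    ((measurable_satExp a).comp (by fun_prop : Measurable fun x : ℝ => x / κ)).aestronglyMeasurable)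
    ((ae_restrict_iff' measurableSet_Ioi).2 (ae_of_all _ fun x hx => ?_))
  have hx' : 0 < x / κ := div_pos hx hκ
  rw [norm_mul, Real.norm_of_nonneg (satExp_nonneg ha hx')]
  exact mul_le_of_le_one_right (norm_nonneg _) (satExp_le_one ha hx')

theorem asep_eq_asepCeiling_add {m n p q L N : ℕ} (P : Fin L → FoxParams m n p q) (c : Fin L → ℝ)
    {ω ϱ τ : ℝ} (hω : 0 < ω) (hϱ : 0 < ϱ) (hτ : 0 < τ)
    (θ : Fin (N + 1) → ℝ) {δ : Fin (N + 1) → ℝ≥0∞} (hδ : ∀ k, 0 < δ k) (ψ φ : Fin L → ℝ)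
    (hnn : ∀ x, 0 < x → 0 ≤ snrPdf P c ψ φ x)
    (hone : ∫ x in Set.Ioi 0, snrPdf P c ψ φ x = 1) :
    asep P c ω ϱ τ θ δ ψ φ = asepCeiling ω ϱ θ δ + ∑ k : Fin (N + 1) with δ k ≠ ⊤, θ k *
      ∫ x in Set.Ioi 0, snrPdf P c ψ φ x * satExp ((δ k).toReal * ω / ϱ) (x / (τ / ϱ)) := by
  -- A function that is not integrable has integral 0 by convention, so total mass 1 already gives
  -- integrability.
  have hf : IntegrableOn (snrPdf P c ψ φ) (Set.Ioi 0) :=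
    Integrable.of_integral_ne_zero (by rw [hone]; exact one_ne_zero)
  have hae : ∀ᵐ x ∂(volume.restrict (Set.Ioi (0 : ℝ))), 0 < x := ae_restrict_mem measurableSet_Ioi
  rw [asep, integral_map (measurable_sinr ω ϱ τ).aemeasurable
    (measurable_sep θ δ).aestronglyMeasurable, snrLaw,
    integral_withDensity_eq_integral_toReal_smul₀ hf.aestronglyMeasurable.aemeasurable.ennreal_ofReal
      (ae_of_all _ fun x => ENNReal.ofReal_lt_top)]
  have e1 : ∫ x in Set.Ioi 0, (ENNReal.ofReal (snrPdf P c ψ φ x)).toReal • sep θ δ (sinr ω ϱ τ x) =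
      ∫ x in Set.Ioi 0, (asepCeiling ω ϱ θ δ * snrPdf P c ψ φ x + ∑ k : Fin (N + 1) with δ k ≠ ⊤,
        θ k * (snrPdf P c ψ φ x * satExp ((δ k).toReal * ω / ϱ) (x / (τ / ϱ)))) := by
    refine setIntegral_congr_fun measurableSet_Ioi fun x hx => ?_
    have hx0 : (0 : ℝ) < x := hx
    rw [ENNReal.toReal_ofReal (hnn x hx0), sep_sinr θ δ hϱ hτ hx0, smul_eq_mul, mul_add,
      mul_comm _ (asepCeiling ω ϱ θ δ), Finset.mul_sum]
    congr 1
    exact Finset.sum_congr rfl fun k _ => by ring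
  have hk : ∀ k ∈ ({k : Fin (N + 1) | δ k ≠ ⊤} : Finset (Fin (N + 1))), Integrable (fun x => θ k *
      (snrPdf P c ψ φ x * satExp ((δ k).toReal * ω / ϱ) (x / (τ / ϱ))))
      (volume.restrict (Set.Ioi 0)) := by
    intro k hk
    simp only [Finset.mem_filter, Finset.mem_univ, true_and] at hk
    have := ENNReal.toReal_pos (hδ k).ne' hk
    exact (integrableOn_mul_satExp_div hf (by positivity) (by positivity)).const_mul _
  rw [e1, integral_add (hf.const_mul _) (integrable_finsetSum _ hk), integral_const_mul, hone,
    mul_one, integral_finsetSum _ hk]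
  simp only [integral_const_mul]

theorem aestronglyMeasurable_foxH_re_comp_mul {m n p q : ℕ} {P : FoxParams m n p q} {c : ℝ}
    (hc : P.IsContour c) (φ : ℝ) :
    AEStronglyMeasurable (fun x => (P.foxH c (φ * x)).re) (volume.restrict (Set.Ioi 0)) :=
  Complex.continuous_re.comp_aestronglyMeasurable (aestronglyMeasurable_mellinInv_mul hc.2 _ φ)

/-- A family of mixtures of dilated functions, each of them bounded by an integrable power at the
origin, spreads out to infinity. -/
theorem tendsto_integral_mul_satExp_div {ι : Type*} {l : Filter ι} {L : ℕ} {h : Fin L → ℝ → ℝ}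
    {f : ι → ℝ → ℝ} {ψ φ : ι → Fin L → ℝ} {β C : Fin L → ℝ} {a κ : ℝ} (ha : 0 < a) (hκ : 0 < κ)
    (hβ : ∀ ℓ, 0 < β ℓ) (hb : ∀ ℓ x, 0 < x → |h ℓ x| ≤ C ℓ * x ^ (β ℓ - 1))
    (hf : ∀ t x, f t x = ∑ ℓ, ψ t ℓ * h ℓ (φ t ℓ * x))
    (hψ : ∀ t ℓ, 0 < ψ t ℓ) (hφ : ∀ t ℓ, 0 < φ t ℓ)
    (hnn : ∀ t x, 0 < x → 0 ≤ f t x) (hone : ∀ t, ∫ x in Set.Ioi 0, f t x = 1)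
    (hφ_zero : ∀ ℓ, Tendsto (fun t => φ t ℓ) l (𝓝 0))
    (hψφ : ∀ ℓ, (fun t => ψ t ℓ / φ t ℓ) =O[l] fun _ => (1 : ℝ)) :
    Tendsto (fun t => ∫ x in Set.Ioi 0, f t x * satExp a (x / κ)) l (𝓝 0) := by
  have hint : ∀ t, IntegrableOn (f t) (Set.Ioi 0) := fun t =>
    Integrable.of_integral_ne_zero (by rw [hone]; exact one_ne_zero)
  -- the mass on a bounded interval
  have hmass : ∀ M : ℝ, 0 < M → Tendsto (fun t => ∑ ℓ, ψ t ℓ / φ t ℓ *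
      (C ℓ * φ t ℓ ^ β ℓ * (M ^ β ℓ / β ℓ))) l (𝓝 0) := by
    intro M hM
    rw [← Finset.sum_const_zero (ι := Fin L) (s := Finset.univ)]
    refine tendsto_finsetSum _ fun ℓ _ => ?_
    have h1 : Tendsto (fun t => C ℓ * φ t ℓ ^ β ℓ * (M ^ β ℓ / β ℓ)) l (𝓝 0) := by
      have := (((Real.continuousAt_rpow_const 0 (β ℓ) (Or.inr (hβ ℓ).le)).tendsto.comp
        (hφ_zero ℓ)).const_mul (C ℓ)).mul_const (M ^ β ℓ / β ℓ)
      simpa [Real.zero_rpow (hβ ℓ).ne', Function.comp_def] using this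
    have h2 := (hψφ ℓ).mul_isLittleO ((isLittleO_one_iff ℝ).2 h1)
    simp only [mul_one] at h2
    exact (isLittleO_one_iff ℝ).1 h2
  -- On (0,M] the excess is at most 1 and the mass of f is estimated through the powers. Beyond M
  -- the mass is at most 1 and the excess is at most a/(1+M/κ).
  have hle : ∀ M : ℝ, 0 < M → ∀ t, ∫ x in Set.Ioi 0, f t x * satExp a (x / κ) ≤
      a / (1 + M / κ) + ∑ ℓ, ψ t ℓ / φ t ℓ * (C ℓ * φ t ℓ ^ β ℓ * (M ^ β ℓ / β ℓ)) := by
    intro M hM t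
    have hpow : ∀ ℓ, IntegrableOn (fun x : ℝ => ψ t ℓ * (C ℓ * (φ t ℓ ^ (β ℓ - 1) *
        x ^ (β ℓ - 1)))) (Set.Ioc 0 M) := fun ℓ =>
      ((((intervalIntegrable_iff_integrableOn_Ioc_of_le hM.le).1
        (intervalIntegral.intervalIntegrable_rpow' (by linarith [hβ ℓ]))).const_mul _).const_mul
          _).const_mul _
    have hval : ∀ ℓ, ∫ x in Set.Ioc 0 M, ψ t ℓ * (C ℓ * (φ t ℓ ^ (β ℓ - 1) * x ^ (β ℓ - 1))) =
        ψ t ℓ / φ t ℓ * (C ℓ * φ t ℓ ^ β ℓ * (M ^ β ℓ / β ℓ)) := by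
      intro ℓ
      rw [integral_const_mul, integral_const_mul, integral_const_mul,
        ← intervalIntegral.integral_of_le hM.le,
        integral_rpow (Or.inl (by linarith [hβ ℓ])), sub_add_cancel, Real.zero_rpow (hβ ℓ).ne',
        Real.rpow_sub_one (hφ t ℓ).ne']
      ring
    have hsmall : ∫ x in Set.Ioc 0 M, f t x ≤
        ∑ ℓ, ψ t ℓ / φ t ℓ * (C ℓ * φ t ℓ ^ β ℓ * (M ^ β ℓ / β ℓ)) := by
      simp only [← hval]
      rw [← integral_finsetSum _ fun ℓ _ => hpow ℓ]
      refine setIntegral_mono_on ((hint t).mono_set Set.Ioc_subset_Ioi_self)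
        (integrable_finsetSum _ fun ℓ _ => hpow ℓ) measurableSet_Ioc fun x hx => ?_
      rw [hf]
      refine Finset.sum_le_sum fun ℓ _ => ?_
      have := (hψ t ℓ).le
      gcongr
      rw [← Real.mul_rpow (hφ t ℓ).le hx.1.le]
      exact (le_abs_self _).trans (hb ℓ _ (mul_pos (hφ t ℓ) hx.1))
    have hi := integrableOn_mul_satExp_div (hint t) ha hκ
    have hI1 : ∫ x in Set.Ioc 0 M, f t x * satExp a (x / κ) ≤ ∫ x in Set.Ioc 0 M, f t x := by
      refine setIntegral_mono_on (hi.mono_set Set.Ioc_subset_Ioi_self)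
        ((hint t).mono_set Set.Ioc_subset_Ioi_self) measurableSet_Ioc fun x hx => ?_
      exact mul_le_of_le_one_right (hnn t x hx.1) (satExp_le_one ha (div_pos hx.1 hκ))
    have hI2 : ∫ x in Set.Ioi M, f t x * satExp a (x / κ) ≤ a / (1 + M / κ) := by
      have hsub : Set.Ioi M ⊆ Set.Ioi 0 := Set.Ioi_subset_Ioi hM.le
      calc _ ≤ ∫ x in Set.Ioi M, f t x * (a / (1 + M / κ)) := by
            refine setIntegral_mono_on (hi.mono_set hsub) (((hint t).mono_set hsub).mul_const _)
              measurableSet_Ioi fun x hx => ?_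
            have hx0 : 0 < x := hsub hx
            have hxM : M ≤ x := le_of_lt hx
            have := hnn t x hx0
            gcongr
            refine (satExp_le_div ha (div_pos hx0 hκ)).trans ?_
            gcongr
        _ = (∫ x in Set.Ioi M, f t x) * (a / (1 + M / κ)) := integral_mul_const _ _
        _ ≤ 1 * (a / (1 + M / κ)) := by
            gcongr
            rw [← hone t]
            exact setIntegral_mono_set (hint t)
              ((ae_restrict_iff' measurableSet_Ioi).2 (ae_of_all _ fun x hx => hnn t x hx))
              (LE.le.eventuallyLE hsub)
        _ = _ := one_mul _
    rw [← Set.Ioc_union_Ioi_eq_Ioi hM.le, setIntegral_union Set.Ioc_disjoint_Ioi_same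
      measurableSet_Ioi (hi.mono_set Set.Ioc_subset_Ioi_self)
      (hi.mono_set (Set.Ioi_subset_Ioi hM.le))]
    linarith
  have hnonneg : ∀ t, 0 ≤ ∫ x in Set.Ioi 0, f t x * satExp a (x / κ) := fun t =>
    setIntegral_nonneg measurableSet_Ioi fun x hx =>
      mul_nonneg (hnn t x hx) (satExp_nonneg ha (div_pos hx hκ))
  rw [Metric.tendsto_nhds]
  intro ε hε
  have hMlim : Tendsto (fun M : ℝ => a / (1 + M / κ)) atTop (𝓝 0) :=
    Tendsto.div_atTop tendsto_const_nhds
      (tendsto_atTop_add_const_left _ _ (tendsto_id.atTop_div_const hκ))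
  -- M is fixed first, to make the tail small uniformly in t; only then does t move along the
  -- filter.
  obtain ⟨M, hM0, hMε⟩ := ((eventually_gt_atTop 0).and
    (hMlim.eventually (gt_mem_nhds (half_pos hε)))).exists
  filter_upwards [(hmass M hM0).eventually (gt_mem_nhds (half_pos hε))] with t ht
  rw [Real.dist_eq, sub_zero, abs_of_nonneg (hnonneg t)]
  linarith [hle M hM0 t]

/-! ### First-order expansion of the correction. -/

namespace FoxParams

variable {m n p q : ℕ}

theorem isLittleO_integral_foxH_mul_satExp (P : FoxParams m n p q) (hA : ∀ i, 0 < P.A i)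
    (hB : ∀ i, 0 < P.B i) {c : ℝ} (hc : P.IsContour c) (hΔ : 0 < P.aStar ∨ 0 ≤ P.delta)
    {i₀ : Fin q} (hi₀ : i₀.val < m) (h𝓑 : 0 < P.calB i₀)
    (hmin : ∀ k : Fin q, k.val < m → k ≠ i₀ → P.expo i₀ < P.expo k) (h1 : P.expo i₀ < 1)
    {a κ : ℝ} (ha : 0 < a) (hκ : 0 < κ) :
    (fun φ : ℝ => (∫ x in Set.Ioi (0 : ℝ), (P.foxH c (φ * x)).re * satExp a (x / κ)) -
      φ⁻¹ * ∑ i : Fin q with i.val < m, φ ^ P.expo i * (P.coeffF i * P.expo i *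
        ∫ x in Set.Ioi (0 : ℝ), x ^ (P.expo i - 1) * satExp a (x / κ))) =o[𝓝[>] 0]
      fun φ => φ⁻¹ * ∑ i : Fin q with i.val < m, φ ^ P.expo i := by
  have h0 : 0 < P.expo i₀ := div_pos h𝓑 (hB i₀)
  obtain ⟨C, hC, hb⟩ := P.norm_foxH_le hA hB hc hΔ hi₀ h𝓑 hmin
  have hlim := tendsto_rpow_mul_integral_comp_mul (aestronglyMeasurable_foxH_re_comp_mul hc)
    ((measurable_satExp a).comp (by fun_prop : Measurable fun x : ℝ => x / κ))
    (fun x hx => (Complex.abs_re_le_norm _).trans (hb x hx))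
    (P.tendsto_rpow_mul_foxH hA hB hc hΔ hi₀ h𝓑 hmin)
    (integrableOn_rpow_mul_satExp_div ha h0 h1 hκ)
  simp only [Function.comp_def] at hlim
  set T : Fin q → ℝ := fun i => P.coeffF i * P.expo i *
    ∫ x in Set.Ioi (0 : ℝ), x ^ (P.expo i - 1) * satExp a (x / κ) with hT
  set J : ℝ → ℝ := fun φ =>
    ∫ x in Set.Ioi (0 : ℝ), (P.foxH c (φ * x)).re * satExp a (x / κ) with hJ
  -- The non-leading terms of the sum vanish relative to φ^(β-1) with β = `P.expo i₀`, whatever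
  -- their constants T i are; they need not match further terms of the expansion of H.
  have hrest : Tendsto (fun φ : ℝ => ∑ i : Fin q with i.val < m ∧ i ≠ i₀,
      φ ^ (P.expo i - P.expo i₀) * T i) (𝓝[>] 0) (𝓝 0) := by
    rw [← Finset.sum_const_zero (ι := Fin q)
      (s := ({i : Fin q | i.val < m ∧ i ≠ i₀} : Finset (Fin q)))]
    refine tendsto_finsetSum _ fun i hi => ?_
    simp only [Finset.mem_filter, Finset.mem_univ, true_and] at hi
    have hpos := sub_pos.2 (hmin i hi.1 hi.2)
    have := ((Real.continuousAt_rpow_const 0 _ (Or.inr hpos.le)).tendsto.mono_left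
      (nhdsWithin_le_nhds (s := Set.Ioi 0))).mul_const (T i)
    simpa [Real.zero_rpow hpos.ne'] using this
  have hins : ({i : Fin q | i.val < m} : Finset (Fin q)) =
      insert i₀ ({i : Fin q | i.val < m ∧ i ≠ i₀} : Finset (Fin q)) := by
    ext i
    by_cases hi : i = i₀
    · subst hi; simp [hi₀]
    · simp [hi]
  have hbr : Tendsto (fun φ : ℝ => φ ^ (1 - P.expo i₀) * J φ - T i₀ -
      ∑ i : Fin q with i.val < m ∧ i ≠ i₀, φ ^ (P.expo i - P.expo i₀) * T i) (𝓝[>] 0) (𝓝 0) := by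
    have := (hlim.sub_const (T i₀)).sub hrest
    simpa [hT, hJ] using this
  -- All summands are nonnegative, so the comparison sum dominates its leading term.
  have hlead : (fun φ : ℝ => φ ^ (P.expo i₀ - 1)) =O[𝓝[>] 0]
      fun φ => φ⁻¹ * ∑ i : Fin q with i.val < m, φ ^ P.expo i := by
    refine IsBigO.of_bound 1 ?_
    filter_upwards [self_mem_nhdsWithin] with φ hφ
    have hφ0 : (0 : ℝ) < φ := hφ
    rw [one_mul, Real.norm_of_nonneg (by positivity), Real.norm_of_nonneg (by positivity),
      Real.rpow_sub_one hφ0.ne', div_eq_inv_mul]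
    gcongr
    exact Finset.single_le_sum (f := fun i => φ ^ P.expo i) (fun i _ => by positivity)
      (Finset.mem_filter.2 ⟨Finset.mem_univ _, hi₀⟩)
  have hprod := (hlead.mul_isLittleO ((isLittleO_one_iff ℝ).2 hbr))
  simp only [mul_one] at hprod
  refine hprod.congr' ?_ EventuallyEq.rfl
  filter_upwards [self_mem_nhdsWithin] with φ hφ
  have hφ0 : (0 : ℝ) < φ := hφ
  rw [hins, Finset.sum_insert (by simp), mul_sub, mul_sub, mul_add, ← mul_assoc,
    ← Real.rpow_add hφ0, Finset.mul_sum, Finset.mul_sum, ← sub_sub]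
  have e1 : P.expo i₀ - 1 + (1 - P.expo i₀) = 0 := by ring
  rw [e1, Real.rpow_zero, one_mul, Real.rpow_sub_one hφ0.ne']
  congr 1
  · congr 1; ring
  · refine Finset.sum_congr rfl fun i _ => ?_
    rw [Real.rpow_sub hφ0]
    have : φ ^ P.expo i₀ ≠ 0 := by positivity
    simp only [hT]
    field_simp

end FoxParams

/-- Integrability of the mixture f does not give that of its separate components. This lets the
integral be split over ℓ. -/
theorem FoxParams.integrableOn_foxH_mul_satExp {m n p q : ℕ} (P : FoxParams m n p q) {c C r φ : ℝ}
    (hc : P.IsContour c) (hb : ∀ x : ℝ, 0 < x → ‖P.foxH c x‖ ≤ C * x ^ (r - 1))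
    (h0 : 0 < r) (h1 : r < 1) (hφ : 0 < φ) {a κ : ℝ} (ha : 0 < a) (hκ : 0 < κ) :
    IntegrableOn (fun x => (P.foxH c (φ * x)).re * satExp a (x / κ)) (Set.Ioi 0) := by
  refine ((integrableOn_rpow_mul_satExp_div ha h0 h1 hκ).const_mul (C * φ ^ (r - 1))).mono'
    ((aestronglyMeasurable_foxH_re_comp_mul hc φ).mul ((measurable_satExp a).comp
      (by fun_prop : Measurable fun x : ℝ => x / κ)).aestronglyMeasurable)
    ((ae_restrict_iff' measurableSet_Ioi).2 (ae_of_all _ fun x hx => ?_))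
  have hx0 : (0 : ℝ) < x := hx
  have hs := satExp_nonneg ha (div_pos hx0 hκ)
  rw [norm_mul, Real.norm_of_nonneg hs, ← mul_assoc, mul_assoc C, ← Real.mul_rpow hφ.le hx0.le]
  gcongr
  exact (Complex.abs_re_le_norm _).trans (hb _ (mul_pos hφ hx0))

/-- Γ(β) cancels in the value of 𝐇_β, the factor δ_k ω/ϱ is the a from the integration by parts, and
(τ/ϱ)^β comes from the dilation by κ. In particular the correction is real. -/
theorem asepCorrection_eq {m n p q L N : ℕ} (P : Fin L → FoxParams m n p q)
    (hB : ∀ ℓ i, 0 < (P ℓ).B i) (h𝓑 : ∀ ℓ, ∀ i : Fin q, i.val < m → 0 < (P ℓ).calB i)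
    {ω ϱ τ : ℝ} (hω : 0 < ω) (hϱ : 0 < ϱ) (hτ : 0 < τ) (θ : Fin (N + 1) → ℝ)
    {δ : Fin (N + 1) → ℝ≥0∞} (hδ : ∀ k, 0 < δ k) {σ ν : Fin L → Fin q → ℝ}
    (hcont : ∀ ℓ, ∀ i : Fin q, i.val < m → ∀ k, δ k ≠ ⊤ →
      (asepBivParams ((P ℓ).expo i)).IsContour (σ ℓ i) (ν ℓ i)
        (((δ k).toReal * ω / ϱ : ℝ) : ℂ) (-1))
    (ψ : Fin L → ℝ) {φ : Fin L → ℝ} (hφ : ∀ ℓ, 0 < φ ℓ) :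
    asepCorrection P σ ν ω ϱ τ θ δ ψ φ = ((∑ ℓ, ψ ℓ * ∑ k : Fin (N + 1) with δ k ≠ ⊤, θ k *
      ((φ ℓ)⁻¹ * ∑ i : Fin q with i.val < m, φ ℓ ^ (P ℓ).expo i *
        ((P ℓ).coeffF i * (P ℓ).expo i * ∫ x in Set.Ioi (0 : ℝ), x ^ ((P ℓ).expo i - 1) *
          satExp ((δ k).toReal * ω / ϱ) (x / (τ / ϱ)))) : ℝ) : ℂ) := by
  rw [asepCorrection, Complex.ofReal_sum, Finset.mul_sum]
  refine Finset.sum_congr rfl fun ℓ _ => ?_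
  rw [Complex.ofReal_mul, Complex.ofReal_sum, Finset.mul_sum, Finset.mul_sum, Finset.mul_sum]
  refine Finset.sum_congr rfl fun k hk => ?_
  simp only [Finset.mem_filter, Finset.mem_univ, true_and] at hk
  rw [Complex.ofReal_mul, Complex.ofReal_mul, Complex.ofReal_mul, Complex.ofReal_sum]
  simp only [Finset.mul_sum]
  refine Finset.sum_congr rfl fun i hi => ?_
  simp only [Finset.mem_filter, Finset.mem_univ, true_and] at hi
  have hd := ENNReal.toReal_pos (hδ k).ne' hk
  have ha : 0 < (δ k).toReal * ω / ϱ := by positivity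
  have hc := hcont ℓ i hi k hk
  have h1 := lt_one_of_isContour ha hc
  have h0 : 0 < (P ℓ).expo i := div_pos (h𝓑 ℓ i hi) (hB ℓ i)
  have hφ0 := hφ ℓ
  rw [asepBivParams_foxH_eq h1 ha hc, integral_rpow_mul_satExp_div _ _ (by positivity : 0 < τ / ϱ)]
  have hI := mul_integral_rpow_mul_satExp ha h0 h1
  have hΓ := (Real.Gamma_pos_of_pos h0).ne'
  have hpow : (φ ℓ * τ / ϱ) ^ (P ℓ).expo i = φ ℓ ^ (P ℓ).expo i * (τ / ϱ) ^ (P ℓ).expo i := by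
    rw [mul_div_assoc, Real.mul_rpow hφ0.le (by positivity)]
  norm_cast
  rw [hpow]
  generalize (∫ w in Set.Ioo (0 : ℝ) 1, w ^ (P ℓ).expo i * (1 - w) ^ (-(P ℓ).expo i) *
    Real.exp (-((δ k).toReal * ω / ϱ * w))) = I at hI
  generalize (∫ u in Set.Ioi (0 : ℝ), u ^ ((P ℓ).expo i - 1) *
    satExp ((δ k).toReal * ω / ϱ) u) = J at hI
  generalize φ ℓ ^ (P ℓ).expo i = X
  generalize (τ / ϱ) ^ (P ℓ).expo i = Y
  calc _ = ψ ℓ / φ ℓ * θ k * (P ℓ).coeffF i * X * Y * ((δ k).toReal * ω / ϱ * I) := by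
        field_simp
    _ = _ := by rw [← hI]; ring

/-! ### Assembly. -/

theorem proposition4 {m n p q L N : ℕ} (hm : 1 ≤ m) (hmq : m ≤ q) (hnp : n ≤ p)
    -- the Fox H-functions of the fading model and their contours
    (P : Fin L → FoxParams m n p q) (c : Fin L → ℝ)
    (hA : ∀ ℓ i, 0 < (P ℓ).A i) (hB : ∀ ℓ i, 0 < (P ℓ).B i)
    (hc : ∀ ℓ, (P ℓ).IsContour (c ℓ))
    (h𝓑 : ∀ ℓ, ∀ i : Fin q, i.val < m → 0 < (P ℓ).calB i)
    (hΔ : ∀ ℓ, 0 < (P ℓ).aStar ∨ 0 ≤ (P ℓ).delta)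
    (hsimple : ∀ ℓ, ∀ i k : Fin q, i.val < m → k.val < m → k ≠ i → ∀ r : ℕ,
      (P ℓ).calB k - (P ℓ).calB i * ((P ℓ).B k / (P ℓ).B i) ≠ -(r : ℝ))
    -- the impairment parameters and the coefficients of the symbol error probability
    (ω ϱ τ : ℝ) (hω : 0 < ω) (hϱ : 0 < ϱ) (hτ : 0 < τ)
    (θ : Fin (N + 1) → ℝ) (δ : Fin (N + 1) → ℝ≥0∞)
    (hθ : ∀ k, 0 < θ k) (hδ : ∀ k, 0 < δ k) (hδ_fin : ∃ k, δ k ≠ ⊤)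
    -- the high-SNR regime
    {ι : Type*} (l : Filter ι) (ψ φ : ι → Fin L → ℝ)
    (hψ : ∀ t ℓ, 0 < ψ t ℓ) (hφ : ∀ t ℓ, 0 < φ t ℓ)
    (hpdf_nonneg : ∀ t x, 0 < x → 0 ≤ snrPdf P c (ψ t) (φ t) x)
    (hpdf_one : ∀ t, ∫ x in Set.Ioi 0, snrPdf P c (ψ t) (φ t) x = 1)
    (hφ_zero : ∀ ℓ, Tendsto (fun t => φ t ℓ) l (𝓝 0))
    (hψφ : ∀ ℓ, (fun t => ψ t ℓ / φ t ℓ) =O[l] fun _ => (1 : ℝ)) :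
    Tendsto (fun t => asep P c ω ϱ τ θ δ (ψ t) (φ t)) l (𝓝 (asepCeiling ω ϱ θ δ)) ∧
    ∀ σ ν : Fin L → Fin q → ℝ,
      (∀ ℓ, ∀ i : Fin q, i.val < m → ∀ k, δ k ≠ ⊤ →
        (asepBivParams ((P ℓ).expo i)).IsContour (σ ℓ i) (ν ℓ i)
          (((δ k).toReal * ω / ϱ : ℝ) : ℂ) (-1)) →
      ((fun t => (asep P c ω ϱ τ θ δ (ψ t) (φ t) : ℂ)) ~[l]
        fun t => (asepCeiling ω ϱ θ δ : ℂ) + asepCorrection P σ ν ω ϱ τ θ δ (ψ t) (φ t)) ∧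
      (fun t => (asep P c ω ϱ τ θ δ (ψ t) (φ t) : ℂ) -
          ((asepCeiling ω ϱ θ δ : ℂ) + asepCorrection P σ ν ω ϱ τ θ δ (ψ t) (φ t))) =o[l]
        fun t => ∑ ℓ, ψ t ℓ / φ t ℓ * ∑ i : Fin q with i.val < m, φ t ℓ ^ (P ℓ).expo i := by
  choose i₀ hi₀ hmin using fun ℓ => (P ℓ).exists_leading hm hmq (hB ℓ) (hsimple ℓ)
  choose C hC hb using fun ℓ => (P ℓ).norm_foxH_le (hA ℓ) (hB ℓ) (hc ℓ) (hΔ ℓ) (hi₀ ℓ)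
    (h𝓑 ℓ _ (hi₀ ℓ)) (hmin ℓ)
  have hβ : ∀ ℓ, ∀ i : Fin q, i.val < m → 0 < (P ℓ).expo i := fun ℓ i hi =>
    div_pos (h𝓑 ℓ i hi) (hB ℓ i)
  have hκ : 0 < τ / ϱ := by positivity
  set a : Fin (N + 1) → ℝ := fun k => (δ k).toReal * ω / ϱ with ha_def
  have ha : ∀ k, δ k ≠ ⊤ → 0 < a k := fun k hk => by
    have := ENNReal.toReal_pos (hδ k).ne' hk
    simp only [ha_def]
    positivity
  have hasep := fun t => asep_eq_asepCeiling_add P c hω hϱ hτ θ hδ (ψ t) (φ t)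
    (hpdf_nonneg t) (hpdf_one t)
  have hlim : Tendsto (fun t => asep P c ω ϱ τ θ δ (ψ t) (φ t)) l (𝓝 (asepCeiling ω ϱ θ δ)) := by
    simp only [hasep]
    have h0 : Tendsto (fun t => ∑ k : Fin (N + 1) with δ k ≠ ⊤, θ k *
        ∫ x in Set.Ioi 0, snrPdf P c (ψ t) (φ t) x * satExp (a k) (x / (τ / ϱ))) l (𝓝 0) := by
      refine (tendsto_finsetSum _ fun k hk => ?_).trans_eq (congrArg 𝓝 Finset.sum_const_zero)
      simp only [Finset.mem_filter, Finset.mem_univ, true_and] at hk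
      simpa only [mul_zero] using (tendsto_integral_mul_satExp_div
        (f := fun t => snrPdf P c (ψ t) (φ t)) (ha k hk) hκ (fun ℓ => hβ ℓ _ (hi₀ ℓ))
        (fun ℓ x hx => (Complex.abs_re_le_norm _).trans (hb ℓ x hx)) (fun t x => rfl)
        hψ hφ hpdf_nonneg hpdf_one hφ_zero hψφ).const_mul (θ k)
    simpa using h0.const_add (asepCeiling ω ϱ θ δ)
  refine ⟨hlim, fun σ ν hcont => ?_⟩
  obtain ⟨k₀, hk₀⟩ := hδ_fin
  -- Convergence of the double integral at a single finite δ_k suffices to force β < 1.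
  have hlt : ∀ ℓ, (P ℓ).expo (i₀ ℓ) < 1 := fun ℓ =>
    lt_one_of_isContour (ha k₀ hk₀) (hcont ℓ _ (hi₀ ℓ) k₀ hk₀)
  have hcorr := fun t => asepCorrection_eq P hB h𝓑 hω hϱ hτ θ hδ hcont (ψ t) (hφ t)
  set S : ι → ℝ := fun t =>
    ∑ ℓ, ψ t ℓ / φ t ℓ * ∑ i : Fin q with i.val < m, φ t ℓ ^ (P ℓ).expo i with hS
  have hterm : ∀ t ℓ, 0 ≤ ψ t ℓ / φ t ℓ * ∑ i : Fin q with i.val < m, φ t ℓ ^ (P ℓ).expo i :=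
    fun t ℓ => by
      have := hψ t ℓ
      have := hφ t ℓ
      positivity
  have hdiff : (fun t => (asep P c ω ϱ τ θ δ (ψ t) (φ t) : ℂ) -
      ((asepCeiling ω ϱ θ δ : ℂ) + asepCorrection P σ ν ω ϱ τ θ δ (ψ t) (φ t))) =o[l] S := by
    -- The ceilings cancel and the error becomes a finite sum over ℓ and k of the single-component
    -- errors.
    have hreal : ∀ t, (asep P c ω ϱ τ θ δ (ψ t) (φ t) : ℂ) -
        ((asepCeiling ω ϱ θ δ : ℂ) + asepCorrection P σ ν ω ϱ τ θ δ (ψ t) (φ t)) =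
        ((∑ ℓ, ∑ k : Fin (N + 1) with δ k ≠ ⊤, θ k * (ψ t ℓ *
          ((∫ x in Set.Ioi (0 : ℝ), ((P ℓ).foxH (c ℓ) (φ t ℓ * x)).re *
            satExp (a k) (x / (τ / ϱ))) -
          (φ t ℓ)⁻¹ * ∑ i : Fin q with i.val < m, φ t ℓ ^ (P ℓ).expo i *
            ((P ℓ).coeffF i * (P ℓ).expo i * ∫ x in Set.Ioi (0 : ℝ), x ^ ((P ℓ).expo i - 1) *
              satExp (a k) (x / (τ / ϱ))))) : ℝ) : ℂ) := by
      intro t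
      rw [hcorr t, hasep t, Complex.ofReal_add, add_sub_add_left_eq_sub, ← Complex.ofReal_sub]
      congr 1
      rw [sub_eq_iff_eq_add, ← Finset.sum_add_distrib]
      simp only [Finset.mul_sum (s := ({k | δ k ≠ ⊤} : Finset (Fin (N + 1)))),
        ← Finset.sum_add_distrib]
      rw [Finset.sum_comm]
      refine Finset.sum_congr rfl fun k hk => ?_
      simp only [Finset.mem_filter, Finset.mem_univ, true_and] at hk
      have hsum : ∫ x in Set.Ioi 0, snrPdf P c (ψ t) (φ t) x * satExp (a k) (x / (τ / ϱ)) =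
          ∑ ℓ, ψ t ℓ * ∫ x in Set.Ioi (0 : ℝ), ((P ℓ).foxH (c ℓ) (φ t ℓ * x)).re *
            satExp (a k) (x / (τ / ϱ)) := by
        simp only [← integral_const_mul]
        rw [← integral_finsetSum _ fun ℓ _ => ((P ℓ).integrableOn_foxH_mul_satExp (hc ℓ) (hb ℓ)
          (hβ ℓ _ (hi₀ ℓ)) (hlt ℓ) (hφ t ℓ) (ha k hk) hκ).const_mul (ψ t ℓ)]
        refine setIntegral_congr_fun measurableSet_Ioi fun x _ => ?_
        simp only [snrPdf, Finset.sum_mul]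
        exact Finset.sum_congr rfl fun ℓ _ => by ring
      rw [hsum, Finset.mul_sum]
      exact Finset.sum_congr rfl fun ℓ _ => by ring
    simp only [hreal]
    refine Complex.isLittleO_ofReal_left.2 (IsLittleO.fun_sum fun ℓ _ => IsLittleO.fun_sum
      fun k hk => IsLittleO.const_mul_left ?_ _)
    simp only [Finset.mem_filter, Finset.mem_univ, true_and] at hk
    have hφ' : Tendsto (fun t => φ t ℓ) l (𝓝[>] 0) :=
      tendsto_nhdsWithin_iff.2 ⟨hφ_zero ℓ, Eventually.of_forall fun t => hφ t ℓ⟩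
    have hlo := ((P ℓ).isLittleO_integral_foxH_mul_satExp (hA ℓ) (hB ℓ) (hc ℓ) (hΔ ℓ) (hi₀ ℓ)
      (h𝓑 ℓ _ (hi₀ ℓ)) (hmin ℓ) (hlt ℓ) (ha k hk) hκ).comp_tendsto hφ'
    refine ((isBigO_refl (fun t => ψ t ℓ) l).mul_isLittleO hlo).trans_isBigO ?_
    -- ψ_ℓ times the comparison function of component ℓ is exactly the ℓ-th summand of S, which is
    -- nonnegative and hence at most S.
    refine IsBigO.of_bound 1 (Eventually.of_forall fun t => ?_)
    simp only [Function.comp_def]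
    rw [← mul_assoc, ← div_eq_mul_inv, one_mul, Real.norm_of_nonneg (hterm t ℓ),
      Real.norm_of_nonneg (Finset.sum_nonneg fun ℓ _ => hterm t ℓ)]
    exact Finset.single_le_sum (fun ℓ _ => hterm t ℓ) (Finset.mem_univ ℓ)
  refine ⟨?_, hdiff⟩
  have hS0 : Tendsto S l (𝓝 0) := by
    rw [← Finset.sum_const_zero (ι := Fin L) (s := Finset.univ)]
    refine tendsto_finsetSum _ fun ℓ _ => ?_
    have h1 : Tendsto (fun t => ∑ i : Fin q with i.val < m, φ t ℓ ^ (P ℓ).expo i) l (𝓝 0) := by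
      rw [← Finset.sum_const_zero (ι := Fin q) (s := ({i | i.val < m} : Finset (Fin q)))]
      refine tendsto_finsetSum _ fun i hi => ?_
      simp only [Finset.mem_filter, Finset.mem_univ, true_and] at hi
      have := (Real.continuousAt_rpow_const 0 _ (Or.inr (hβ ℓ i hi).le)).tendsto.comp (hφ_zero ℓ)
      rwa [Real.zero_rpow (hβ ℓ i hi).ne'] at this
    have h2 := (hψφ ℓ).mul_isLittleO ((isLittleO_one_iff ℝ).2 h1)
    simp only [mul_one] at h2
    exact (isLittleO_one_iff ℝ).1 h2
  -- A finite δ_k makes the ceiling positive, so asymptotic equivalence reduces to both sides having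
  -- this common limit.
  have hceil : (asepCeiling ω ϱ θ δ : ℂ) ≠ 0 := by
    rw [Complex.ofReal_ne_zero]
    have hnn : ∀ k, 0 ≤ θ k * expNeg (δ k) (ω / ϱ) := fun k => by
      refine mul_nonneg (hθ k).le ?_
      unfold expNeg
      split_ifs <;> positivity
    refine (lt_of_lt_of_le ?_ (Finset.single_le_sum (fun k _ => hnn k) (Finset.mem_univ k₀))).ne'
    rw [expNeg, if_neg hk₀]
    have := hθ k₀
    positivity
  have hlimC : Tendsto (fun t => (asep P c ω ϱ τ θ δ (ψ t) (φ t) : ℂ)) l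
      (𝓝 (asepCeiling ω ϱ θ δ : ℂ)) := (Complex.continuous_ofReal.tendsto _).comp hlim
  have hlimR : Tendsto (fun t => (asepCeiling ω ϱ θ δ : ℂ) +
      asepCorrection P σ ν ω ϱ τ θ δ (ψ t) (φ t)) l (𝓝 (asepCeiling ω ϱ θ δ : ℂ)) := by
    have h := hlimC.sub ((isLittleO_one_iff ℝ).1 (hdiff.trans_isBigO (hS0.isBigO_one ℝ)))
    simpa using h
  exact ((isEquivalent_const_iff_tendsto hceil).2 hlimC).trans
    ((isEquivalent_const_iff_tendsto hceil).2 hlimR).symm
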